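/- **Setting.** Let $0<m<L$. A periodic rod diagram divides the $z$-axis into consecutive closed intervals (rods). Each rod is either an axis rod of kind $\phi$ (rod structure $(1,0)$), an axis rod of kind $\psi$ (rod structure $(0,1)$), or a horizon rod. A common end point of two axis rods is a corner; a common end point of an axis rod and a horizon rod is a pole. Consider the following five diagrams, given by their period $P$ and the rods in one period. 1. (Black rings) $P=2L$: $[-2L+m,-m]$ of kind $\phi$, $[-m,m]$ horizon. 2. (Soliton) $P=2L$: $[0,L]$ of kind $\phi$, $[L,2L]$ of kind $\psi$. 3. (Spheres) $P=2L$: $[-L,-m]$ of kind $\psi$, $[-m,m]$ horizon, $[m,L]$ of kind $\phi$. 4. (Double spheres) $P=4L$: $[-2L+m,-m]$ of kind $\phi$, $[-m,m]$ horizon, $[m,2L-m]$ of kind $\psi$, $[2L-m,2L+m]$ horizon. 5. (Black Saturns) $P=6L$: $[-2L-m,-2L+m]$ horizon, $[-2L+m,-m]$ of kind $\psi$, $[-m,m]$ horizon, $[m,2L-m]$ of kind $\psi$, $[2L-m,2L+m]$ horizon, $[2L+m,4L-m]$ of kind $\phi$. For an interval $I=[a,b]$ put $U_I=\log(r_a-z_a)-\log(r_b-z_b)$,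 where $z_a=z-a$, $r_a=\sqrt{\rho^2+z_a^2}$. On $\{\rho>0\}$ let $$u=k_u+\lim_{n\to\infty}\Big(\sum_{j=-n}^{n}\ \sum_{I}U_{I+jP}+\tfrac{2\ell_\phi}{P}\log n\Big),$$ where $I$ runs over the axis rods of kind $\phi$ in the period above, $\ell_\phi$ is their total length, and $k_u$ is a constant. Let $v$ be defined in the same way with the axis rods of kind $\psi$ and a constant $k_v$. Let $\alpha$ be a solution of $$\alpha_\rho=\tfrac{\rho}{4}\big[u_\rho^2-u_z^2+v_\rho^2-v_z^2+u_\rho v_\rho-u_zv_z-\tfrac{2}{\rho}(u_\rho+v_\rho)\big],$$ $$\alpha_z=\tfrac{\rho}{4}\big[2u_\rho u_z+2v_\rho v_z+u_\rho v_z+u_zv_\rho-\tfrac{2}{\rho}(u_z+v_z)\big].$$ These data define the static bi-axisymmetric metric $$g=-e^{-u-v}\rho^2dt^2+e^{2\alpha}(d\rho^2+dz^2)+e^u d\phi^2+e^v d\psi^2,\qquad \rho>0,$$ where $\phi,\psi$ have period $2\pi$. Call $(u,v,\alpha)$ balanced if no axis rod carries a conical singularity, that is, if at every interior point of every axis rod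 of kind $\phi$ (respectively $\psi$) one has $\lim_{\rho\to0}\big(\log\rho+\alpha-\tfrac12u\big)=0$ (respectively $\lim_{\rho\to0}\big(\log\rho+\alpha-\tfrac12v\big)=0$). **Theorem.** For each of the five diagrams and all $0<m<L$, balanced $(u,v,\alpha)$ exist. For every balanced $(u,v,\alpha)$, every degeneracy of $g$ is only a coordinate singularity. More precisely, $g$ is a smooth Lorentzian metric for $\rho>0$; the rods cover the $z$-axis and every end point of a rod is shared by a neighboring rod; adjacent axis rods are of different kinds, and both neighbors of a horizon rod are axis rods. Moreover: * *Axis rods.* Near every interior point of an axis rod of kind $\phi$, $g$ extends to a smooth $t$- and $\psi$-independent Lorentzian metric across the rod in the coordinates $(t,x,y,z,\psi)$, $x=\rho\cos\phi$, $y=\rho\sin\phi$; likewise for kind $\psi$ with the two angles exchanged. * *Corners.* Near every corner $z_0$, put $\rho=\xi\eta$, $z=z_0\pm\tfrac12(\xi^2-\eta^2)$, $\xi,\eta>0$, with the sign $+$ if the rod of kind $\phi$ lies to the north ($z>z_0$) and $-$ if it lies to the south. Then $g$ extends to a smooth $t$-independent Lorentzian metric across the corner in the coordinates $(t,\eta\cos\phi,\eta\sin\phi,\xi\cos\psi,\xi\sin\psi)$.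 * *Horizon rods and poles.* For every horizon rod $[a,b]$ there is a constant $c>0$ such that the following hold. * In the Kruskal coordinates $(X,Y,z,\phi,\psi)$, $XY=\rho^2$, $X/Y=e^{2ct}$, $g$ extends from $\{X,Y>0,\ a<z<b\}$ to a smooth Lorentzian metric, independent of $\phi,\psi$, on an open set containing $\{XY\ge0,\ a<z<b\}$. * At each of the two poles $z_0\in\{a,b\}$, put $\rho=2\xi\eta$, $z=z_0\pm(\xi^2-\eta^2)$, $\xi,\eta>0$, with the sign $+$ at $b$ and $-$ at $a$. If the adjacent axis rod is of kind $\phi$, then $g$ extends to a smooth $\psi$-independent Lorentzian metric on a neighborhood $\{|XY|<\delta^2,\ x^2+y^2<\delta^2\}$ of the pole in the coordinates $(X,Y,x,y,\psi)$, $XY=\xi^2$, $X/Y=e^{2ct}$, $x=\eta\cos\phi$, $y=\eta\sin\phi$; likewise for kind $\psi$ with the angles exchanged. * In all these extensions $\partial_t$ becomes the Killing field $K=c(X\partial_X-Y\partial_Y)$, and $\{X=0\}$ and $\{Y=0\}$ are Killing horizons of $K$, i.e. null hypersurfaces with normal $K$ away from the zeros $X=Y=0$ of $K$. -/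

import Mathlib

open Filter Topology Set
open scoped Matrix

noncomputable section

namespace StaticWeyl

/-! ### Rod diagrams -/

/-- The two angular Killing fields: `phi` stands for rod structure `(1,0)`, `psi` for `(0,1)`. -/
inductive Angle
  | phi
  | psi
  deriving DecidableEq

/-- A rod of the `z`-axis is an axis rod, on which one of the two rotational Killing fields
vanishes, or a horizon rod. -/
inductive RodKind
  | axis (i : Angle)
  | horizon
  deriving DecidableEq

/-- A rod: the interval `[a, b]` of the `z`-axis together with its kind. -/
structure Rod where
  a : ℝ
  b : ℝ
  kind : RodKind

/-- The translate of a rod by `s` along the `z`-axis. -/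
def Rod.shift (R : Rod) (s : ℝ) : Rod := ⟨R.a + s, R.b + s, R.kind⟩

/-- A periodic rod diagram: the period and the list of rods in one period cell. -/
structure RodDiagram where
  period : ℝ
  cell : List Rod

namespace RodDiagram

/-- All rods of the diagram: the translates of the rods in the cell by multiples of the period. -/
def rods (D : RodDiagram) : Set Rod :=
  {R | ∃ R₀ ∈ D.cell, ∃ j : ℤ, R = R₀.shift (j * D.period)}

/-- The total length of the axis rods of kind `i` in one period. -/
def axisLength (D : RodDiagram) (i : Angle) : ℝ :=
  (D.cell.map fun R => if R.kind = .axis i then R.b - R.a else 0).sum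

end RodDiagram

/-- The five families of examples. -/
inductive Family
  | blackRings
  | soliton
  | spheres
  | doubleSpheres
  | blackSaturns

/-- The rod diagrams of the five families, with parameters `0 < m < L`.
The soliton does not depend on `m`. -/
def Family.diagram (L m : ℝ) : Family → RodDiagram
  | .blackRings => ⟨2 * L,
      [⟨-2 * L + m, -m, .axis .phi⟩, ⟨-m, m, .horizon⟩]⟩
  | .soliton => ⟨2 * L,
      [⟨0, L, .axis .phi⟩, ⟨L, 2 * L, .axis .psi⟩]⟩
  | .spheres => ⟨2 * L,
      [⟨-L, -m, .axis .psi⟩, ⟨-m, m, .horizon⟩, ⟨m, L, .axis .phi⟩]⟩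
  | .doubleSpheres => ⟨4 * L,
      [⟨-2 * L + m, -m, .axis .phi⟩, ⟨-m, m, .horizon⟩,
       ⟨m, 2 * L - m, .axis .psi⟩, ⟨2 * L - m, 2 * L + m, .horizon⟩]⟩
  | .blackSaturns => ⟨6 * L,
      [⟨-2 * L - m, -2 * L + m, .horizon⟩, ⟨-2 * L + m, -m, .axis .psi⟩,
       ⟨-m, m, .horizon⟩, ⟨m, 2 * L - m, .axis .psi⟩,
       ⟨2 * L - m, 2 * L + m, .horizon⟩, ⟨2 * L + m, 4 * L - m, .axis .phi⟩]⟩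

/-! ### The solutions: functions of `(ρ, z)` on the half plane `ρ > 0` -/

/-- The potential `U_I = log (r_a - z_a) - log (r_b - z_b)` of the interval `I = [a, b]`. -/
def rodPotential (a b ρ z : ℝ) : ℝ :=
  Real.log (√(ρ ^ 2 + (z - a) ^ 2) - (z - a)) - Real.log (√(ρ ^ 2 + (z - b) ^ 2) - (z - b))

/-- The `n`-th renormalized partial sum of the potentials of the axis rods of kind `i`. -/
def partialPotential (D : RodDiagram) (i : Angle) (n : ℕ) (ρ z : ℝ) : ℝ :=
  ∑ j ∈ Finset.Icc (-(n : ℤ)) n,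
    (D.cell.map fun R => if R.kind = .axis i then
      rodPotential (R.a + j * D.period) (R.b + j * D.period) ρ z else 0).sum
  + 2 * D.axisLength i / D.period * Real.log n

/-- `w` is, up to an additive constant, the renormalized series of the potentials of the axis rods
of kind `i`. -/
def IsRenormalizedPotential (D : RodDiagram) (i : Angle) (w : ℝ → ℝ → ℝ) : Prop :=
  ∃ k : ℝ, ∀ ρ z : ℝ, 0 < ρ →
    Tendsto (fun n : ℕ => partialPotential D i n ρ z + k) atTop (𝓝 (w ρ z))

/-- Partial derivative in `ρ`. -/
def dρ (w : ℝ → ℝ → ℝ) (ρ z : ℝ) : ℝ := deriv (fun s => w s z) ρ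

/-- Partial derivative in `z`. -/
def dz (w : ℝ → ℝ → ℝ) (ρ z : ℝ) : ℝ := deriv (fun s => w ρ s) z

/-- `α` is obtained from `u, v` by quadrature. -/
def IsQuadrature (u v α : ℝ → ℝ → ℝ) : Prop :=
  ∀ ρ z : ℝ, 0 < ρ →
    HasDerivAt (fun s => α s z)
      (ρ / 4 * (dρ u ρ z ^ 2 - dz u ρ z ^ 2 + dρ v ρ z ^ 2 - dz v ρ z ^ 2
        + dρ u ρ z * dρ v ρ z - dz u ρ z * dz v ρ z - 2 / ρ * (dρ u ρ z + dρ v ρ z))) ρ ∧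
    HasDerivAt (fun s => α ρ s)
      (ρ / 4 * (2 * dρ u ρ z * dz u ρ z + 2 * dρ v ρ z * dz v ρ z
        + dρ u ρ z * dz v ρ z + dz u ρ z * dρ v ρ z - 2 / ρ * (dz u ρ z + dz v ρ z))) z

/-- The logarithm of the norm squared of the rotational Killing field `i`. -/
def fiber (u v : ℝ → ℝ → ℝ) : Angle → ℝ → ℝ → ℝ
  | .phi => u
  | .psi => v

/-- Absence of conical singularities: the logarithmic angle defect vanishes at every interior
point of every axis rod. -/
def IsBalanced (D : RodDiagram) (u v α : ℝ → ℝ → ℝ) : Prop :=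
  ∀ R ∈ D.rods, ∀ i : Angle, R.kind = .axis i → ∀ z ∈ Ioo R.a R.b,
    Tendsto (fun ρ => Real.log ρ + α ρ z - fiber u v i ρ z / 2) (𝓝[>] 0) (𝓝 0)

/-- The balanced solutions with the given rod diagram. -/
structure IsBalancedSolution (D : RodDiagram) (u v α : ℝ → ℝ → ℝ) : Prop where
  potential_u : IsRenormalizedPotential D .phi u
  potential_v : IsRenormalizedPotential D .psi v
  quadrature : IsQuadrature u v α
  balanced : IsBalanced D u v α

/-! ### Metrics in coordinates -/

/-- Coordinate space. -/
abbrev E := Fin 5 → ℝ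

/-- A field of bilinear forms, by its coefficient matrices. -/
abbrev MetricField := E → Matrix (Fin 5) (Fin 5) ℝ

/-- The metric in Weyl-Papapetrou coordinates `(t, ρ, z, φ, ψ)`:
`-ρ² e^{-u-v} dt² + e^{2α} (dρ² + dz²) + e^u dφ² + e^v dψ²`. -/
def weylMetric (u v α : ℝ → ℝ → ℝ) : MetricField := fun q =>
  Matrix.diagonal ![
    -(Real.exp (-u (q 1) (q 2) - v (q 1) (q 2)) * q 1 ^ 2),
    Real.exp (2 * α (q 1) (q 2)),
    Real.exp (2 * α (q 1) (q 2)),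
    Real.exp (u (q 1) (q 2)),
    Real.exp (v (q 1) (q 2))]

/-- `G` is a smooth metric of signature `(-,+,+,+,+)` on `W`. -/
structure IsLorentzianOn (G : MetricField) (W : Set E) : Prop where
  smooth : ∀ i j, ContDiffOn ℝ ((⊤ : ℕ∞) : WithTop ℕ∞) (fun p => G p i j) W
  symm : ∀ p ∈ W, (G p).IsSymm
  signature : ∀ p ∈ W, ∃ P : Matrix (Fin 5) (Fin 5) ℝ, IsUnit P.det ∧
    Pᵀ * G p * P = Matrix.diagonal ![-1, 1, 1, 1, 1]

/-- The Jacobian matrix of a map. -/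
def jacobian (F : E → E) (q : E) : Matrix (Fin 5) (Fin 5) ℝ :=
  LinearMap.toMatrix' (fderiv ℝ F q : E →ₗ[ℝ] E)

/-- The pullback `F^* G`. -/
def pullback (F : E → E) (G : MetricField) : MetricField := fun q =>
  (jacobian F q)ᵀ * G (F q) * jacobian F q

/-- `G` is a smooth Lorentzian metric on the open set `W` which represents `g` in new coordinates:
on the parameter domain `U`, the old coordinates are `A q` and the new ones are `B q`. -/
structure IsSmoothExtension (g : MetricField) (A B : E → E) (U W : Set E) (G : MetricField) :
    Prop where
  isOpen : IsOpen W
  mapsTo : MapsTo B U W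
  lorentzian : IsLorentzianOn G W
  agrees : ∀ q ∈ U, pullback A g q = pullback B G q

/-- `G` does not depend on the `i`-th coordinate. -/
def IsIndependentOf (G : MetricField) (W : Set E) (i : Fin 5) : Prop :=
  ∀ p ∈ W, ∀ s : ℝ, p + Pi.single i s ∈ W ∧ G (p + Pi.single i s) = G p

/-- The Killing equation `L_K G = 0` on `W`. -/
def IsKillingField (G : MetricField) (W : Set E) (K : E → E) : Prop :=
  ∀ p ∈ W, ∀ i j : Fin 5,
    fderiv ℝ (fun x => G x i j) p (K p)
      + ∑ k, (G p k j * fderiv ℝ K p (Pi.single i 1) k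
        + G p i k * fderiv ℝ K p (Pi.single j 1) k) = 0

/-- The field `c (X ∂_X - Y ∂_Y)`, where `X, Y` are the first two coordinates. -/
def boost (c : ℝ) : E → E := fun p => ![c * p 0, -(c * p 1), 0, 0, 0]

/-- In coordinates `(X, Y, …)` on `W`, the hypersurfaces `Y = 0` and `X = 0` are null with normal
the Killing field `K = c (X ∂_X - Y ∂_Y)`: `K` is orthogonal to every tangent vector, hence
(being tangent) null. `K` vanishes on these hypersurfaces only where `X = Y = 0`. -/
structure IsKillingHorizon (G : MetricField) (W : Set E) (c : ℝ) : Prop where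
  killing : IsKillingField G W (boost c)
  future : ∀ p ∈ W, p 1 = 0 → ∀ w : E, w 1 = 0 → boost c p ⬝ᵥ (G p *ᵥ w) = 0
  past : ∀ p ∈ W, p 0 = 0 → ∀ w : E, w 0 = 0 → boost c p ⬝ᵥ (G p *ᵥ w) = 0

/-- `∂_t` (the zeroth coordinate field on `U`) is represented by `c (X ∂_X - Y ∂_Y)`. -/
def TimeIsBoost (B : E → E) (U : Set E) (c : ℝ) : Prop :=
  ∀ q ∈ U, fderiv ℝ B q (Pi.single 0 1) = boost c (B q)

/-! ### Interior of an axis rod -/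

/-- Weyl coordinates to `(t, x, y, z, other angle)`, where `(ρ, vanishing angle)` are polar
coordinates (angles of period `2π`) for `(x, y)`. -/
def axisChart : Angle → E → E
  | .phi, q => ![q 0, q 1 * Real.cos (q 3), q 1 * Real.sin (q 3), q 2, q 4]
  | .psi, q => ![q 0, q 1 * Real.cos (q 4), q 1 * Real.sin (q 4), q 2, q 3]

/-- The metric extends smoothly across the point `z₀` of an axis rod of kind `i`. -/
def ExtendsAcrossAxis (g : MetricField) (i : Angle) (z₀ : ℝ) : Prop :=
  ∃ δ > 0, ∃ G : MetricField,
    IsSmoothExtension g id (axisChart i)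
      {q | 0 < q 1 ∧ q 1 < δ ∧ |q 2 - z₀| < δ}
      {p | p 1 ^ 2 + p 2 ^ 2 < δ ^ 2 ∧ |p 3 - z₀| < δ} G ∧
    IsIndependentOf G {p | p 1 ^ 2 + p 2 ^ 2 < δ ^ 2 ∧ |p 3 - z₀| < δ} 0 ∧
    IsIndependentOf G {p | p 1 ^ 2 + p 2 ^ 2 < δ ^ 2 ∧ |p 3 - z₀| < δ} 4

/-! ### Corners -/

/-- `(t, ξ, η, φ, ψ)` to Weyl coordinates with `ρ = ξ η`, `z = z₀ + σ (ξ² - η²) / 2`. If `σ = 1`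
then `η = 0` is the part of the axis with `z ≥ z₀`; if `σ = -1`, that with `z ≤ z₀`. -/
def cornerWeyl (z₀ σ : ℝ) : E → E := fun q =>
  ![q 0, q 1 * q 2, z₀ + σ * (q 1 ^ 2 - q 2 ^ 2) / 2, q 3, q 4]

/-- `(t, ξ, η, φ, ψ)` to `(t, η cos φ, η sin φ, ξ cos ψ, ξ sin ψ)`. -/
def cornerChart : E → E := fun q =>
  ![q 0, q 2 * Real.cos (q 3), q 2 * Real.sin (q 3), q 1 * Real.cos (q 4), q 1 * Real.sin (q 4)]

/-- The metric extends smoothly across the corner `z₀`; the `phi`-rod lies to the north (`σ = 1`)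
or to the south (`σ = -1`). -/
def ExtendsAcrossCorner (g : MetricField) (z₀ σ : ℝ) : Prop :=
  ∃ δ > 0, ∃ G : MetricField,
    IsSmoothExtension g (cornerWeyl z₀ σ) cornerChart
      {q | 0 < q 1 ∧ q 1 < δ ∧ 0 < q 2 ∧ q 2 < δ}
      {p | p 1 ^ 2 + p 2 ^ 2 < δ ^ 2 ∧ p 3 ^ 2 + p 4 ^ 2 < δ ^ 2} G ∧
    IsIndependentOf G {p | p 1 ^ 2 + p 2 ^ 2 < δ ^ 2 ∧ p 3 ^ 2 + p 4 ^ 2 < δ ^ 2} 0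

/-! ### Horizon rods and poles -/

/-- Weyl coordinates to Kruskal coordinates `(X, Y, z, φ, ψ)`, `X Y = ρ²`, `X / Y = e^{2 c t}`. -/
def horizonChart (c : ℝ) : E → E := fun q =>
  ![q 1 * Real.exp (c * q 0), q 1 * Real.exp (-(c * q 0)), q 2, q 3, q 4]

/-- The metric extends smoothly across the interior of the horizon rod `[a, b]`, as a Killing
horizon of surface gravity `c`. -/
def ExtendsAcrossHorizon (g : MetricField) (a b c : ℝ) : Prop :=
  ∃ W : Set E, {p | 0 ≤ p 0 * p 1 ∧ p 2 ∈ Ioo a b} ⊆ W ∧ ∃ G : MetricField,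
    IsSmoothExtension g id (horizonChart c) {q | 0 < q 1 ∧ q 2 ∈ Ioo a b} W G ∧
    IsIndependentOf G W 3 ∧ IsIndependentOf G W 4 ∧
    IsKillingHorizon G W c ∧
    TimeIsBoost (horizonChart c) {q | 0 < q 1 ∧ q 2 ∈ Ioo a b} c

/-- `(t, ξ, η, φ, ψ)` to Weyl coordinates with `ρ = 2 ξ η`, `z = z₀ + σ (ξ² - η²)`. If `σ = 1`
then `η = 0` is the part of the axis with `z ≥ z₀`; if `σ = -1`, that with `z ≤ z₀`. -/
def poleWeyl (z₀ σ : ℝ) : E → E := fun q =>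
  ![q 0, 2 * q 1 * q 2, z₀ + σ * (q 1 ^ 2 - q 2 ^ 2), q 3, q 4]

/-- `(t, ξ, η, φ, ψ)` to `(X, Y, x, y, other angle)` with `X Y = ξ²`, `X / Y = e^{2 c t}`, and
`(η, vanishing angle)` polar coordinates for `(x, y)`. -/
def poleChart (c : ℝ) : Angle → E → E
  | .phi, q => ![q 1 * Real.exp (c * q 0), q 1 * Real.exp (-(c * q 0)),
      q 2 * Real.cos (q 3), q 2 * Real.sin (q 3), q 4]
  | .psi, q => ![q 1 * Real.exp (c * q 0), q 1 * Real.exp (-(c * q 0)),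
      q 2 * Real.cos (q 4), q 2 * Real.sin (q 4), q 3]

/-- The metric extends smoothly across the pole `z₀` between a horizon rod and an axis rod of kind
`i`, which lies to the north (`σ = 1`) or to the south (`σ = -1`) of the pole; the horizon of
surface gravity `c` extends through the pole as a Killing horizon. -/
def ExtendsAcrossPole (g : MetricField) (i : Angle) (z₀ σ c : ℝ) : Prop :=
  ∃ δ > 0, ∃ G : MetricField,
    IsSmoothExtension g (poleWeyl z₀ σ) (poleChart c i)
      {q | 0 < q 1 ∧ q 1 < δ ∧ 0 < q 2 ∧ q 2 < δ}
      {p | |p 0 * p 1| < δ ^ 2 ∧ p 2 ^ 2 + p 3 ^ 2 < δ ^ 2} G ∧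
    IsIndependentOf G {p | |p 0 * p 1| < δ ^ 2 ∧ p 2 ^ 2 + p 3 ^ 2 < δ ^ 2} 4 ∧
    IsKillingHorizon G {p | |p 0 * p 1| < δ ^ 2 ∧ p 2 ^ 2 + p 3 ^ 2 < δ ^ 2} c ∧
    TimeIsBoost (poleChart c i) {q | 0 < q 1 ∧ q 1 < δ ∧ 0 < q 2 ∧ q 2 < δ} c

/-! ### Geometric regularity -/

/-- Every degeneracy of the Weyl-Papapetrou form of the metric is a coordinate singularity. -/
structure IsGeometricallyRegular (D : RodDiagram) (u v α : ℝ → ℝ → ℝ) : Prop where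
  /-- The rods fill the `z`-axis. -/
  cover : ∀ z : ℝ, ∃ R ∈ D.rods, z ∈ Icc R.a R.b
  /-- Every rod has a neighbor at both ends, so that each end point is a corner or a pole. -/
  neighbors : ∀ R ∈ D.rods, (∃ R' ∈ D.rods, R'.a = R.b) ∧ (∃ R' ∈ D.rods, R'.b = R.a)
  /-- There is no degeneracy away from the `z`-axis. -/
  offAxis : IsLorentzianOn (weylMetric u v α) {q | 0 < q 1}
  /-- Interior points of axis rods. -/
  axis : ∀ R ∈ D.rods, ∀ i : Angle, R.kind = .axis i → ∀ z ∈ Ioo R.a R.b,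
    ExtendsAcrossAxis (weylMetric u v α) i z
  /-- Corners: `R` is the rod to the south, `R'` the rod to the north. -/
  corner : ∀ R ∈ D.rods, ∀ R' ∈ D.rods, R.b = R'.a → ∀ i j : Angle,
    R.kind = .axis i → R'.kind = .axis j →
      i ≠ j ∧ ExtendsAcrossCorner (weylMetric u v α) R.b (if j = .phi then 1 else -1)
  /-- Horizon rods, with one surface gravity for the interior and the two poles. -/
  horizon : ∀ R ∈ D.rods, R.kind = .horizon → ∃ c > 0,
    ExtendsAcrossHorizon (weylMetric u v α) R.a R.b c ∧
    (∃ R' ∈ D.rods, R'.a = R.b ∧ ∃ i : Angle, R'.kind = .axis i ∧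
      ExtendsAcrossPole (weylMetric u v α) i R.b 1 c) ∧
    (∃ R' ∈ D.rods, R'.b = R.a ∧ ∃ i : Angle, R'.kind = .axis i ∧
      ExtendsAcrossPole (weylMetric u v α) i R.a (-1) c)

end StaticWeyl

end

/-!
All functions of `ρ` and `z` are written as functions of `s = ρ²` and `z`. In these variables
"smooth across the axis `ρ = 0`" means smooth in a neighborhood of `s = 0`, and an axisymmetric
function on `ℝ³` is harmonic if and only if it satisfies `axiLaplacian f = 0`.

**Potentials.** The potential of a rod is the Newtonian potential of a homogeneous segment. A
translate by `1 / ε` contributes `-|ε|` times the length plus `ε²` times a function that is smooth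
in `ε` up to `ε = 0`, so the series, renormalized by the logarithm, converges to a function that is
smooth and harmonic away from the rods (`exists_tail`, `isAxiHarmonicAt_periodicPotential`). Hence
near a rod a potential is `log ρ²`, if the rod is of its kind, plus a smooth function
(`exists_smooth_part_rod`), and near a common end point `z₀` of two rods it is a combination of
`log (r + (z - z₀))` and `log (r - (z - z₀))` plus a smooth function
(`exists_smooth_part_endpoint`).

**The function `α`.** For harmonic `u` and `v` the right hand side of the quadrature is a closed
form (`quadrature_closed`). Near a rod its singular terms cancel, because the coefficients
`(e₁, e₂)` of the logarithms satisfy `e₁² + e₂² + e₁ e₂ = e₁ + e₂`. Thus `α` extends smoothly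
across the axis, and on the rod it equals `u / 2`, `v / 2` (in both cases with the logarithm
removed) or `-(u + v) / 2`, for an axis rod of kind `φ`, of kind `ψ` or a horizon rod, up to a
constant (`exists_rod_extension`). The constant is the logarithmic angle defect of an axis rod, and
minus the logarithm of the surface gravity of a horizon rod. Near an end point, parabolic
coordinates with `ρ² = p q` turn the two logarithms above into `log p` and `log q`. There
`2 α + log (p + q)` extends smoothly (`exists_endpoint_extension`), and its values at `p = 0` and
at `q = 0` are tied to the constants of the two rods (`endpoint_boundary_value`).

**Extension of the metric.** In Cartesian coordinates about an axis rod, or in Kruskal coordinates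
about a horizon rod, the singular part of the metric is regular exactly when two smooth functions
agree on the rod. This is the boundary identity for `α`. By Hadamard's lemma their difference is
the defining function of the rod times a smooth function, and the metric is made of blocks
`e (dx² + dy²) + k (x dx + y dy)²` and `n dX dY + (k / 4) (Y dX + X dY)²` with smooth coefficients.
The signature follows from the determinants of the blocks (`signature_time_block`,
`signature_null_block`). See `extendsAcrossAxis`, `extendsAcrossHorizon`, `extendsAcrossCorner` and
`extendsAcrossPole`. The second block is invariant under the boosts
`(X, Y) ↦ (e^{cs} X, e^{-cs} Y)`, so the boost field is a Killing field, and it is null and normal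
to `X = 0` and `Y = 0`.

**Existence.** Each of the five diagrams is mapped to itself by a reflection of the axis, which
preserves or exchanges the two kinds. The reflection shows that `α`, which is periodic up to a
constant, is periodic, so the angle defect is the same on all axis rods of one kind. It is then
removed by the choice of the two constants `k_u` and `k_v` (`exists_isBalancedSolution`).
-/

namespace StaticWeyl

open MeasureTheory
open scoped ContDiff

/-! ### Parametric integrals -/

section Parametric

variable {E' : Type*} [NormedAddCommGroup E'] [NormedSpace ℝ E']

theorem contDiffAt_slice {K : ℝ → E' → ℝ} {y : ℝ} {x : E'}
    (h : ContDiffAt ℝ ∞ (Function.uncurry K) (y, x)) : ContDiffAt ℝ ∞ (K y) x :=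
  h.comp x (contDiffAt_const.prodMk contDiffAt_id)

theorem contDiffAt_fderiv_slice {K : ℝ → E' → ℝ} {y : ℝ} {x : E'} (v : E')
    (h : ContDiffAt ℝ ∞ (Function.uncurry K) (y, x)) :
    ContDiffAt ℝ ∞ (Function.uncurry fun y x => fderiv ℝ (K y) x v) (y, x) := by
  have h1 : ContDiffAt ℝ ∞ (Function.uncurry fun (q : ℝ × E') (x : E') => K q.1 x)
      ((y, x), (y, x).2) :=
    ContDiffAt.comp (f := fun q : (ℝ × E') × E' => (q.1.1, q.2)) (g := Function.uncurry K)
      ((y, x), x) h (by fun_prop)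
  exact (ContDiffAt.fderiv (g := Prod.snd) h1 contDiffAt_snd le_rfl).clm_apply contDiffAt_const

variable [FiniteDimensional ℝ E'] {μ : Measure ℝ} [IsFiniteMeasureOnCompacts μ] {C : Set ℝ}
  {O : Set E'} {K : ℝ → E' → ℝ}

theorem hasFDerivAt_setIntegral (hC : IsCompact C) (hO : IsOpen O)
    (hK : ∀ y ∈ C, ∀ x ∈ O, ContDiffAt ℝ ∞ (Function.uncurry K) (y, x)) {x : E'} (hx : x ∈ O) :
    IntegrableOn (fun y => fderiv ℝ (K y) x) C μ ∧
    HasFDerivAt (fun x => ∫ y in C, K y x ∂μ) (∫ y in C, fderiv ℝ (K y) x ∂μ) x := by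
  have hcont : ∀ x ∈ O, ContinuousOn (fun y => K y x) C := fun x hx y hy =>
    ((hK y hy x hx).continuousAt.comp (f := fun y => (y, x))
      (by fun_prop)).continuousWithinAt
  have hd : ∀ y ∈ C, ∀ x ∈ O, ContinuousAt (fun q : ℝ × E' => fderiv ℝ (K q.1) q.2) (y, x) := by
    intro y hy x hx
    have h1 : ContDiffAt ℝ ∞ (Function.uncurry fun (q : ℝ × E') (x : E') => K q.1 x)
        ((y, x), (y, x).2) :=
      ContDiffAt.comp (f := fun q : (ℝ × E') × E' => (q.1.1, q.2)) (g := Function.uncurry K)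
        ((y, x), x) (hK y hy x hx) (by fun_prop)
    exact (ContDiffAt.fderiv (m := 0) (n := ∞) (g := Prod.snd) h1 contDiffAt_snd
      (by simp)).continuousAt
  have hdc : ∀ x ∈ O, ContinuousOn (fun y => fderiv ℝ (K y) x) C := fun x hx y hy =>
    (ContinuousAt.comp (f := fun y => (y, x)) (hd y hy x hx) (by fun_prop)).continuousWithinAt
  obtain ⟨r, hr, hrO⟩ := Metric.nhds_basis_closedBall.mem_iff.1 (hO.mem_nhds hx)
  obtain ⟨M, hM⟩ := (hC.prod (isCompact_closedBall x r)).exists_bound_of_continuousOn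
    (f := fun q : ℝ × E' => fderiv ℝ (K q.1) q.2)
    (fun q hq => (hd q.1 hq.1 q.2 (hrO hq.2)).continuousWithinAt)
  refine ⟨(hdc x hx).integrableOn_compact hC, ?_⟩
  refine hasFDerivAt_integral_of_dominated_of_fderiv_le
    (F' := fun x y => fderiv ℝ (K y) x) (bound := fun _ => M)
    (Metric.closedBall_mem_nhds x hr) ?_ ?_ ?_ ?_ ?_ ?_
  · filter_upwards [hO.mem_nhds hx] with z hz
    exact (hcont z hz).aestronglyMeasurable_of_isCompact hC hC.measurableSet
  · exact (hcont x hx).integrableOn_compact hC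
  · exact (hdc x hx).aestronglyMeasurable_of_isCompact hC hC.measurableSet
  · filter_upwards [ae_restrict_mem hC.measurableSet] with y hy z hz
    exact hM (y, z) ⟨hy, hz⟩
  · exact integrableOn_const hC.measure_ne_top
  · filter_upwards [ae_restrict_mem hC.measurableSet] with y hy z hz
    exact ((contDiffAt_slice (hK y hy z (hrO hz))).differentiableAt (by simp)).hasFDerivAt

/-- Differentiation under the integral sign. -/
theorem fderiv_setIntegral_apply (hC : IsCompact C) (hO : IsOpen O)
    (hK : ∀ y ∈ C, ∀ x ∈ O, ContDiffAt ℝ ∞ (Function.uncurry K) (y, x)) {x : E'} (hx : x ∈ O)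
    (v : E') :
    fderiv ℝ (fun x => ∫ y in C, K y x ∂μ) x v = ∫ y in C, fderiv ℝ (K y) x v ∂μ := by
  obtain ⟨hi, h⟩ := hasFDerivAt_setIntegral (μ := μ) hC hO hK hx
  rw [h.fderiv, ContinuousLinearMap.integral_apply hi]

/-- An integral over a compact set of parameters of smooth functions is smooth. -/
theorem contDiffAt_setIntegral (hC : IsCompact C) (hO : IsOpen O)
    (hK : ∀ y ∈ C, ∀ x ∈ O, ContDiffAt ℝ ∞ (Function.uncurry K) (y, x)) {x : E'} (hx : x ∈ O) :
    ContDiffAt ℝ ∞ (fun x => ∫ y in C, K y x ∂μ) x := by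
  have key : ∀ n : ℕ, ∀ K : ℝ → E' → ℝ,
      (∀ y ∈ C, ∀ x ∈ O, ContDiffAt ℝ ∞ (Function.uncurry K) (y, x)) →
      ContDiffOn ℝ n (fun x => ∫ y in C, K y x ∂μ) O := by
    intro n
    -- The partial derivatives are integrals of the same form.
    induction n with
    | zero =>
      intro K hK
      refine contDiffOn_zero.2 fun x hx => ?_
      exact (hasFDerivAt_setIntegral (μ := μ) hC hO hK hx).2.continuousAt.continuousWithinAt
    | succ n ih =>
      intro K hK
      rw [Nat.cast_succ]
      refine contDiffOn_succ_of_fderiv_apply (fun x hx =>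
        (hasFDerivAt_setIntegral (μ := μ) hC hO hK hx).2.differentiableAt.differentiableWithinAt)
        (fun h => absurd h (by simp)) fun v => ?_
      refine (ih (fun y x => fderiv ℝ (K y) x v)
        fun y hy x hx => contDiffAt_fderiv_slice v (hK y hy x hx)).congr fun x hx => ?_
      rw [fderivWithin_of_isOpen hO hx, fderiv_setIntegral_apply hC hO hK hx]
  exact (contDiffOn_infty.2 fun n => key n K hK).contDiffAt (hO.mem_nhds hx)

end Parametric

/-! ### Primitives and Hadamard's lemma -/

section Primitive

variable {O : Set (ℝ × ℝ)} {w : ℝ × ℝ → ℝ}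

theorem contDiffAt_intervalIntegral {E' : Type*} [NormedAddCommGroup E'] [NormedSpace ℝ E']
    [FiniteDimensional ℝ E'] {a b : ℝ} (hab : a ≤ b)
    {O : Set E'} {K : ℝ → E' → ℝ} (hO : IsOpen O)
    (hK : ∀ y ∈ Icc a b, ∀ x ∈ O, ContDiffAt ℝ ∞ (Function.uncurry K) (y, x)) {x : E'}
    (hx : x ∈ O) : ContDiffAt ℝ ∞ (fun x => ∫ y in a..b, K y x) x := by
  have h := contDiffAt_setIntegral (μ := volume) isCompact_Icc hO hK hx
  simpa only [intervalIntegral.integral_of_le hab, integral_Icc_eq_integral_Ioc] using h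

/-- Primitives in the first variable depend smoothly on both variables. The domain is only required
to contain the segments to the line `s = s₁`. -/
theorem exists_primitive_fst (hO : IsOpen O) (s₁ : ℝ)
    (hseg : ∀ x ∈ O, ∀ t ∈ Icc (0 : ℝ) 1, (s₁ + t * (x.1 - s₁), x.2) ∈ O)
    (hw : ∀ x ∈ O, ContDiffAt ℝ ∞ w x) :
    ∃ B : ℝ × ℝ → ℝ, (∀ x ∈ O, ContDiffAt ℝ ∞ B x) ∧
      ∀ x ∈ O, ∀ F : ℝ → ℝ, (∀ s ∈ uIcc s₁ x.1, HasDerivAt F (w (s, x.2)) s) →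
        B x = F x.1 - F s₁ := by
  refine ⟨fun x => ∫ t in (0 : ℝ)..1, (x.1 - s₁) * w (s₁ + t * (x.1 - s₁), x.2), ?_, ?_⟩
  · intro x hx
    refine contDiffAt_intervalIntegral
      (K := fun t x => (x.1 - s₁) * w (s₁ + t * (x.1 - s₁), x.2)) zero_le_one hO
      (fun t ht x hx => ?_) hx
    refine ContDiffAt.mul (by fun_prop) ?_
    exact ContDiffAt.comp (f := fun q : ℝ × ℝ × ℝ => (s₁ + q.1 * (q.2.1 - s₁), q.2.2)) (t, x)
      (hw _ (hseg x hx t ht)) (by fun_prop)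
  · intro x hx F hF
    have hmem : ∀ t ∈ uIcc (0 : ℝ) 1, s₁ + t * (x.1 - s₁) ∈ uIcc s₁ x.1 := by
      intro t ht
      rw [uIcc_of_le zero_le_one] at ht
      rw [mem_uIcc]
      rcases le_total s₁ x.1 with h | h
      · left
        constructor <;> nlinarith [ht.1, ht.2]
      · right
        constructor <;> nlinarith [ht.1, ht.2]
    have h1 : ∀ t ∈ uIcc (0 : ℝ) 1, HasDerivAt (fun t => F (s₁ + t * (x.1 - s₁)))
        ((x.1 - s₁) * w (s₁ + t * (x.1 - s₁), x.2)) t := by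
      intro t ht
      have h2 : HasDerivAt (fun t : ℝ => s₁ + t * (x.1 - s₁)) (x.1 - s₁) t := by
        simpa using ((hasDerivAt_id t).mul_const (x.1 - s₁)).const_add s₁
      exact ((hF _ (hmem t ht)).comp t h2).congr_deriv (mul_comm _ _)
    dsimp only
    rw [intervalIntegral.integral_eq_sub_of_hasDerivAt h1]
    · simp
    · refine ContinuousOn.intervalIntegrable fun t ht => ?_
      rw [uIcc_of_le zero_le_one] at ht
      refine (ContinuousAt.mul continuousAt_const ?_).continuousWithinAt
      exact ContinuousAt.comp (f := fun t : ℝ => (s₁ + t * (x.1 - s₁), x.2))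
        (hw _ (hseg x hx t ht)).continuousAt (by fun_prop)

theorem hasDerivAt_fst {f : ℝ × ℝ → ℝ} {x : ℝ × ℝ} (h : DifferentiableAt ℝ f x) :
    HasDerivAt (fun s => f (s, x.2)) (fderiv ℝ f x (1, 0)) x.1 := by
  have h1 : HasDerivAt (fun s : ℝ => (s, x.2)) ((1 : ℝ), (0 : ℝ)) x.1 :=
    (hasDerivAt_id x.1).prodMk (hasDerivAt_const _ _)
  exact HasFDerivAt.comp_hasDerivAt (f := fun s : ℝ => (s, x.2)) x.1 h.hasFDerivAt h1

theorem hasDerivAt_snd {f : ℝ × ℝ → ℝ} {x : ℝ × ℝ} (h : DifferentiableAt ℝ f x) :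
    HasDerivAt (fun z => f (x.1, z)) (fderiv ℝ f x (0, 1)) x.2 := by
  have h1 : HasDerivAt (fun z : ℝ => (x.1, z)) ((0 : ℝ), (1 : ℝ)) x.2 :=
    (hasDerivAt_const _ _).prodMk (hasDerivAt_id x.2)
  exact HasFDerivAt.comp_hasDerivAt (f := fun z : ℝ => (x.1, z)) x.2 h.hasFDerivAt h1

theorem contDiffAt_fderiv_apply {E' : Type*} [NormedAddCommGroup E'] [NormedSpace ℝ E']
    {f : E' → ℝ} {x : E'} (h : ContDiffAt ℝ ∞ f x) (v : E') :
    ContDiffAt ℝ ∞ (fun y => fderiv ℝ f y v) x :=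
  (h.fderiv_right (m := ∞) le_rfl).clm_apply contDiffAt_const

/-- Hadamard's lemma in the first variable. The quotient is an average of the partial derivative,
which is smooth across `s = 0`. -/
theorem exists_hadamard_fst (hO : IsOpen O)
    (hseg : ∀ x ∈ O, ∀ t ∈ Icc (0 : ℝ) 1, (t * x.1, x.2) ∈ O)
    {Ψ : ℝ × ℝ → ℝ} (hΨ : ∀ x ∈ O, ContDiffAt ℝ ∞ Ψ x) :
    ∃ κ : ℝ × ℝ → ℝ, (∀ x ∈ O, ContDiffAt ℝ ∞ κ x) ∧
      ∀ x ∈ O, Ψ x = Ψ (0, x.2) + x.1 * κ x := by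
  refine ⟨fun x => ∫ t in (0 : ℝ)..1, fderiv ℝ Ψ (t * x.1, x.2) (1, 0), ?_, ?_⟩
  · intro x hx
    refine contDiffAt_intervalIntegral
      (K := fun t x => fderiv ℝ Ψ (t * x.1, x.2) (1, 0)) zero_le_one hO
      (fun t ht x hx => ?_) hx
    exact ContDiffAt.comp (f := fun q : ℝ × ℝ × ℝ => (q.1 * q.2.1, q.2.2)) (t, x)
      (contDiffAt_fderiv_apply (hΨ _ (hseg x hx t ht)) (1, 0)) (by fun_prop)
  · intro x hx
    have h1 : ∀ t ∈ uIcc (0 : ℝ) 1, HasDerivAt (fun t => Ψ (t * x.1, x.2))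
        (fderiv ℝ Ψ (t * x.1, x.2) (1, 0) * x.1) t := by
      intro t ht
      rw [uIcc_of_le zero_le_one] at ht
      have h2 : HasDerivAt (fun t : ℝ => t * x.1) x.1 t := by
        simpa using (hasDerivAt_id t).mul_const x.1
      have h3 := hasDerivAt_fst (f := Ψ) (x := (t * x.1, x.2))
        ((hΨ _ (hseg x hx t ht)).differentiableAt (by simp))
      exact h3.comp t h2
    have h4 := intervalIntegral.integral_eq_sub_of_hasDerivAt h1
      (ContinuousOn.intervalIntegrable fun t ht => by
        rw [uIcc_of_le zero_le_one] at ht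
        refine (ContinuousAt.mul ?_ continuousAt_const).continuousWithinAt
        exact ContinuousAt.comp (f := fun t : ℝ => (t * x.1, x.2))
          (contDiffAt_fderiv_apply (hΨ _ (hseg x hx t ht)) (1, 0)).continuousAt (by fun_prop))
    rw [intervalIntegral.integral_mul_const] at h4
    simp only [one_mul, zero_mul] at h4
    change _ = _ + x.1 * ∫ t in (0 : ℝ)..1, fderiv ℝ Ψ (t * x.1, x.2) (1, 0)
    linarith

theorem mem_box {δ : ℝ} {x : ℝ × ℝ} : x ∈ Ioo (-δ) δ ×ˢ Ioo (-δ) δ ↔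
    (-δ < x.1 ∧ x.1 < δ) ∧ (-δ < x.2 ∧ x.2 < δ) := Iff.rfl

/-- Hadamard's lemma in the first variable on a square. -/
theorem exists_hadamard_box_fst {δ : ℝ}
    {Ψ : ℝ × ℝ → ℝ} (hΨ : ∀ x ∈ Ioo (-δ) δ ×ˢ Ioo (-δ) δ, ContDiffAt ℝ ∞ Ψ x) :
    ∃ κ : ℝ × ℝ → ℝ, (∀ x ∈ Ioo (-δ) δ ×ˢ Ioo (-δ) δ, ContDiffAt ℝ ∞ κ x) ∧
      ∀ x ∈ Ioo (-δ) δ ×ˢ Ioo (-δ) δ, Ψ x = Ψ (0, x.2) + x.1 * κ x := by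
  refine exists_hadamard_fst (isOpen_Ioo.prod isOpen_Ioo) (fun x hx t ht => ?_) hΨ
  rw [mem_box] at hx ⊢
  refine ⟨⟨?_, ?_⟩, hx.2⟩ <;> dsimp only <;> nlinarith [ht.1, ht.2, hx.1.1, hx.1.2]

/-- Hadamard's lemma in the second variable on a square. -/
theorem exists_hadamard_box_snd {δ : ℝ}
    {Ψ : ℝ × ℝ → ℝ} (hΨ : ∀ x ∈ Ioo (-δ) δ ×ˢ Ioo (-δ) δ, ContDiffAt ℝ ∞ Ψ x) :
    ∃ κ : ℝ × ℝ → ℝ, (∀ x ∈ Ioo (-δ) δ ×ˢ Ioo (-δ) δ, ContDiffAt ℝ ∞ κ x) ∧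
      ∀ x ∈ Ioo (-δ) δ ×ˢ Ioo (-δ) δ, Ψ x = Ψ (x.1, 0) + x.2 * κ x := by
  obtain ⟨κ, h1, h2⟩ := exists_hadamard_box_fst (δ := δ) (Ψ := fun x => Ψ (x.2, x.1))
    fun x hx => ContDiffAt.comp (f := fun x : ℝ × ℝ => (x.2, x.1)) x (hΨ (x.2, x.1) ⟨hx.2, hx.1⟩)
      (by fun_prop)
  exact ⟨fun x => κ (x.2, x.1), fun x hx => ContDiffAt.comp (f := fun x : ℝ × ℝ => (x.2, x.1)) x
    (h1 (x.2, x.1) ⟨hx.2, hx.1⟩) (by fun_prop), fun x hx => h2 (x.2, x.1) ⟨hx.2, hx.1⟩⟩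

/-- A function on the open quadrant whose partial derivatives extend smoothly to a square about
the origin extends smoothly itself. -/
theorem exists_smooth_extension_quadrant {δ : ℝ} (hδ : 0 < δ) {S S₁ S₂ : ℝ × ℝ → ℝ}
    (h₁ : ∀ x ∈ Ioo (-δ) δ ×ˢ Ioo (-δ) δ, ContDiffAt ℝ ∞ S₁ x)
    (h₂ : ∀ x ∈ Ioo (-δ) δ ×ˢ Ioo (-δ) δ, ContDiffAt ℝ ∞ S₂ x)
    (hS₁ : ∀ x ∈ Ioo 0 δ ×ˢ Ioo 0 δ, HasDerivAt (fun p => S (p, x.2)) (S₁ x) x.1)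
    (hS₂ : ∀ x ∈ Ioo 0 δ ×ˢ Ioo 0 δ, HasDerivAt (fun q => S (x.1, q)) (S₂ x) x.2) :
    ∃ S' : ℝ × ℝ → ℝ, (∀ x ∈ Ioo (-δ) δ ×ˢ Ioo (-δ) δ, ContDiffAt ℝ ∞ S' x) ∧
      ∀ x ∈ Ioo 0 δ ×ˢ Ioo 0 δ, S' x = S x := by
  have hb : 0 < δ / 2 ∧ δ / 2 < δ := ⟨by linarith, by linarith⟩
  have hseg : ∀ x ∈ Ioo (-δ) δ ×ˢ Ioo (-δ) δ, ∀ t ∈ Icc (0 : ℝ) 1,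
      (δ / 2 + t * (x.1 - δ / 2), x.2) ∈ Ioo (-δ) δ ×ˢ Ioo (-δ) δ := by
    intro x hx t ht
    rw [mem_box] at hx ⊢
    refine ⟨⟨?_, ?_⟩, hx.2⟩ <;> dsimp only <;> nlinarith [ht.1, ht.2, hx.1.1, hx.1.2]
  obtain ⟨B, hB, hB'⟩ := exists_primitive_fst (isOpen_Ioo.prod isOpen_Ioo) (δ / 2) hseg h₁
  obtain ⟨B₂, hB₂, hB₂'⟩ := exists_primitive_fst (w := fun x => S₂ (x.2, x.1))
    (isOpen_Ioo.prod isOpen_Ioo) (δ / 2) hseg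
    fun x hx => ContDiffAt.comp (f := fun x : ℝ × ℝ => (x.2, x.1)) x (h₂ (x.2, x.1) ⟨hx.2, hx.1⟩)
      (by fun_prop)
  have hpos : ∀ s ∈ Ioo (0 : ℝ) δ, ∀ r ∈ uIcc (δ / 2) s, r ∈ Ioo (0 : ℝ) δ := fun s hs r hr =>
    ordConnected_Ioo.uIcc_subset hb hs hr
  refine ⟨fun x => S (δ / 2, δ / 2) + B₂ (x.2, δ / 2) + B x, fun x hx => ?_, fun x hx => ?_⟩
  · refine (contDiffAt_const.add ?_).add (hB x hx)
    refine ContDiffAt.comp (f := fun x : ℝ × ℝ => (x.2, δ / 2)) x (hB₂ _ ⟨hx.2, ?_⟩) (by fun_prop)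
    exact ⟨by dsimp only; linarith, hb.2⟩
  · have e1 := hB' x ⟨⟨by linarith [hx.1.1], hx.1.2⟩, ⟨by linarith [hx.2.1], hx.2.2⟩⟩
      (fun p => S (p, x.2)) fun s hs => hS₁ (s, x.2) ⟨hpos _ hx.1 s hs, hx.2⟩
    have e2 := hB₂' (x.2, δ / 2) ⟨⟨by dsimp only; linarith [hx.2.1], hx.2.2⟩,
      ⟨by dsimp only; linarith, hb.2⟩⟩
      (fun q => S (δ / 2, q)) fun s hs => hS₂ (δ / 2, s) ⟨hb, hpos _ hx.2 s hs⟩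
    dsimp only at e1 e2 ⊢
    rw [e1, e2]
    ring_nf

end Primitive

/-! ### Axisymmetric harmonic functions -/

/-- The Laplacian of `ℝ³` on the axisymmetric function `f (ρ², z)`, since
`∂_ρ² + ρ⁻¹ ∂_ρ = 4 (∂_s + s ∂_s²)` for `s = ρ²`. -/
noncomputable def axiLaplacian (f : ℝ × ℝ → ℝ) (x : ℝ × ℝ) : ℝ :=
  4 * (fderiv ℝ f x (1, 0) + x.1 * fderiv ℝ (fun y => fderiv ℝ f y (1, 0)) x (1, 0))
    + fderiv ℝ (fun y => fderiv ℝ f y (0, 1)) x (0, 1)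

/-- Near `x` the function is smooth, and at `x` it solves the axisymmetric Laplace equation. -/
def IsAxiHarmonicAt (f : ℝ × ℝ → ℝ) (x : ℝ × ℝ) : Prop :=
  ContDiffAt ℝ ∞ f x ∧ axiLaplacian f x = 0

theorem eventually_differentiableAt {f : ℝ × ℝ → ℝ} {x : ℝ × ℝ} (h : ContDiffAt ℝ ∞ f x) :
    ∀ᶠ y in 𝓝 x, DifferentiableAt ℝ f y := by
  filter_upwards [(h.of_le (m := 1) (by exact_mod_cast le_top)).eventually (by simp)] with y hy
  exact hy.differentiableAt (by simp)

namespace IsAxiHarmonicAt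

variable {f g : ℝ × ℝ → ℝ} {x : ℝ × ℝ}

theorem congr (hf : IsAxiHarmonicAt f x) (h : g =ᶠ[𝓝 x] f) : IsAxiHarmonicAt g x := by
  refine ⟨hf.1.congr_of_eventuallyEq h, ?_⟩
  have h1 : ∀ v, (fun y => fderiv ℝ g y v) =ᶠ[𝓝 x] fun y => fderiv ℝ f y v := fun v => by
    filter_upwards [h.fderiv (𝕜 := ℝ)] with y hy
    rw [hy]
  rw [← hf.2, axiLaplacian, axiLaplacian, (h1 (1, 0)).fderiv_eq, (h1 (0, 1)).fderiv_eq, h.fderiv_eq]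

theorem add (hf : IsAxiHarmonicAt f x) (hg : IsAxiHarmonicAt g x) :
    IsAxiHarmonicAt (fun y => f y + g y) x := by
  refine ⟨hf.1.add hg.1, ?_⟩
  have h1 : ∀ v, (fun y => fderiv ℝ (fun y => f y + g y) y v) =ᶠ[𝓝 x]
      fun y => fderiv ℝ f y v + fderiv ℝ g y v := fun v => by
    filter_upwards [eventually_differentiableAt hf.1, eventually_differentiableAt hg.1] with y h h'
    rw [fderiv_fun_add h h', _root_.add_apply]
  have h2 : ∀ v w : ℝ × ℝ, fderiv ℝ (fun y => fderiv ℝ f y v + fderiv ℝ g y v) x w =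
      fderiv ℝ (fun y => fderiv ℝ f y v) x w + fderiv ℝ (fun y => fderiv ℝ g y v) x w := by
    intro v w
    rw [fderiv_fun_add ((contDiffAt_fderiv_apply hf.1 v).differentiableAt (by simp))
      ((contDiffAt_fderiv_apply hg.1 v).differentiableAt (by simp)), _root_.add_apply]
  have e1 := hf.2
  have e2 := hg.2
  simp only [axiLaplacian] at e1 e2
  have h3 := (h1 (1, 0)).self_of_nhds
  dsimp only at h3
  rw [axiLaplacian, (h1 (1, 0)).fderiv_eq, (h1 (0, 1)).fderiv_eq, h3, h2, h2]
  linear_combination e1 + e2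

theorem const_mul (hf : IsAxiHarmonicAt f x) (c : ℝ) : IsAxiHarmonicAt (fun y => c * f y) x := by
  refine ⟨contDiffAt_const.mul hf.1, ?_⟩
  have h1 : ∀ v, (fun y => fderiv ℝ (fun y => c * f y) y v) =ᶠ[𝓝 x]
      fun y => c * fderiv ℝ f y v := fun v => by
    filter_upwards [eventually_differentiableAt hf.1] with y h
    rw [fderiv_const_mul h, _root_.smul_apply, smul_eq_mul]
  have h2 : ∀ v w : ℝ × ℝ, fderiv ℝ (fun y => c * fderiv ℝ f y v) x w =
      c * fderiv ℝ (fun y => fderiv ℝ f y v) x w := by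
    intro v w
    rw [fderiv_const_mul ((contDiffAt_fderiv_apply hf.1 v).differentiableAt (by simp)),
      _root_.smul_apply, smul_eq_mul]
  have e1 := hf.2
  simp only [axiLaplacian] at e1
  have h3 := (h1 (1, 0)).self_of_nhds
  dsimp only at h3
  rw [axiLaplacian, (h1 (1, 0)).fderiv_eq, (h1 (0, 1)).fderiv_eq, h3, h2, h2]
  linear_combination c * e1

theorem neg (hf : IsAxiHarmonicAt f x) : IsAxiHarmonicAt (fun y => -f y) x := by
  simpa using hf.const_mul (-1)

theorem const (c : ℝ) : IsAxiHarmonicAt (fun _ => c) x := by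
  refine ⟨contDiffAt_const, ?_⟩
  simp [axiLaplacian]

theorem sum {ι : Type*} {s : Finset ι} {F : ι → ℝ × ℝ → ℝ} (h : ∀ i ∈ s, IsAxiHarmonicAt (F i) x) :
    IsAxiHarmonicAt (fun y => ∑ i ∈ s, F i y) x := by
  classical
  induction s using Finset.induction_on with
  | empty => simpa using const 0
  | insert i s hi ih =>
    simp only [Finset.sum_insert hi]
    exact (h i (by simp)).add (ih fun j hj => h j (by simp [hj]))

/-- A parametric integral of axisymmetric harmonic functions is axisymmetric harmonic. -/
theorem setIntegral {μ : Measure ℝ} [IsFiniteMeasureOnCompacts μ] {C : Set ℝ} {O : Set (ℝ × ℝ)}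
    {K : ℝ → ℝ × ℝ → ℝ} (hC : IsCompact C) (hO : IsOpen O)
    (hK : ∀ y ∈ C, ∀ x ∈ O, ContDiffAt ℝ ∞ (Function.uncurry K) (y, x))
    (hL : ∀ y ∈ C, ∀ x ∈ O, axiLaplacian (K y) x = 0) (hx : x ∈ O) :
    IsAxiHarmonicAt (fun x => ∫ y in C, K y x ∂μ) x := by
  refine ⟨contDiffAt_setIntegral hC hO hK hx, ?_⟩
  have hK' : ∀ v, ∀ y ∈ C, ∀ x ∈ O,
      ContDiffAt ℝ ∞ (Function.uncurry fun y x => fderiv ℝ (K y) x v) (y, x) :=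
    fun v y hy x hx => contDiffAt_fderiv_slice v (hK y hy x hx)
  have hK'' : ∀ v w, ∀ y ∈ C, ∀ x ∈ O, ContDiffAt ℝ ∞
      (Function.uncurry fun y x => fderiv ℝ (fun z => fderiv ℝ (K y) z v) x w) (y, x) :=
    fun v w y hy x hx => contDiffAt_fderiv_slice w (hK' v y hy x hx)
  have hint : ∀ F : ℝ → ℝ × ℝ → ℝ, (∀ y ∈ C, ∀ x ∈ O, ContDiffAt ℝ ∞ (Function.uncurry F) (y, x)) →
      IntegrableOn (fun y => F y x) C μ := fun F hF =>
    ContinuousOn.integrableOn_compact hC fun y hy =>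
      ((hF y hy x hx).continuousAt.comp (f := fun y => (y, x)) (by fun_prop)).continuousWithinAt
  have h1 : ∀ v, (fun x => fderiv ℝ (fun x => ∫ y in C, K y x ∂μ) x v) =ᶠ[𝓝 x]
      fun x => ∫ y in C, fderiv ℝ (K y) x v ∂μ := fun v => by
    filter_upwards [hO.mem_nhds hx] with z hz
    exact fderiv_setIntegral_apply hC hO hK hz v
  have h3 := (h1 (1, 0)).self_of_nhds
  dsimp only at h3
  rw [axiLaplacian, (h1 (1, 0)).fderiv_eq, (h1 (0, 1)).fderiv_eq, h3,
    fderiv_setIntegral_apply hC hO (hK' _) hx, fderiv_setIntegral_apply hC hO (hK' _) hx]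
  refine Eq.trans ?_ (setIntegral_eq_zero_of_forall_eq_zero (μ := μ) fun y hy => hL y hy x hx)
  have i1 := hint _ (hK' (1, 0))
  have i2 := (hint _ (hK'' (1, 0) (1, 0))).const_mul x.1
  have i3 := hint _ (hK'' (0, 1) (0, 1))
  simp only [axiLaplacian]
  have i4 : Integrable (fun y => 4 * (fderiv ℝ (K y) x (1, 0) +
      x.1 * fderiv ℝ (fun z => fderiv ℝ (K y) z (1, 0)) x (1, 0))) (μ.restrict C) :=
    (i1.add i2).const_mul 4
  rw [integral_add i4 i3, integral_const_mul, integral_add i1 i2,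
    integral_const_mul]

end IsAxiHarmonicAt

theorem fderiv_fst_eq {f : ℝ × ℝ → ℝ} {x : ℝ × ℝ} {d : ℝ} (h : DifferentiableAt ℝ f x)
    (hd : HasDerivAt (fun s => f (s, x.2)) d x.1) : fderiv ℝ f x (1, 0) = d :=
  (hasDerivAt_fst h).unique hd

theorem fderiv_snd_eq {f : ℝ × ℝ → ℝ} {x : ℝ × ℝ} {d : ℝ} (h : DifferentiableAt ℝ f x)
    (hd : HasDerivAt (fun z => f (x.1, z)) d x.2) : fderiv ℝ f x (0, 1) = d :=
  (hasDerivAt_snd h).unique hd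

/-- The Coulomb potential of a point of the axis, up to scaling. The form of the radicand includes
the limit `C = 0`, in which the point moves to infinity. -/
theorem isAxiHarmonicAt_inv_sqrt {B C : ℝ} {x : ℝ × ℝ} (hx : 0 < C ^ 2 * x.1 + (B + C * x.2) ^ 2) :
    IsAxiHarmonicAt (fun x => (√(C ^ 2 * x.1 + (B + C * x.2) ^ 2))⁻¹) x := by
  set r : ℝ × ℝ → ℝ := fun x => √(C ^ 2 * x.1 + (B + C * x.2) ^ 2) with hr
  set O : Set (ℝ × ℝ) := {x | 0 < C ^ 2 * x.1 + (B + C * x.2) ^ 2} with hOdef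
  have hO : IsOpen O := isOpen_lt (by fun_prop) (by fun_prop)
  have hr0 : ∀ y ∈ O, 0 < r y := fun y hy => Real.sqrt_pos.2 hy
  have hsq : ∀ y ∈ O, r y ^ 2 = C ^ 2 * y.1 + (B + C * y.2) ^ 2 := fun y hy =>
    Real.sq_sqrt (le_of_lt hy)
  have hsm : ∀ y ∈ O, ContDiffAt ℝ ∞ r y := fun y hy =>
    ContDiffAt.sqrt (by fun_prop) (ne_of_gt hy)
  have hrs : ∀ y ∈ O, HasDerivAt (fun s => r (s, y.2)) (C ^ 2 / (2 * r y)) y.1 := by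
    intro y hy
    have h1 : HasDerivAt (fun s => C ^ 2 * s + (B + C * y.2) ^ 2) (C ^ 2) y.1 := by
      simpa using ((hasDerivAt_id y.1).const_mul (C ^ 2)).add_const ((B + C * y.2) ^ 2)
    exact h1.sqrt (ne_of_gt hy)
  have hrz : ∀ y ∈ O, HasDerivAt (fun z => r (y.1, z)) (C * (B + C * y.2) / r y) y.2 := by
    intro y hy
    have h0 : HasDerivAt (fun z => B + C * z) C y.2 := by
      simpa using ((hasDerivAt_id y.2).const_mul C).const_add B
    have h1 : HasDerivAt (fun z => C ^ 2 * y.1 + (B + C * z) ^ 2) (2 * (B + C * y.2) * C) y.2 := by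
      simpa using (h0.pow 2).const_add (C ^ 2 * y.1)
    refine (h1.sqrt (ne_of_gt hy)).congr_deriv ?_
    have := (hr0 y hy).ne'
    change _ / (2 * r y) = _
    field_simp
  have hne : ∀ y ∈ O, r y ≠ 0 := fun y hy => (hr0 y hy).ne'
  have hinv : ∀ y ∈ O, ∀ n : ℕ, ContDiffAt ℝ ∞ (fun y => (r y ^ n)⁻¹) y := fun y hy n =>
    ((hsm y hy).pow n).inv (pow_ne_zero _ (hne y hy))
  have d1 : ∀ y ∈ O, fderiv ℝ (fun y => (r y)⁻¹) y (1, 0) = -(C ^ 2 / 2) * (r y ^ 3)⁻¹ := by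
    intro y hy
    have := hne y hy
    refine fderiv_fst_eq (((hsm y hy).inv this).differentiableAt (by simp)) ?_
    refine ((hrs y hy).inv this).congr_deriv ?_
    change -(C ^ 2 / (2 * r y)) / r y ^ 2 = _
    field_simp
  have d2 : ∀ y ∈ O, fderiv ℝ (fun y => (r y)⁻¹) y (0, 1) = -(C * (B + C * y.2)) * (r y ^ 3)⁻¹ := by
    intro y hy
    have := hne y hy
    refine fderiv_snd_eq (((hsm y hy).inv this).differentiableAt (by simp)) ?_
    refine ((hrz y hy).inv this).congr_deriv ?_
    change -(C * (B + C * y.2) / r y) / r y ^ 2 = _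
    field_simp
  refine ⟨(hsm x hx).inv (hne x hx), ?_⟩
  have e1 : (fun y => fderiv ℝ (fun y => (r y)⁻¹) y (1, 0)) =ᶠ[𝓝 x]
      fun y => -(C ^ 2 / 2) * (r y ^ 3)⁻¹ := by
    filter_upwards [hO.mem_nhds hx] with y hy using d1 y hy
  have e2 : (fun y => fderiv ℝ (fun y => (r y)⁻¹) y (0, 1)) =ᶠ[𝓝 x]
      fun y => -(C * (B + C * y.2)) * (r y ^ 3)⁻¹ := by
    filter_upwards [hO.mem_nhds hx] with y hy using d2 y hy
  have d11 : fderiv ℝ (fun y => -(C ^ 2 / 2) * (r y ^ 3)⁻¹) x (1, 0) =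
      3 * C ^ 4 / 4 / r x ^ 5 := by
    have := hne x hx
    refine fderiv_fst_eq ((contDiffAt_const.mul (hinv x hx 3)).differentiableAt (by simp)) ?_
    refine ((((hrs x hx).pow 3).inv (pow_ne_zero _ this)).const_mul (-(C ^ 2 / 2))).congr_deriv ?_
    simp only [Pi.pow_apply]
    change -(C ^ 2 / 2) * (-(_ * r x ^ 2 * (C ^ 2 / (2 * r x))) / (r x ^ 3) ^ 2) = _
    field_simp
    ring
  have d22 : fderiv ℝ (fun y => -(C * (B + C * y.2)) * (r y ^ 3)⁻¹) x (0, 1) =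
      -(C ^ 2) / r x ^ 3 + 3 * C ^ 2 * (B + C * x.2) ^ 2 / r x ^ 5 := by
    have := hne x hx
    refine fderiv_snd_eq ((ContDiffAt.mul (by fun_prop) (hinv x hx 3)).differentiableAt
      (by simp)) ?_
    have h0 : HasDerivAt (fun z => -(C * (B + C * z))) (-(C * C)) x.2 := by
      simpa using ((((hasDerivAt_id x.2).const_mul C).const_add B).const_mul C).fun_neg
    refine (h0.mul (((hrz x hx).pow 3).inv (pow_ne_zero _ this))).congr_deriv ?_
    simp only [Pi.pow_apply, Pi.inv_apply]
    change -(C * C) * (r x ^ 3)⁻¹ + -(C * (B + C * x.2)) *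
      (-(_ * r x ^ 2 * (C * (B + C * x.2) / r x)) / (r x ^ 3) ^ 2) = _
    field_simp
    ring
  rw [axiLaplacian, e1.fderiv_eq, e2.fderiv_eq, d1 x hx, d11, d22]
  have := hne x hx
  have h2 := hsq x hx
  field_simp
  linear_combination (-6 * C ^ 2) * h2

/-! ### Superpositions and potentials of segments -/

/-- Countable superpositions, with summable weights, of members of a smooth family of
axisymmetric harmonic functions. The series is an integral with respect to a finite measure on the
parameters, and is differentiated under the integral sign. -/
theorem exists_isAxiHarmonicAt_hasSum {C : Set ℝ} {O : Set (ℝ × ℝ)}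
    {K : ℝ → ℝ × ℝ → ℝ} (hC : IsCompact C) (hO : IsOpen O)
    (hK : ∀ y ∈ C, ∀ x ∈ O, ContDiffAt ℝ ∞ (Function.uncurry K) (y, x))
    (hL : ∀ y ∈ C, ∀ x ∈ O, axiLaplacian (K y) x = 0)
    {ε : ℕ → ℝ} (hε : ∀ i, ε i ∈ C) {w : ℕ → ℝ} (hw : ∀ i, 0 ≤ w i) (hs : Summable w) :
    ∃ g : ℝ × ℝ → ℝ, ∀ x ∈ O, IsAxiHarmonicAt g x ∧ HasSum (fun i => w i * K (ε i) x) (g x) := by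
  set μ : Measure ℝ := Measure.sum fun i => ENNReal.ofReal (w i) • Measure.dirac (ε i) with hμ
  have hfin : IsFiniteMeasure μ := by
    refine ⟨?_⟩
    rw [hμ, Measure.sum_apply _ MeasurableSet.univ]
    simp only [Measure.smul_apply, measure_univ, smul_eq_mul, mul_one]
    exact hs.tsum_ofReal_lt_top
  have hres : μ.restrict C = μ := by
    refine Measure.restrict_eq_self_of_ae_mem ?_
    refine (Measure.ae_sum_iff' (p := fun y => y ∈ C) hC.measurableSet).2 fun i => ?_
    refine Measure.ae_smul_measure ?_ _
    exact (ae_dirac_iff (p := fun y => y ∈ C) hC.measurableSet).2 (hε i)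
  refine ⟨fun x => ∫ y in C, K y x ∂μ, fun x hx =>
    ⟨IsAxiHarmonicAt.setIntegral hC hO hK hL hx, ?_⟩⟩
  have hint : IntegrableOn (fun y => K y x) C μ :=
    ContinuousOn.integrableOn_compact hC fun y hy =>
      ((hK y hy x hx).continuousAt.comp (f := fun y => (y, x)) (by fun_prop)).continuousWithinAt
  rw [IntegrableOn, hres] at hint
  have h := hasSum_integral_measure hint
  rw [← hμ, ← hres] at h
  have e1 : ∀ i, ∫ y, K y x ∂(ENNReal.ofReal (w i) • Measure.dirac (ε i)) = w i * K (ε i) x := by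
    intro i
    rw [integral_smul_measure, integral_dirac, ENNReal.toReal_ofReal (hw i), smul_eq_mul]
  simpa only [e1] using h

/-- The Newtonian potential `-∫_a^b dt / |x - t|` of the segment `[a, b]` of the axis. -/
noncomputable def segmentPotential (a b : ℝ) (x : ℝ × ℝ) : ℝ :=
  -∫ t in a..b, (√(x.1 + (x.2 - t) ^ 2))⁻¹

theorem sqrt_sub_pos {ρ x : ℝ} (hρ : 0 < ρ) : 0 < √(ρ ^ 2 + x ^ 2) - x := by
  have : |x| < √(ρ ^ 2 + x ^ 2) := by
    rw [← Real.sqrt_sq_eq_abs]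
    exact Real.sqrt_lt_sqrt (sq_nonneg x) (by nlinarith)
  linarith [le_abs_self x]

/-- The integrand `1 / |x - t|` has the primitive `log (r_t - (z - t))`. -/
theorem rodPotential_eq_segmentPotential (a b : ℝ) {ρ : ℝ} (hρ : 0 < ρ) (z : ℝ) :
    rodPotential a b ρ z = segmentPotential a b (ρ ^ 2, z) := by
  have hpos : ∀ t : ℝ, 0 < ρ ^ 2 + (z - t) ^ 2 := fun t => by positivity
  have h1 : ∀ t : ℝ, HasDerivAt (fun t => Real.log (√(ρ ^ 2 + (z - t) ^ 2) - (z - t)))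
      (√(ρ ^ 2 + (z - t) ^ 2))⁻¹ t := by
    intro t
    have h0 : HasDerivAt (fun t => z - t) (-1) t := by
      simpa using (hasDerivAt_id t).const_sub z
    have h2 : HasDerivAt (fun t => ρ ^ 2 + (z - t) ^ 2) (2 * (z - t) * (-1)) t := by
      simpa using (h0.pow 2).const_add (ρ ^ 2)
    have hne := (sqrt_sub_pos (x := z - t) hρ).ne'
    have hr := (Real.sqrt_pos.2 (hpos t)).ne'
    refine (((h2.sqrt (hpos t).ne').sub h0).log hne).congr_deriv ?_
    simp only [Pi.sub_apply] at hne ⊢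
    field_simp
    ring
  rw [segmentPotential, intervalIntegral.integral_eq_sub_of_hasDerivAt fun t _ => h1 t]
  · rw [rodPotential]
    ring
  · refine ContinuousOn.intervalIntegrable fun t _ => ContinuousAt.continuousWithinAt ?_
    exact ContinuousAt.inv₀ (by fun_prop) (Real.sqrt_pos.2 (hpos t)).ne'

theorem isOpen_setOf_forall_Icc_pos (a b : ℝ) {D : ℝ → ℝ × ℝ → ℝ}
    (hD : Continuous (Function.uncurry D)) :
    IsOpen {x | ∀ t ∈ Icc a b, 0 < D t x} := by
  rw [isOpen_iff_mem_nhds]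
  intro x hx
  refine isCompact_Icc.eventually_forall_of_forall_eventually fun t ht => ?_
  have h1 : ContinuousAt (fun q : (ℝ × ℝ) × ℝ => D q.2 q.1) (x, t) := by
    have : Continuous fun q : (ℝ × ℝ) × ℝ => (Function.uncurry D) (q.2, q.1) := by fun_prop
    exact this.continuousAt
  exact h1.eventually (lt_mem_nhds (hx t ht))

theorem isAxiHarmonicAt_segmentPotential {a b : ℝ} (hab : a ≤ b) {x : ℝ × ℝ}
    (hx : ∀ t ∈ Icc a b, 0 < x.1 + (x.2 - t) ^ 2) : IsAxiHarmonicAt (segmentPotential a b) x := by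
  have h := IsAxiHarmonicAt.setIntegral (μ := volume) (C := Icc a b)
    (O := {x : ℝ × ℝ | ∀ t ∈ Icc a b, 0 < x.1 + (x.2 - t) ^ 2})
    (K := fun t x => (√(x.1 + (x.2 - t) ^ 2))⁻¹) isCompact_Icc
    (isOpen_setOf_forall_Icc_pos a b (D := fun t x => x.1 + (x.2 - t) ^ 2) (by fun_prop)) ?_ ?_ hx
  · simp only [integral_Icc_eq_integral_Ioc, ← intervalIntegral.integral_of_le hab] at h
    exact h.neg
  · intro t ht y hy
    have h1 := hy t ht
    exact ContDiffAt.inv (ContDiffAt.sqrt (by fun_prop) h1.ne') (Real.sqrt_pos.2 h1).ne'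
  · intro t ht y hy
    have h1 : (fun x : ℝ × ℝ => (√(x.1 + (x.2 - t) ^ 2))⁻¹) =
        fun x => (√(1 ^ 2 * x.1 + (-t + 1 * x.2) ^ 2))⁻¹ := by
      funext x
      ring_nf
    rw [h1]
    refine (isAxiHarmonicAt_inv_sqrt ?_).2
    have := hy t ht
    ring_nf at this ⊢
    exact this

/-! ### The tail of the series of potentials -/

/-- The squared distance to the point `t + ε⁻¹` of the axis, multiplied by `ε ^ 2`. -/
def scaledDist (ε t : ℝ) (x : ℝ × ℝ) : ℝ := ε ^ 2 * x.1 + (1 + ε * (t - x.2)) ^ 2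

/-- The function with `ε * tailKernel ε t x = 1 - 1 / √(scaledDist ε t x)`, in a form that is smooth
at `ε = 0`, the limit of translates at infinity. -/
noncomputable def tailKernel (ε t : ℝ) (x : ℝ × ℝ) : ℝ :=
  (2 * (t - x.2) + ε * (x.1 + (t - x.2) ^ 2)) /
    (√(scaledDist ε t x) * (1 + √(scaledDist ε t x)))

theorem mul_tailKernel {ε t : ℝ} {x : ℝ × ℝ} (h : 0 < scaledDist ε t x) :
    ε * tailKernel ε t x = 1 - (√(scaledDist ε t x))⁻¹ := by
  have h1 := Real.sqrt_pos.2 h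
  have h2 := Real.sq_sqrt h.le
  have h3 : 1 + √(scaledDist ε t x) ≠ 0 := by positivity
  have h4 : scaledDist ε t x = 1 + ε * (2 * (t - x.2) + ε * (x.1 + (t - x.2) ^ 2)) := by
    rw [scaledDist]; ring
  rw [tailKernel]
  field_simp
  linear_combination -h2 - h4

theorem contDiffAt_tailKernel {ε t : ℝ} {x : ℝ × ℝ} (h : 0 < scaledDist ε t x) :
    ContDiffAt ℝ ∞ (fun q : ℝ × ℝ × ℝ × ℝ => tailKernel q.1 q.2.1 q.2.2) (ε, t, x) := by
  have h1 := Real.sqrt_pos.2 h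
  have h2 : ContDiffAt ℝ ∞ (fun q : ℝ × ℝ × ℝ × ℝ => √(scaledDist q.1 q.2.1 q.2.2)) (ε, t, x) := by
    refine ContDiffAt.sqrt ?_ h.ne'
    unfold scaledDist
    fun_prop
  unfold tailKernel
  refine ContDiffAt.div (by fun_prop) (h2.mul (contDiffAt_const.add h2)) ?_
  dsimp only
  positivity

theorem isAxiHarmonicAt_tailKernel {ε t : ℝ} {x : ℝ × ℝ} (h : 0 < scaledDist ε t x) :
    IsAxiHarmonicAt (tailKernel ε t) x := by
  rcases eq_or_ne ε 0 with rfl | hε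
  -- For `ε = 0` the function is the harmonic polynomial `t - z`.
  · have h0 : tailKernel 0 t = fun x => t - x.2 := by
      funext y
      simp [tailKernel, scaledDist]
      ring
    rw [h0]
    refine ⟨by fun_prop, ?_⟩
    have hd : ∀ y : ℝ × ℝ, DifferentiableAt ℝ (fun x : ℝ × ℝ => t - x.2) y := fun y => by fun_prop
    have h1 : ∀ y : ℝ × ℝ, fderiv ℝ (fun x : ℝ × ℝ => t - x.2) y (1, 0) = 0 := fun y =>
      fderiv_fst_eq (hd y) (hasDerivAt_const y.1 (t - y.2))
    have h2 : ∀ y : ℝ × ℝ, fderiv ℝ (fun x : ℝ × ℝ => t - x.2) y (0, 1) = -1 := fun y =>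
      fderiv_snd_eq (hd y) (by simpa using (hasDerivAt_id y.2).const_sub t)
    simp [axiLaplacian, h1, h2]
  · have hO : IsOpen {y | 0 < scaledDist ε t y} :=
      isOpen_lt continuous_const (by unfold scaledDist; fun_prop)
    have h1 : IsAxiHarmonicAt (fun y => ε⁻¹ + (-ε⁻¹) * (√(scaledDist ε t y))⁻¹) x := by
      refine (IsAxiHarmonicAt.const _).add (IsAxiHarmonicAt.const_mul ?_ _)
      have h2 : (fun y => (√(scaledDist ε t y))⁻¹) =
          fun y => (√((-ε) ^ 2 * y.1 + ((1 + ε * t) + (-ε) * y.2) ^ 2))⁻¹ := by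
        funext y
        rw [scaledDist]
        ring_nf
      rw [h2]
      refine isAxiHarmonicAt_inv_sqrt ?_
      rw [scaledDist] at h
      ring_nf at h ⊢
      exact h
    refine h1.congr ?_
    filter_upwards [hO.mem_nhds h] with y hy
    have h3 := mul_tailKernel hy
    field_simp
    have h5 := (Real.sqrt_pos.2 hy).ne'
    field_simp at h3
    linear_combination h3

/-- For small `ε` the point `t + 1 / ε` is far from the region `|s|, |z| < R`, which also contains
points with `s < 0`. -/
theorem scaledDist_pos {R : ℝ} (hR : 0 ≤ R) {ε t : ℝ} {x : ℝ × ℝ} (hε : |ε| * (8 * (R + 1)) < 1)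
    (ht : |t| ≤ R) (h1 : |x.1| < R) (h2 : |x.2| < R) : 0 < scaledDist ε t x := by
  have h0 := abs_nonneg ε
  have ha : |ε * (t - x.2)| ≤ 1 / 4 := by
    rw [abs_mul]
    have : |t - x.2| ≤ 2 * R := (abs_sub _ _).trans (by linarith)
    nlinarith
  have hb : |ε ^ 2 * x.1| ≤ 1 / 8 := by
    rw [abs_mul, abs_pow]
    have : |ε| ≤ 1 := by nlinarith
    have h3 : |ε| * |x.1| ≤ 1 / 8 := by nlinarith
    nlinarith [abs_nonneg x.1, mul_nonneg h0 (abs_nonneg x.1)]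
  rw [abs_le] at ha hb
  rw [scaledDist]
  nlinarith

theorem isOpen_tailBox (R : ℝ) : IsOpen {x : ℝ × ℝ | |x.1| < R ∧ |x.2| < R} :=
  IsOpen.and (isOpen_lt (by fun_prop) continuous_const) (isOpen_lt (by fun_prop) continuous_const)

section Tail

variable {c d R : ℝ}

theorem abs_le_of_mem_Icc (hc : |c| ≤ R) (hd : |d| ≤ R) {t : ℝ} (ht : t ∈ Icc c d) : |t| ≤ R := by
  rw [abs_le] at *
  exact ⟨hc.1.trans ht.1, ht.2.trans hd.2⟩

theorem contDiffAt_integral_tailKernel (hcd : c ≤ d) (hc : |c| ≤ R) (hd : |d| ≤ R) {ε : ℝ}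
    {x : ℝ × ℝ} (hε : |ε| * (8 * (R + 1)) < 1) (h1 : |x.1| < R) (h2 : |x.2| < R) :
    ContDiffAt ℝ ∞ (Function.uncurry fun ε x => ∫ t in c..d, tailKernel ε t x) (ε, x) := by
  have hR : 0 ≤ R := (abs_nonneg c).trans hc
  refine contDiffAt_intervalIntegral
    (O := {q : ℝ × ℝ × ℝ | |q.1| * (8 * (R + 1)) < 1 ∧ |q.2.1| < R ∧ |q.2.2| < R})
    (K := fun t (q : ℝ × ℝ × ℝ) => tailKernel q.1 t q.2) hcd ?_ ?_ ⟨hε, h1, h2⟩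
  · exact IsOpen.and (isOpen_lt (by fun_prop) continuous_const) (IsOpen.and
      (isOpen_lt (by fun_prop) continuous_const) (isOpen_lt (by fun_prop) continuous_const))
  · intro t ht q hq
    exact ContDiffAt.comp (f := fun p : ℝ × ℝ × ℝ × ℝ => (p.2.1, p.1, p.2.2)) (t, q)
      (contDiffAt_tailKernel
        (scaledDist_pos hR hq.1 (abs_le_of_mem_Icc hc hd ht) hq.2.1 hq.2.2)) (by fun_prop)

theorem isAxiHarmonicAt_integral_tailKernel (hcd : c ≤ d) (hc : |c| ≤ R) (hd : |d| ≤ R) {ε : ℝ}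
    {x : ℝ × ℝ} (hε : |ε| * (8 * (R + 1)) < 1) (h1 : |x.1| < R) (h2 : |x.2| < R) :
    IsAxiHarmonicAt (fun x => ∫ t in c..d, tailKernel ε t x) x := by
  have hR : 0 ≤ R := (abs_nonneg c).trans hc
  have h := IsAxiHarmonicAt.setIntegral (μ := volume) (C := Icc c d)
    (O := {x : ℝ × ℝ | |x.1| < R ∧ |x.2| < R}) (K := fun t x => tailKernel ε t x) isCompact_Icc
    (isOpen_tailBox R) ?_ ?_ ⟨h1, h2⟩
  · simpa only [integral_Icc_eq_integral_Ioc, ← intervalIntegral.integral_of_le hcd] using h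
  · intro t ht y hy
    exact ContDiffAt.comp (f := fun p : ℝ × ℝ × ℝ => (ε, p.1, p.2)) (t, y)
      (contDiffAt_tailKernel (scaledDist_pos hR hε (abs_le_of_mem_Icc hc hd ht) hy.1 hy.2))
      (by fun_prop)
  · intro t ht y hy
    exact (isAxiHarmonicAt_tailKernel
      (scaledDist_pos hR hε (abs_le_of_mem_Icc hc hd ht) hy.1 hy.2)).2

theorem intervalIntegrable_tailKernel (hc : |c| ≤ R) (hd : |d| ≤ R) (hcd : c ≤ d) {ε : ℝ}
    {x : ℝ × ℝ} (hε : |ε| * (8 * (R + 1)) < 1) (h1 : |x.1| < R) (h2 : |x.2| < R) :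
    IntervalIntegrable (fun t => tailKernel ε t x) volume c d := by
  have hR : 0 ≤ R := (abs_nonneg c).trans hc
  refine ContinuousOn.intervalIntegrable fun t ht => ContinuousAt.continuousWithinAt ?_
  rw [uIcc_of_le hcd] at ht
  exact ContinuousAt.comp (f := fun t : ℝ => (ε, t, x)) (contDiffAt_tailKernel
    (scaledDist_pos hR hε (abs_le_of_mem_Icc hc hd ht) h1 h2)).continuousAt (by fun_prop)

/-- The potential of a far translate of a segment, to first order in the inverse distance
`|ε|`, is `-|ε|` times the length of the segment. -/
theorem segmentPotential_add_inv (hcd : c ≤ d) (hc : |c| ≤ R) (hd : |d| ≤ R) {ε : ℝ} (hε0 : ε ≠ 0)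
    {x : ℝ × ℝ} (hε : |ε| * (8 * (R + 1)) < 1) (h1 : |x.1| < R) (h2 : |x.2| < R) :
    segmentPotential (c + ε⁻¹) (d + ε⁻¹) x + |ε| * (d - c) =
      |ε| * ε * ∫ t in c..d, tailKernel ε t x := by
  have hR : 0 ≤ R := (abs_nonneg c).trans hc
  have e1 : segmentPotential (c + ε⁻¹) (d + ε⁻¹) x =
      ∫ t in c..d, |ε| * (ε * tailKernel ε t x - 1) := by
    rw [segmentPotential, ← intervalIntegral.integral_comp_add_right
      (fun t => (√(x.1 + (x.2 - t) ^ 2))⁻¹), ← intervalIntegral.integral_neg]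
    refine intervalIntegral.integral_congr fun t ht => ?_
    rw [uIcc_of_le hcd] at ht
    have hpos := scaledDist_pos hR hε (abs_le_of_mem_Icc hc hd ht) h1 h2
    have h3 : x.1 + (x.2 - (t + ε⁻¹)) ^ 2 = scaledDist ε t x / |ε| ^ 2 := by
      rw [sq_abs, scaledDist]
      field_simp
      ring
    rw [mul_tailKernel hpos, h3, Real.sqrt_div hpos.le, Real.sqrt_sq (abs_nonneg ε), inv_div]
    ring
  have hi := intervalIntegrable_tailKernel hc hd hcd hε h1 h2
  rw [e1, intervalIntegral.integral_const_mul,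
    intervalIntegral.integral_sub (hi.const_mul ε) intervalIntegrable_const,
    intervalIntegral.integral_const_mul]
  simp
  ring

end Tail

/-- The far part of the renormalized series is a smooth axisymmetric harmonic function, across the
axis as well. The translates by `±j P` together contribute `-2 (d - c) / (j P)`, which is
compensated by the logarithm up to a convergent sequence, and a remainder with summable weights
`(j P)⁻²`. -/
theorem exists_tail {P c d : ℝ} (hP : 0 < P) (hcd : c ≤ d) (R : ℝ) (N₀ : ℕ) :
    ∃ N : ℕ, N₀ ≤ N ∧ ∃ τ : ℝ × ℝ → ℝ, ∀ x : ℝ × ℝ, |x.1| < R → |x.2| < R →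
      IsAxiHarmonicAt τ x ∧ Tendsto (fun n : ℕ => ∑ j ∈ Finset.Ico (N + 1) (n + 1),
        (segmentPotential (c + j * P) (d + j * P) x + segmentPotential (c - j * P) (d - j * P) x)
        + 2 * (d - c) / P * Real.log n) atTop (𝓝 (τ x)) := by
  set R' : ℝ := max R (max |c| |d|) with hR'
  have hc : |c| ≤ R' := (le_max_left _ _).trans (le_max_right _ _)
  have hd : |d| ≤ R' := (le_max_right _ _).trans (le_max_right _ _)
  have hRR : R ≤ R' := le_max_left _ _
  have hR0 : 0 ≤ R' := (abs_nonneg c).trans hc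
  -- Translates with `|j| > N` are so far away that the tail kernel is smooth.
  obtain ⟨N, hN⟩ := exists_nat_gt (max (N₀ : ℝ) (8 * (R' + 1) / P))
  have hN0 : N₀ ≤ N := by exact_mod_cast ((le_max_left _ _).trans hN.le)
  have hNP : 8 * (R' + 1) < N * P := by
    have := (le_max_right _ _).trans_lt hN
    rwa [div_lt_iff₀ hP] at this
  have hNP0 : 0 < N * P := by linarith
  -- The inverse distances of the translates with `|j| > N`.
  set ε : ℕ → ℝ := fun i => (((N + 1 + i : ℕ) : ℝ) * P)⁻¹ with hεdef
  have hden : ∀ i : ℕ, N * P ≤ ((N + 1 + i : ℕ) : ℝ) * P := fun i => by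
    push_cast
    nlinarith [(Nat.cast_nonneg i : (0 : ℝ) ≤ i)]
  have hεC : ∀ i, ε i ∈ Icc 0 (N * P)⁻¹ := fun i =>
    ⟨inv_nonneg.2 (hNP0.le.trans (hden i)), inv_anti₀ hNP0 (hden i)⟩
  have hsmall : ∀ e ∈ Icc 0 (N * P)⁻¹, |e| * (8 * (R' + 1)) < 1 := by
    intro e he
    rw [abs_of_nonneg he.1]
    calc e * (8 * (R' + 1)) ≤ (N * P)⁻¹ * (8 * (R' + 1)) := by gcongr; exact he.2
      _ < (N * P)⁻¹ * (N * P) := by gcongr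
      _ = 1 := inv_mul_cancel₀ hNP0.ne'
  have hsmall' : ∀ e ∈ Icc 0 (N * P)⁻¹, |-e| * (8 * (R' + 1)) < 1 := fun e he => by
    rw [abs_neg]; exact hsmall e he
  have hsum : Summable fun i => ε i ^ 2 := by
    have h1 : Summable fun n : ℕ => P⁻¹ ^ 2 * (1 / (n : ℝ) ^ 2) :=
      (Real.summable_one_div_nat_pow.2 one_lt_two).mul_left _
    refine ((summable_nat_add_iff (N + 1)).2 h1).congr fun i => ?_
    simp only [hεdef, Nat.cast_add]
    field_simp
    ring
  obtain ⟨g, hg⟩ := exists_isAxiHarmonicAt_hasSum (C := Icc 0 (N * P)⁻¹)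
    (O := {x : ℝ × ℝ | |x.1| < R' ∧ |x.2| < R'})
    (K := fun e x => (∫ t in c..d, tailKernel e t x) - ∫ t in c..d, tailKernel (-e) t x)
    isCompact_Icc (isOpen_tailBox R')
    (fun e he x hx => ContDiffAt.sub (contDiffAt_integral_tailKernel hcd hc hd (hsmall e he) hx.1
        hx.2) (ContDiffAt.comp (f := fun q : ℝ × ℝ × ℝ => (-q.1, q.2)) (e, x)
        (contDiffAt_integral_tailKernel hcd hc hd (hsmall' e he) hx.1 hx.2) (by fun_prop)))
    (fun e he x hx => by
      have := (isAxiHarmonicAt_integral_tailKernel hcd hc hd (hsmall e he) hx.1 hx.2).add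
        (isAxiHarmonicAt_integral_tailKernel hcd hc hd (hsmall' e he) hx.1 hx.2).neg
      simpa only [← sub_eq_add_neg] using this.2)
    hεC (fun i => sq_nonneg (ε i)) hsum
  set H : ℝ := ∑ j ∈ Finset.range N, ((j : ℝ) + 1)⁻¹ with hH
  refine ⟨N, hN0, fun x => g x + -(2 * (d - c) / P * (Real.eulerMascheroniConstant - H)),
    fun x h1 h2 => ?_⟩
  have h1 := h1.trans_le hRR
  have h2 := h2.trans_le hRR
  obtain ⟨hg1, hg2⟩ := hg x ⟨h1, h2⟩
  refine ⟨hg1.add (IsAxiHarmonicAt.const _), ?_⟩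
  have hterm : ∀ i : ℕ, segmentPotential (c + (N + 1 + i : ℕ) * P) (d + (N + 1 + i : ℕ) * P) x +
      segmentPotential (c - (N + 1 + i : ℕ) * P) (d - (N + 1 + i : ℕ) * P) x =
      ε i ^ 2 * ((∫ t in c..d, tailKernel (ε i) t x) - ∫ t in c..d, tailKernel (-ε i) t x)
      - 2 * (d - c) / P * (((N + i : ℕ) : ℝ) + 1)⁻¹ := by
    intro i
    have hpos : 0 < ε i := inv_pos.2 (hNP0.trans_le (hden i))
    have e1 := segmentPotential_add_inv hcd hc hd hpos.ne' (hsmall _ (hεC i)) h1 h2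
    have e2 := segmentPotential_add_inv hcd hc hd (neg_ne_zero.2 hpos.ne')
      (hsmall' _ (hεC i)) h1 h2
    have e3 : (ε i)⁻¹ = (N + 1 + i : ℕ) * P := inv_inv _
    have e4 : 2 * (d - c) / P * (((N + i : ℕ) : ℝ) + 1)⁻¹ = 2 * ε i * (d - c) := by
      have h5 : ((N + 1 + i : ℕ) : ℝ) = ((N + i : ℕ) : ℝ) + 1 := by push_cast; ring
      simp only [hεdef, h5]
      have : ((N + i : ℕ) : ℝ) + 1 ≠ 0 := by positivity
      field_simp
    rw [e3, abs_of_pos hpos] at e1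
    rw [inv_neg, e3, abs_neg, abs_of_pos hpos, ← sub_eq_add_neg, ← sub_eq_add_neg] at e2
    rw [e4]
    linear_combination e1 + e2
  have hharm : ∀ n : ℕ, N ≤ n → ∑ i ∈ Finset.range (n - N), (((N + i : ℕ) : ℝ) + 1)⁻¹ =
      (harmonic n : ℝ) - H := by
    intro n hn
    rw [harmonic, hH, eq_sub_iff_add_eq']
    push_cast
    have h := Finset.sum_range_add (fun j : ℕ => ((j : ℝ) + 1)⁻¹) N (n - N)
    rw [Nat.add_sub_cancel' hn] at h
    rw [h]
    push_cast
    rfl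
  have hlim : Tendsto (fun n : ℕ => (∑ i ∈ Finset.range (n - N), ε i ^ 2 *
      ((∫ t in c..d, tailKernel (ε i) t x) - ∫ t in c..d, tailKernel (-ε i) t x)) +
      -(2 * (d - c) / P * (((harmonic n : ℝ) - Real.log n) - H))) atTop
      (𝓝 (g x + -(2 * (d - c) / P * (Real.eulerMascheroniConstant - H)))) :=
    (hg2.tendsto_sum_nat.comp (tendsto_sub_atTop_nat N)).add
      (((Real.tendsto_harmonic_sub_log.sub_const H).const_mul _).neg)
  refine hlim.congr' ?_
  filter_upwards [eventually_ge_atTop N] with n hn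
  rw [Finset.sum_Ico_eq_sum_range, Nat.add_sub_add_right, Finset.sum_congr rfl fun i _ => hterm i,
    Finset.sum_sub_distrib, ← Finset.mul_sum, hharm n hn]
  ring

/-! ### Periodic potentials -/

/-- The renormalized partial sums of the potentials of the translates by `j * P`, `|j| ≤ n`, of the
segment `[c, d]`, without the translates with `j ∈ J`. -/
noncomputable def partialPeriodic (P c d : ℝ) (J : Finset ℤ) (n : ℕ) (x : ℝ × ℝ) : ℝ :=
  ∑ j ∈ Finset.Icc (-(n : ℤ)) n,
    (if j ∈ J then 0 else segmentPotential (c + j * P) (d + j * P) x)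
    + 2 * (d - c) / P * Real.log n

/-- The renormalized potential of the translates by multiples of `P` of the segment `[c, d]`,
without the translates by `j * P` with `j ∈ J`. -/
noncomputable def periodicPotential (P c d : ℝ) (J : Finset ℤ) (x : ℝ × ℝ) : ℝ :=
  limUnder atTop fun n : ℕ => partialPeriodic P c d J n x

theorem sum_Icc_neg_succ (F : ℤ → ℝ) (n : ℕ) :
    ∑ j ∈ Finset.Icc (-((n + 1 : ℕ) : ℤ)) (n + 1 : ℕ), F j =
      ∑ j ∈ Finset.Icc (-(n : ℤ)) n, F j + (F (n + 1 : ℕ) + F (-(n + 1 : ℕ))) := by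
  have h1 : Finset.Icc (-((n + 1 : ℕ) : ℤ)) (n + 1 : ℕ) =
      insert ((n + 1 : ℕ) : ℤ) (insert (-((n + 1 : ℕ) : ℤ)) (Finset.Icc (-(n : ℤ)) n)) := by
    ext j
    simp only [Finset.mem_insert, Finset.mem_Icc]
    omega
  rw [h1, Finset.sum_insert (by simp only [Finset.mem_insert, Finset.mem_Icc]; omega),
    Finset.sum_insert (by simp only [Finset.mem_Icc]; omega)]
  ring

theorem sum_Icc_neg_eq {N : ℕ} (F : ℤ → ℝ) {n : ℕ} (hn : N ≤ n) :
    ∑ j ∈ Finset.Icc (-(n : ℤ)) n, F j =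
      ∑ j ∈ Finset.Icc (-(N : ℤ)) N, F j + ∑ j ∈ Finset.Ico (N + 1) (n + 1), (F j + F (-j)) := by
  induction n, hn using Nat.le_induction with
  | base => simp
  | succ n hn ih =>
    rw [sum_Icc_neg_succ, ih, Finset.sum_Ico_succ_top (show N + 1 ≤ n + 1 by omega), add_assoc]

/-- A shift of a symmetric sum changes only two boundary terms. -/
theorem sum_Icc_neg_shift (F : ℤ → ℝ) (n : ℕ) :
    ∑ j ∈ Finset.Icc (-(n : ℤ)) n, F (j + 1) =
      ∑ j ∈ Finset.Icc (-(n : ℤ)) n, F j + (F (n + 1 : ℕ) - F (-n)) := by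
  induction n with
  | zero => simp
  | succ n ih =>
    rw [sum_Icc_neg_succ, sum_Icc_neg_succ, ih]
    have h1 : -((n + 1 : ℕ) : ℤ) + 1 = -n := by push_cast; ring
    rw [h1]
    push_cast
    ring

/-- On a bounded region the periodic potential is a finite sum of potentials of segments and a
smooth harmonic function. -/
theorem exists_near_add_tail {P c d : ℝ} (hP : 0 < P) (hcd : c ≤ d) (J : Finset ℤ) (R : ℝ) :
    ∃ N : ℕ, ∃ τ : ℝ × ℝ → ℝ, ∀ x : ℝ × ℝ, |x.1| < R → |x.2| < R →
      IsAxiHarmonicAt τ x ∧ Tendsto (fun n : ℕ => partialPeriodic P c d J n x) atTop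
        (𝓝 (∑ j ∈ Finset.Icc (-(N : ℤ)) N,
          (if j ∈ J then 0 else segmentPotential (c + j * P) (d + j * P) x) + τ x)) := by
  obtain ⟨N, hN, τ, hτ⟩ := exists_tail hP hcd R (J.sup Int.natAbs)
  refine ⟨N, τ, fun x h1 h2 => ⟨(hτ x h1 h2).1, ?_⟩⟩
  refine ((hτ x h1 h2).2.const_add _).congr' ?_
  filter_upwards [eventually_ge_atTop N] with n hn
  rw [partialPeriodic, sum_Icc_neg_eq _ hn, add_assoc]
  congr 2
  refine Finset.sum_congr rfl fun j hj => ?_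
  rw [Finset.mem_Ico] at hj
  have hJ : ∀ i : ℤ, N < i.natAbs → i ∉ J := fun i hi hiJ => by
    have := Finset.le_sup (f := Int.natAbs) hiJ
    omega
  rw [if_neg (hJ _ (by omega)), if_neg (hJ _ (by omega))]
  push_cast
  ring_nf

section

variable {P c d : ℝ}

theorem tendsto_partialPeriodic (hP : 0 < P) (hcd : c ≤ d) (J : Finset ℤ) (x : ℝ × ℝ) :
    Tendsto (fun n : ℕ => partialPeriodic P c d J n x) atTop (𝓝 (periodicPotential P c d J x)) := by
  obtain ⟨N, τ, h⟩ := exists_near_add_tail hP hcd J (max |x.1| |x.2| + 1)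
  exact tendsto_nhds_limUnder ⟨_, (h x (by linarith [le_max_left |x.1| |x.2|])
    (by linarith [le_max_right |x.1| |x.2|])).2⟩

/-- The periodic potential is smooth and harmonic away from the segments, also across the axis. -/
theorem isAxiHarmonicAt_periodicPotential (hP : 0 < P) (hcd : c ≤ d) {J : Finset ℤ} {x : ℝ × ℝ}
    (hx : ∀ j ∉ J, ∀ t ∈ Icc (c + j * P) (d + j * P), 0 < x.1 + (x.2 - t) ^ 2) :
    IsAxiHarmonicAt (periodicPotential P c d J) x := by
  set R := max |x.1| |x.2| + 1 with hR
  obtain ⟨N, τ, h⟩ := exists_near_add_tail hP hcd J R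
  have h1 : |x.1| < R := by linarith [le_max_left |x.1| |x.2|]
  have h2 : |x.2| < R := by linarith [le_max_right |x.1| |x.2|]
  have h3 : IsAxiHarmonicAt (fun x => ∑ j ∈ Finset.Icc (-(N : ℤ)) N,
      (if j ∈ J then 0 else segmentPotential (c + j * P) (d + j * P) x) + τ x) x := by
    refine IsAxiHarmonicAt.add (IsAxiHarmonicAt.sum fun j _ => ?_) (h x h1 h2).1
    by_cases hj : j ∈ J
    · simpa only [if_pos hj] using IsAxiHarmonicAt.const 0
    · simpa only [if_neg hj] using isAxiHarmonicAt_segmentPotential (by linarith) (hx j hj)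
  refine h3.congr ?_
  filter_upwards [(isOpen_tailBox R).mem_nhds (show x ∈ _ from ⟨h1, h2⟩)] with y hy
  exact (h y hy.1 hy.2).2.limUnder_eq

theorem periodicPotential_eq_sum_add (hP : 0 < P) (hcd : c ≤ d) (J : Finset ℤ) (x : ℝ × ℝ) :
    periodicPotential P c d ∅ x =
      ∑ j ∈ J, segmentPotential (c + j * P) (d + j * P) x + periodicPotential P c d J x := by
  refine tendsto_nhds_unique (tendsto_partialPeriodic hP hcd ∅ x)
    (((tendsto_partialPeriodic hP hcd J x).const_add _).congr' ?_)
  filter_upwards [eventually_ge_atTop (J.sup Int.natAbs)] with n hn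
  have hJ : J ⊆ Finset.Icc (-(n : ℤ)) n := fun i hi => by
    have := Finset.le_sup (f := Int.natAbs) hi
    rw [Finset.mem_Icc]
    omega
  rw [partialPeriodic, partialPeriodic, ← add_assoc, ← Finset.inter_eq_right.2 hJ,
    ← Finset.sum_ite_mem, ← Finset.sum_add_distrib, Finset.inter_eq_right.2 hJ]
  congr 1
  refine Finset.sum_congr rfl fun j _ => ?_
  by_cases hj : j ∈ J <;> simp [hj]

theorem segmentPotential_nonpos (hcd : c ≤ d) (x : ℝ × ℝ) : segmentPotential c d x ≤ 0 :=
  neg_nonpos.2 (intervalIntegral.integral_nonneg hcd fun _ _ => inv_nonneg.2 (Real.sqrt_nonneg _))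

/-- The potentials of far translates tend to zero: by convergence of the renormalized series the
sum of the two outermost terms does, and both have the same sign. -/
theorem tendsto_segmentPotential_translate (hP : 0 < P) (hcd : c ≤ d) (x : ℝ × ℝ) {F : ℤ → ℝ}
    (hF : F = fun j : ℤ => segmentPotential (c + j * P) (d + j * P) x) :
    Tendsto (fun n : ℕ => F (n + 1 : ℕ)) atTop (𝓝 0) ∧
      Tendsto (fun n : ℕ => F (-(n + 1 : ℕ))) atTop (𝓝 0) := by
  have hpp : ∀ n, partialPeriodic P c d ∅ n x = ∑ j ∈ Finset.Icc (-(n : ℤ)) n, F j +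
      2 * (d - c) / P * Real.log n := fun n => by
    simp only [hF, partialPeriodic, Finset.notMem_empty, if_false]
  have h := tendsto_partialPeriodic hP hcd ∅ x
  have h1 := ((tendsto_add_atTop_iff_nat 1).2 h).sub h
  have h2 : Tendsto (fun n : ℕ => 2 * (d - c) / P * (Real.log (n + 1) - Real.log n)) atTop
      (𝓝 (2 * (d - c) / P * 0)) := Real.tendsto_log_nat_add_one_sub_log.const_mul _
  have h3 : Tendsto (fun n : ℕ => F (n + 1 : ℕ) + F (-(n + 1 : ℕ))) atTop (𝓝 0) := by
    have h4 := h1.sub h2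
    rw [sub_self, mul_zero, sub_zero] at h4
    refine h4.congr fun n => ?_
    rw [hpp, hpp, sum_Icc_neg_succ]
    push_cast
    ring
  have hn : ∀ j, F j ≤ 0 := fun j => by
    rw [hF]
    exact segmentPotential_nonpos (by linarith) x
  exact ⟨tendsto_of_tendsto_of_tendsto_of_le_of_le h3 tendsto_const_nhds
      (fun n => by linarith [hn (-(n + 1 : ℕ))]) fun n => hn _,
    tendsto_of_tendsto_of_tendsto_of_le_of_le h3 tendsto_const_nhds
      (fun n => by linarith [hn (n + 1 : ℕ)]) fun n => hn _⟩

/-- The renormalized potential does not depend on the choice of the period cell. -/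
theorem periodicPotential_add_period (hP : 0 < P) (hcd : c ≤ d) (x : ℝ × ℝ) :
    periodicPotential P (c + P) (d + P) ∅ x = periodicPotential P c d ∅ x := by
  set F : ℤ → ℝ := fun j => segmentPotential (c + j * P) (d + j * P) x with hF
  have h1 := tendsto_partialPeriodic hP (show c + P ≤ d + P by linarith) ∅ x
  have h2 := tendsto_partialPeriodic hP hcd ∅ x
  obtain ⟨h3, h4⟩ := tendsto_segmentPotential_translate hP hcd x hF
  have h5 := ((tendsto_add_atTop_iff_nat 1).2 h2).add
    (((tendsto_add_atTop_iff_nat 1).2 h3).sub h4)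
  rw [sub_zero, add_zero] at h5
  refine tendsto_nhds_unique ((tendsto_add_atTop_iff_nat 1).2 h1) (h5.congr fun n => ?_)
  have e1 : ∀ j : ℤ, segmentPotential (c + P + j * P) (d + P + j * P) x = F (j + 1) := fun j => by
    simp only [hF]
    push_cast
    ring_nf
  simp only [partialPeriodic, Finset.notMem_empty, if_false, e1, sum_Icc_neg_shift]
  ring

theorem segmentPotential_translate (a b h s z : ℝ) :
    segmentPotential a b (s, z + h) = segmentPotential (a - h) (b - h) (s, z) := by
  rw [segmentPotential, segmentPotential, ← intervalIntegral.integral_comp_sub_right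
    (fun t => (√(s + (z - t) ^ 2))⁻¹)]
  congr 1
  refine intervalIntegral.integral_congr fun t _ => ?_
  ring_nf

theorem segmentPotential_reflect (a b s z : ℝ) :
    segmentPotential a b (s, -z) = segmentPotential (-b) (-a) (s, z) := by
  rw [segmentPotential, segmentPotential, ← intervalIntegral.integral_comp_neg
    (fun t => (√(s + (z - t) ^ 2))⁻¹)]
  congr 1
  refine intervalIntegral.integral_congr fun t _ => ?_
  ring_nf

theorem periodicPotential_translate (P c d h s z : ℝ) :
    periodicPotential P c d ∅ (s, z + h) = periodicPotential P (c - h) (d - h) ∅ (s, z) := by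
  have : (fun n : ℕ => partialPeriodic P c d ∅ n (s, z + h)) =
      fun n : ℕ => partialPeriodic P (c - h) (d - h) ∅ n (s, z) := by
    funext n
    simp only [partialPeriodic, segmentPotential_translate, Finset.notMem_empty, if_false]
    congr 1
    · exact Finset.sum_congr rfl fun j _ => by ring_nf
    · ring_nf
  rw [periodicPotential, periodicPotential, this]

theorem periodicPotential_reflect (P c d s z : ℝ) :
    periodicPotential P c d ∅ (s, -z) = periodicPotential P (-d) (-c) ∅ (s, z) := by
  have : (fun n : ℕ => partialPeriodic P c d ∅ n (s, -z)) =
      fun n : ℕ => partialPeriodic P (-d) (-c) ∅ n (s, z) := by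
    funext n
    simp only [partialPeriodic, segmentPotential_reflect, Finset.notMem_empty, if_false]
    congr 1
    · refine Finset.sum_equiv (Equiv.neg ℤ) (fun j => ?_) (fun j _ => ?_)
      · simp only [Finset.mem_Icc, Equiv.neg_apply]
        omega
      · simp only [Equiv.neg_apply]
        push_cast
        ring_nf
    · ring_nf
  rw [periodicPotential, periodicPotential, this]

end

theorem partialPotential_eq (D : RodDiagram) (i : Angle) (n : ℕ) {ρ : ℝ} (hρ : 0 < ρ) (z : ℝ) :
    partialPotential D i n ρ z = (D.cell.map fun R => if R.kind = .axis i then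
      partialPeriodic D.period R.a R.b ∅ n (ρ ^ 2, z) else 0).sum := by
  have key : ∀ l : List Rod, ∑ j ∈ Finset.Icc (-(n : ℤ)) n,
      (l.map fun R => if R.kind = .axis i then
        rodPotential (R.a + j * D.period) (R.b + j * D.period) ρ z else 0).sum
      + 2 * (l.map fun R => if R.kind = .axis i then R.b - R.a else 0).sum / D.period *
        Real.log n = (l.map fun R => if R.kind = .axis i then
      partialPeriodic D.period R.a R.b ∅ n (ρ ^ 2, z) else 0).sum := by
    intro l
    induction l with
    | nil => simp
    | cons R l ih =>
      simp only [List.map_cons, List.sum_cons, Finset.sum_add_distrib]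
      rw [← ih]
      by_cases h : R.kind = .axis i
      · simp only [if_pos h, partialPeriodic, rodPotential_eq_segmentPotential _ _ hρ,
          Finset.notMem_empty, if_false]
        ring
      · simp only [if_neg h, Finset.sum_const_zero]
        ring
  exact key D.cell

/-- The renormalized potential of the axis rods of kind `i`, as a function of `(ρ ^ 2, z)`, with the
additive constant `0`. -/
noncomputable def diagramPotential (D : RodDiagram) (i : Angle) (x : ℝ × ℝ) : ℝ :=
  (D.cell.map fun R => if R.kind = .axis i then
    periodicPotential D.period R.a R.b ∅ x else 0).sum

theorem tendsto_partialPotential {D : RodDiagram} (hP : 0 < D.period)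
    (hD : ∀ R ∈ D.cell, R.a ≤ R.b) (i : Angle) {ρ : ℝ} (hρ : 0 < ρ) (z : ℝ) :
    Tendsto (fun n : ℕ => partialPotential D i n ρ z) atTop
      (𝓝 (diagramPotential D i (ρ ^ 2, z))) := by
  simp only [partialPotential_eq D i _ hρ z, diagramPotential]
  refine tendsto_list_sum _ fun R hR => ?_
  by_cases h : R.kind = .axis i
  · simpa only [if_pos h] using tendsto_partialPeriodic hP (hD R hR) ∅ _
  · simp only [if_neg h, tendsto_const_nhds]

theorem isAxiHarmonicAt_diagramPotential {D : RodDiagram} (hP : 0 < D.period)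
    (hD : ∀ R ∈ D.cell, R.a ≤ R.b) (i : Angle) {x : ℝ × ℝ} (hx : 0 < x.1) :
    IsAxiHarmonicAt (diagramPotential D i) x := by
  unfold diagramPotential
  have key : ∀ l : List Rod, (∀ R ∈ l, R.a ≤ R.b) → IsAxiHarmonicAt (fun x =>
      (l.map fun R => if R.kind = .axis i then
        periodicPotential D.period R.a R.b ∅ x else 0).sum) x := by
    intro l hl
    induction l with
    | nil => exact IsAxiHarmonicAt.const 0
    | cons R l ih =>
      simp only [List.map_cons, List.sum_cons]
      refine IsAxiHarmonicAt.add ?_ (ih fun R hR => hl R (List.mem_cons_of_mem _ hR))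
      by_cases h : R.kind = .axis i
      · simp only [if_pos h]
        exact isAxiHarmonicAt_periodicPotential hP (hl R List.mem_cons_self)
          fun j _ t _ => by positivity
      · simpa only [if_neg h] using IsAxiHarmonicAt.const 0
  exact key D.cell hD

/-! ### Behaviour of the potentials at the axis -/

/-- The function `log (r - (z - c))`, singular on the part `z ≥ c` of the axis. -/
noncomputable def northLog (c : ℝ) (x : ℝ × ℝ) : ℝ :=
  Real.log (√(x.1 + (x.2 - c) ^ 2) - (x.2 - c))

/-- The function `log (r + (z - c))`, singular on the part `z ≤ c` of the axis. -/
noncomputable def southLog (c : ℝ) (x : ℝ × ℝ) : ℝ :=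
  Real.log (√(x.1 + (x.2 - c) ^ 2) + (x.2 - c))

theorem abs_lt_sqrt_add_sq {s : ℝ} (hs : 0 < s) (y : ℝ) : |y| < √(s + y ^ 2) := by
  rw [← Real.sqrt_sq_eq_abs]
  exact Real.sqrt_lt_sqrt (sq_nonneg y) (by linarith)

theorem northLog_add_southLog (c : ℝ) {x : ℝ × ℝ} (hx : 0 < x.1) :
    northLog c x + southLog c x = Real.log x.1 := by
  have h := abs_lt.1 (abs_lt_sqrt_add_sq hx (x.2 - c))
  have h1 := Real.sq_sqrt (show 0 ≤ x.1 + (x.2 - c) ^ 2 by positivity)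
  rw [northLog, southLog, ← Real.log_mul (by linarith [h.2]) (by linarith [h.1])]
  congr 1
  linear_combination h1

theorem segmentPotential_eq_northLog (a b : ℝ) {x : ℝ × ℝ} (hx : 0 < x.1) :
    segmentPotential a b x = northLog a x - northLog b x := by
  have h := rodPotential_eq_segmentPotential a b (Real.sqrt_pos.2 hx) x.2
  rw [Real.sq_sqrt hx.le] at h
  rw [← h, rodPotential, Real.sq_sqrt hx.le]
  rfl

theorem contDiffAt_northLog {c : ℝ} {x : ℝ × ℝ} (h1 : 0 < x.1 + (x.2 - c) ^ 2) (h2 : x.2 < c) :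
    ContDiffAt ℝ ∞ (northLog c) x := by
  have := Real.sqrt_nonneg (x.1 + (x.2 - c) ^ 2)
  refine ContDiffAt.log (ContDiffAt.sub (ContDiffAt.sqrt (by fun_prop) h1.ne') (by fun_prop)) ?_
  linarith

theorem contDiffAt_southLog {c : ℝ} {x : ℝ × ℝ} (h1 : 0 < x.1 + (x.2 - c) ^ 2) (h2 : c < x.2) :
    ContDiffAt ℝ ∞ (southLog c) x := by
  have := Real.sqrt_nonneg (x.1 + (x.2 - c) ^ 2)
  refine ContDiffAt.log (ContDiffAt.add (ContDiffAt.sqrt (by fun_prop) h1.ne') (by fun_prop)) ?_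
  linarith

/-- The domain in the plane of `(ρ ^ 2, z)`, containing `ρ ^ 2 ≥ 0`, `a < z < b`, to which
potentials that are singular at most at `z = a` and `z = b` extend smoothly. -/
def rodDomain (a b : ℝ) : Set (ℝ × ℝ) :=
  {x | (a < x.2 ∧ x.2 < b) ∧ 0 < x.1 + (x.2 - a) ^ 2 ∧ 0 < x.1 + (x.2 - b) ^ 2}

theorem isOpen_rodDomain (a b : ℝ) : IsOpen (rodDomain a b) :=
  IsOpen.and (IsOpen.and (isOpen_lt (by fun_prop) (by fun_prop)) (isOpen_lt (by fun_prop)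
    (by fun_prop))) (IsOpen.and (isOpen_lt (by fun_prop) (by fun_prop))
    (isOpen_lt (by fun_prop) (by fun_prop)))

theorem mem_rodDomain_of_nonneg {a b s z : ℝ} (hs : 0 ≤ s) (h1 : a < z) (h2 : z < b) :
    (s, z) ∈ rodDomain a b :=
  ⟨⟨h1, h2⟩, by have : 0 < z - a := by linarith
                positivity, by have : z - b ≠ 0 := by linarith
                               positivity⟩

theorem mem_rodDomain_segment {a b s₁ s z t : ℝ} (hs₁ : 0 ≤ s₁) (h : (s, z) ∈ rodDomain a b)
    (ht : t ∈ Icc (0 : ℝ) 1) : (s₁ + t * (s - s₁), z) ∈ rodDomain a b := by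
  obtain ⟨h1, h2, h3⟩ := h
  have h4 := mem_rodDomain_of_nonneg hs₁ h1.1 h1.2
  dsimp only at h2 h3
  have h5 := h4.2.1
  have h6 := h4.2.2
  dsimp only at h5 h6
  refine ⟨h1, ?_, ?_⟩ <;> dsimp only
  · rcases eq_or_lt_of_le ht.2 with h | h
    · subst h; linarith
    · nlinarith [mul_pos (sub_pos.2 h) h5, mul_nonneg ht.1 h2.le]
  · rcases eq_or_lt_of_le ht.2 with h | h
    · subst h; linarith
    · nlinarith [mul_pos (sub_pos.2 h) h6, mul_nonneg ht.1 h3.le]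

/-- The period and the lengths of the rods are positive. The rods in a period cell are disjoint up
to end points, from each other and from all translates. -/
structure RodDiagram.IsSeparated (D : RodDiagram) : Prop where
  period_pos : 0 < D.period
  nodup : D.cell.Nodup
  lt : ∀ R ∈ D.cell, R.a < R.b
  short : ∀ R ∈ D.cell, R.b - R.a < D.period
  sep : ∀ R ∈ D.cell, ∀ R' ∈ D.cell, ∀ j j' : ℤ, (R = R' ∧ j = j') ∨
    R.b + j * D.period ≤ R'.a + j' * D.period ∨ R'.b + j' * D.period ≤ R.a + j * D.period

section

variable {D : RodDiagram}

open Classical in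
theorem diagramPotential_eq_sum (hD : D.IsSeparated) (i : Angle) (J : Rod → Finset ℤ) (x : ℝ × ℝ) :
    diagramPotential D i x =
      ∑ R ∈ D.cell.toFinset, (if R.kind = .axis i then
        ∑ j ∈ J R, segmentPotential (R.a + j * D.period) (R.b + j * D.period) x else 0) +
      ∑ R ∈ D.cell.toFinset, (if R.kind = .axis i then
        periodicPotential D.period R.a R.b (J R) x else 0) := by
  rw [diagramPotential, ← List.sum_toFinset _ hD.nodup, ← Finset.sum_add_distrib]
  refine Finset.sum_congr rfl fun R hR => ?_
  by_cases h : R.kind = .axis i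
  · simp only [if_pos h]
    exact periodicPotential_eq_sum_add hD.period_pos (hD.lt R (List.mem_toFinset.1 hR)).le _ _
  · simp only [if_neg h, add_zero]

open Classical in
theorem contDiffAt_sum_periodicPotential (hD : D.IsSeparated) (i : Angle) (J : Rod → Finset ℤ)
    {x : ℝ × ℝ} (hx : ∀ R ∈ D.cell, ∀ j ∉ J R,
      ∀ t ∈ Icc (R.a + j * D.period) (R.b + j * D.period), 0 < x.1 + (x.2 - t) ^ 2) :
    ContDiffAt ℝ ∞ (fun x => ∑ R ∈ D.cell.toFinset, (if R.kind = .axis i then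
        periodicPotential D.period R.a R.b (J R) x else 0)) x := by
  refine ContDiffAt.sum fun R hR => ?_
  rw [List.mem_toFinset] at hR
  by_cases h : R.kind = .axis i
  · simp only [if_pos h]
    exact (isAxiHarmonicAt_periodicPotential hD.period_pos (hD.lt R hR).le (hx R hR)).1
  · simpa only [if_neg h] using contDiffAt_const

open Classical in
/-- Near a rod, a potential is `log ρ²`, if the rod is of its kind, plus a smooth function. -/
theorem exists_smooth_part_rod (hD : D.IsSeparated) (i : Angle) {R₁ : Rod} (hR₁ : R₁ ∈ D.cell)
    (j₁ : ℤ) : ∃ f : ℝ × ℝ → ℝ,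
      ∀ x ∈ rodDomain (R₁.a + j₁ * D.period) (R₁.b + j₁ * D.period), ContDiffAt ℝ ∞ f x ∧
        (0 < x.1 → diagramPotential D i x =
          (if R₁.kind = .axis i then Real.log x.1 else 0) + f x) := by
  set a := R₁.a + j₁ * D.period with ha
  set b := R₁.b + j₁ * D.period with hb
  set J : Rod → Finset ℤ := fun R => if R = R₁ then {j₁} else ∅ with hJ
  refine ⟨fun x => (if R₁.kind = .axis i then -southLog a x - northLog b x else 0) +
    ∑ R ∈ D.cell.toFinset, (if R.kind = .axis i then
        periodicPotential D.period R.a R.b (J R) x else 0), fun x hx => ⟨?_, fun hx0 => ?_⟩⟩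
  · refine ContDiffAt.add ?_ (contDiffAt_sum_periodicPotential hD i J fun R hR j hj t ht => ?_)
    · by_cases h : R₁.kind = .axis i
      · simp only [if_pos h]
        exact (contDiffAt_southLog hx.2.1 hx.1.1).neg.sub (contDiffAt_northLog hx.2.2 hx.1.2)
      · simpa only [if_neg h] using contDiffAt_const
    · obtain ⟨⟨h1, h2⟩, h3, h4⟩ := hx
      rcases hD.sep R hR R₁ hR₁ j j₁ with ⟨h, h'⟩ | h | h
      · simp [hJ, h, h'] at hj
      · nlinarith [ht.1, ht.2]
      · nlinarith [ht.1, ht.2]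
  · rw [diagramPotential_eq_sum hD i J, ← add_assoc]
    congr 1
    rw [Finset.sum_eq_single_of_mem R₁ (List.mem_toFinset.2 hR₁)]
    · by_cases h : R₁.kind = .axis i
      · simp only [if_pos h, hJ, if_true, Finset.sum_singleton]
        rw [← ha, ← hb, segmentPotential_eq_northLog _ _ hx0]
        linear_combination northLog_add_southLog a hx0
      · simp [if_neg h]
    · intro R _ hR
      simp [hJ, hR]

open Classical in
/-- Near a common end point `z₀` of two rods, a potential is the sum of `log (r + (z - z₀))` and
`log (r - (z - z₀))`, if the southern and northern rod respectively is of its kind, and a smooth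
function. -/
theorem exists_smooth_part_endpoint (hD : D.IsSeparated) {R₁ R₂ : Rod} (hR₁ : R₁ ∈ D.cell)
    (hR₂ : R₂ ∈ D.cell) {j₁ j₂ : ℤ} {z₀ : ℝ} (h₁ : R₁.b + j₁ * D.period = z₀)
    (h₂ : R₂.a + j₂ * D.period = z₀) :
    ∃ ε > 0, z₀ + ε ≤ R₂.b + j₂ * D.period ∧ R₁.a + j₁ * D.period ≤ z₀ - ε ∧
      ∀ i : Angle, ∃ f : ℝ × ℝ → ℝ,
      ∀ x : ℝ × ℝ, |x.1| < ε ^ 2 → |x.2 - z₀| < ε → ContDiffAt ℝ ∞ f x ∧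
        (0 < x.1 → diagramPotential D i x =
          (if R₁.kind = .axis i then southLog z₀ x else 0) +
          (if R₂.kind = .axis i then northLog z₀ x else 0) + f x) := by
  have hl₁ := hD.lt R₁ hR₁
  have hl₂ := hD.lt R₂ hR₂
  set a := R₁.a + j₁ * D.period with ha
  set b := R₂.b + j₂ * D.period with hb
  have haz : a < z₀ := by linarith
  have hzb : z₀ < b := by linarith
  have hne : R₂ ≠ R₁ := by
    rintro rfl
    have h3 := hD.short R₂ hR₂
    have h4 : 0 < ((j₂ - j₁ : ℤ) : ℝ) * D.period := by
      push_cast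
      nlinarith
    have h5 : (0 : ℝ) < ((j₂ - j₁ : ℤ) : ℝ) := pos_of_mul_pos_left h4 hD.period_pos.le
    have h6 : (1 : ℝ) ≤ ((j₂ - j₁ : ℤ) : ℝ) := by
      have : 0 < j₂ - j₁ := by exact_mod_cast h5
      exact_mod_cast this
    have h7 := mul_le_mul_of_nonneg_right h6 hD.period_pos.le
    push_cast at h7
    linarith
  set J : Rod → Finset ℤ := fun R => if R = R₁ then {j₁} else if R = R₂ then {j₂} else ∅ with hJ
  have hm := min_le_left (z₀ - a) (b - z₀)
  have hm' := min_le_right (z₀ - a) (b - z₀)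
  have hm0 : 0 < min (z₀ - a) (b - z₀) := lt_min (by linarith) (by linarith)
  obtain ⟨ε, hε⟩ : ∃ ε, 2 * ε = min (z₀ - a) (b - z₀) := ⟨min (z₀ - a) (b - z₀) / 2, by ring⟩
  have hε0 : 0 < ε := by linarith
  have hne' : R₁ ≠ R₂ := fun h => hne h.symm
  refine ⟨ε, hε0, by linarith, by linarith, fun i =>
    ⟨fun x => (if R₁.kind = .axis i then -southLog a x else 0) +
    (if R₂.kind = .axis i then -northLog b x else 0) +
    ∑ R ∈ D.cell.toFinset, (if R.kind = .axis i then
        periodicPotential D.period R.a R.b (J R) x else 0),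
        fun x hx1 hx2 => ⟨?_, fun hx0 => ?_⟩⟩⟩
  · rw [abs_lt] at hx1 hx2
    refine ContDiffAt.add (ContDiffAt.add ?_ ?_)
      (contDiffAt_sum_periodicPotential hD i J fun R hR j hj t ht => ?_)
    · by_cases h : R₁.kind = .axis i
      · simp only [if_pos h]
        exact (contDiffAt_southLog (by nlinarith) (by linarith)).neg
      · simpa only [if_neg h] using contDiffAt_const
    · by_cases h : R₂.kind = .axis i
      · simp only [if_pos h]
        exact (contDiffAt_northLog (by nlinarith) (by linarith)).neg
      · simpa only [if_neg h] using contDiffAt_const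
    · rcases hD.sep R hR R₁ hR₁ j j₁ with ⟨h, h'⟩ | h | h
      · simp [hJ, h, h'] at hj
      · have : t ≤ a := ht.2.trans h
        nlinarith
      · rcases hD.sep R hR R₂ hR₂ j j₂ with ⟨h, h'⟩ | h3 | h3
        · simp [hJ, h, h', hne] at hj
        · have := hD.lt R hR
          linarith
        · have : b ≤ t := h3.trans ht.1
          nlinarith
  · rw [diagramPotential_eq_sum hD i J, ← add_assoc]
    congr 1
    rw [← Finset.sum_subset (s₁ := {R₁, R₂}), Finset.sum_pair hne']
    · simp only [hJ, if_true, hne, if_false, Finset.sum_singleton, h₁, h₂, ← ha, ← hb,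
        segmentPotential_eq_northLog _ _ hx0]
      have e1 := northLog_add_southLog a hx0
      have e2 := northLog_add_southLog z₀ hx0
      split_ifs <;> linarith
    · intro R hR
      rw [Finset.mem_insert, Finset.mem_singleton] at hR
      rcases hR with rfl | rfl <;> rwa [List.mem_toFinset]
    · intro R _ hR
      rw [Finset.mem_insert, Finset.mem_singleton, not_or] at hR
      simp [hJ, hR.1, hR.2]

end

/-! ### The quadrature -/

/-- The component along `ds`, `s = ρ²`, of the differential of `α`. -/
noncomputable def quadratureS (U V : ℝ × ℝ → ℝ) (x : ℝ × ℝ) : ℝ :=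
  x.1 / 2 * (fderiv ℝ U x (1, 0) ^ 2 + fderiv ℝ V x (1, 0) ^ 2
      + fderiv ℝ U x (1, 0) * fderiv ℝ V x (1, 0))
    - (fderiv ℝ U x (0, 1) ^ 2 + fderiv ℝ V x (0, 1) ^ 2
      + fderiv ℝ U x (0, 1) * fderiv ℝ V x (0, 1)) / 8
    - (fderiv ℝ U x (1, 0) + fderiv ℝ V x (1, 0)) / 2

/-- The component along `dz` of the differential of `α`. -/
noncomputable def quadratureZ (U V : ℝ × ℝ → ℝ) (x : ℝ × ℝ) : ℝ :=
  x.1 * (fderiv ℝ U x (1, 0) * fderiv ℝ U x (0, 1) + fderiv ℝ V x (1, 0) * fderiv ℝ V x (0, 1)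
      + (fderiv ℝ U x (1, 0) * fderiv ℝ V x (0, 1)
        + fderiv ℝ U x (0, 1) * fderiv ℝ V x (1, 0)) / 2)
    - (fderiv ℝ U x (0, 1) + fderiv ℝ V x (0, 1)) / 2

/-- `A` is obtained from `U`, `V` by quadrature, in the variables `(ρ², z)`. -/
def IsSquareQuadrature (U V A : ℝ × ℝ → ℝ) : Prop :=
  ∀ x : ℝ × ℝ, 0 < x.1 → HasFDerivAt A
    (quadratureS U V x • ContinuousLinearMap.fst ℝ ℝ ℝ
      + quadratureZ U V x • ContinuousLinearMap.snd ℝ ℝ ℝ) x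

theorem IsSquareQuadrature.hasDerivAt_fst {U V A : ℝ × ℝ → ℝ} (h : IsSquareQuadrature U V A)
    {x : ℝ × ℝ} (hx : 0 < x.1) : HasDerivAt (fun s => A (s, x.2)) (quadratureS U V x) x.1 := by
  have h1 := StaticWeyl.hasDerivAt_fst (h x hx).differentiableAt
  rw [(h x hx).fderiv] at h1
  simpa using h1

theorem IsSquareQuadrature.hasDerivAt_snd {U V A : ℝ × ℝ → ℝ} (h : IsSquareQuadrature U V A)
    {x : ℝ × ℝ} (hx : 0 < x.1) : HasDerivAt (fun z => A (x.1, z)) (quadratureZ U V x) x.2 := by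
  have h1 := StaticWeyl.hasDerivAt_snd (h x hx).differentiableAt
  rw [(h x hx).fderiv] at h1
  simpa using h1

theorem contDiffAt_quadratureS {U V : ℝ × ℝ → ℝ} {x : ℝ × ℝ} (hU : ContDiffAt ℝ ∞ U x)
    (hV : ContDiffAt ℝ ∞ V x) : ContDiffAt ℝ ∞ (quadratureS U V) x := by
  have h1 := contDiffAt_fderiv_apply hU (1, 0)
  have h2 := contDiffAt_fderiv_apply hU (0, 1)
  have h3 := contDiffAt_fderiv_apply hV (1, 0)
  have h4 := contDiffAt_fderiv_apply hV (0, 1)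
  unfold quadratureS
  fun_prop

theorem contDiffAt_quadratureZ {U V : ℝ × ℝ → ℝ} {x : ℝ × ℝ} (hU : ContDiffAt ℝ ∞ U x)
    (hV : ContDiffAt ℝ ∞ V x) : ContDiffAt ℝ ∞ (quadratureZ U V) x := by
  have h1 := contDiffAt_fderiv_apply hU (1, 0)
  have h2 := contDiffAt_fderiv_apply hU (0, 1)
  have h3 := contDiffAt_fderiv_apply hV (1, 0)
  have h4 := contDiffAt_fderiv_apply hV (0, 1)
  unfold quadratureZ
  fun_prop

theorem fderiv_fderiv_comm {U : ℝ × ℝ → ℝ} {x : ℝ × ℝ} (hU : ContDiffAt ℝ ∞ U x) (v w : ℝ × ℝ) :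
    fderiv ℝ (fun y => fderiv ℝ U y v) x w = fderiv ℝ (fun y => fderiv ℝ U y w) x v := by
  have hd : DifferentiableAt ℝ (fderiv ℝ U) x :=
    (hU.fderiv_right (m := ∞) le_rfl).differentiableAt (by simp)
  have hs : IsSymmSndFDerivAt ℝ U x := hU.isSymmSndFDerivAt (by
    simp only [minSmoothness_of_isRCLikeNormedField]
    exact WithTop.coe_le_coe.2 (le_top (a := (2 : ℕ∞))))
  have h1 : ∀ v, fderiv ℝ (fun y => fderiv ℝ U y v) x w = fderiv ℝ (fderiv ℝ U) x w v := by
    intro v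
    rw [fderiv_clm_apply hd (differentiableAt_const v)]
    simp
  have h2 : ∀ v w, fderiv ℝ (fun y => fderiv ℝ U y v) x w = fderiv ℝ (fderiv ℝ U) x w v := by
    intro v w
    rw [fderiv_clm_apply hd (differentiableAt_const v)]
    simp
  rw [h2, h2, hs.eq]

/-- The quadrature form is closed for harmonic `U` and `V`: the difference of the mixed derivatives
is a combination of the Laplacians of `U` and `V`. -/
theorem quadrature_closed {U V : ℝ × ℝ → ℝ} {x : ℝ × ℝ} (hU : IsAxiHarmonicAt U x)
    (hV : IsAxiHarmonicAt V x) :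
    fderiv ℝ (quadratureS U V) x (0, 1) = fderiv ℝ (quadratureZ U V) x (1, 0) := by
  have hdS := (contDiffAt_quadratureS hU.1 hV.1).differentiableAt (by simp)
  have hdZ := (contDiffAt_quadratureZ hU.1 hV.1).differentiableAt (by simp)
  have hdd : ∀ {W : ℝ × ℝ → ℝ} (_ : ContDiffAt ℝ ∞ W x) (v : ℝ × ℝ),
      DifferentiableAt ℝ (fun y => fderiv ℝ W y v) x := fun hW v =>
    (contDiffAt_fderiv_apply hW v).differentiableAt (by simp)
  have us := hasDerivAt_fst (hdd hU.1 (1, 0))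
  have uz := hasDerivAt_fst (hdd hU.1 (0, 1))
  have vs := hasDerivAt_fst (hdd hV.1 (1, 0))
  have vz := hasDerivAt_fst (hdd hV.1 (0, 1))
  have us' := hasDerivAt_snd (hdd hU.1 (1, 0))
  have uz' := hasDerivAt_snd (hdd hU.1 (0, 1))
  have vs' := hasDerivAt_snd (hdd hV.1 (1, 0))
  have vz' := hasDerivAt_snd (hdd hV.1 (0, 1))
  have e1 := fderiv_fderiv_comm hU.1 (1, 0) (0, 1)
  have e2 := fderiv_fderiv_comm hV.1 (1, 0) (0, 1)
  have l1 := hU.2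
  have l2 := hV.2
  rw [axiLaplacian] at l1 l2
  rw [← e1] at uz
  rw [← e2] at vz
  have d1 := (((((us'.pow 2).add (vs'.pow 2)).add (us'.mul vs')).const_mul (x.1 / 2)).sub
    ((((uz'.pow 2).add (vz'.pow 2)).add (uz'.mul vz')).div_const 8)).sub
      ((us'.add vs').div_const 2)
  have d2 := ((hasDerivAt_id x.1).mul (((us.mul uz).add (vs.mul vz)).add
    (((us.mul vz).add (uz.mul vs)).div_const 2))).sub ((uz.add vz).div_const 2)
  rw [fderiv_snd_eq hdS d1, fderiv_fst_eq hdZ d2]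
  simp
  set a := (fderiv ℝ U x) (1, 0)
  set b := (fderiv ℝ U x) (0, 1)
  set c := (fderiv ℝ V x) (1, 0)
  set d := (fderiv ℝ V x) (0, 1)
  linear_combination (-b / 4 - d / 8) * l1 + (-d / 4 - b / 8) * l2

/-- The quadrature is solvable on the half plane: its right hand side is a closed form. -/
theorem exists_isSquareQuadrature {U V : ℝ × ℝ → ℝ}
    (hU : ∀ x : ℝ × ℝ, 0 < x.1 → IsAxiHarmonicAt U x)
    (hV : ∀ x : ℝ × ℝ, 0 < x.1 → IsAxiHarmonicAt V x) : ∃ A, IsSquareQuadrature U V A := by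
  have hconv : Convex ℝ {x : ℝ × ℝ | 0 < x.1} :=
    convex_halfSpace_gt (ContinuousLinearMap.fst ℝ ℝ ℝ).isLinear 0
  have hopen : IsOpen {x : ℝ × ℝ | 0 < x.1} := isOpen_lt (by fun_prop) (by fun_prop)
  have hdS : ∀ x : ℝ × ℝ, 0 < x.1 → DifferentiableAt ℝ (quadratureS U V) x := fun x hx =>
    (contDiffAt_quadratureS (hU x hx).1 (hV x hx).1).differentiableAt (by simp)
  have hdZ : ∀ x : ℝ × ℝ, 0 < x.1 → DifferentiableAt ℝ (quadratureZ U V) x := fun x hx =>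
    (contDiffAt_quadratureZ (hU x hx).1 (hV x hx).1).differentiableAt (by simp)
  have hd : DifferentiableOn ℝ (fun x => quadratureS U V x • ContinuousLinearMap.fst ℝ ℝ ℝ
      + quadratureZ U V x • ContinuousLinearMap.snd ℝ ℝ ℝ) {x : ℝ × ℝ | 0 < x.1} := fun x hx =>
    (((hdS x hx).smul_const _).add ((hdZ x hx).smul_const _)).differentiableWithinAt
  have hsymm : ∀ x ∈ {x : ℝ × ℝ | 0 < x.1}, ∀ v w : ℝ × ℝ,
      fderiv ℝ (fun x => quadratureS U V x • ContinuousLinearMap.fst ℝ ℝ ℝ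
        + quadratureZ U V x • ContinuousLinearMap.snd ℝ ℝ ℝ) x v w =
      fderiv ℝ (fun x => quadratureS U V x • ContinuousLinearMap.fst ℝ ℝ ℝ
        + quadratureZ U V x • ContinuousLinearMap.snd ℝ ℝ ℝ) x w v := by
    intro x hx v w
    have hc := quadrature_closed (hU x hx) (hV x hx)
    have hF : fderiv ℝ (fun x => quadratureS U V x • ContinuousLinearMap.fst ℝ ℝ ℝ
        + quadratureZ U V x • ContinuousLinearMap.snd ℝ ℝ ℝ) x = _ :=
      (((hdS x hx).hasFDerivAt.smul_const (ContinuousLinearMap.fst ℝ ℝ ℝ)).add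
        ((hdZ x hx).hasFDerivAt.smul_const (ContinuousLinearMap.snd ℝ ℝ ℝ))).fderiv
    rw [hF]
    have hv : ∀ (L : ℝ × ℝ →L[ℝ] ℝ) (v : ℝ × ℝ), L v = v.1 * L (1, 0) + v.2 * L (0, 1) := by
      intro L v
      have : v = v.1 • ((1 : ℝ), (0 : ℝ)) + v.2 • ((0 : ℝ), (1 : ℝ)) := by
        ext <;> simp
      conv_lhs => rw [this]
      rw [map_add, map_smul, map_smul, smul_eq_mul, smul_eq_mul]
    simp only [_root_.add_apply, ContinuousLinearMap.smulRight_apply, _root_.smul_apply,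
      ContinuousLinearMap.coe_fst', ContinuousLinearMap.coe_snd', smul_eq_mul]
    rw [hv (fderiv ℝ (quadratureS U V) x) v, hv (fderiv ℝ (quadratureS U V) x) w,
      hv (fderiv ℝ (quadratureZ U V) x) v, hv (fderiv ℝ (quadratureZ U V) x) w, hc]
    ring
  exact hconv.exists_forall_hasFDerivAt_of_fderiv_symmetric hopen hd hsymm

theorem IsSquareQuadrature.contDiffAt {U V A : ℝ × ℝ → ℝ} (h : IsSquareQuadrature U V A)
    (hU : ∀ x : ℝ × ℝ, 0 < x.1 → ContDiffAt ℝ ∞ U x)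
    (hV : ∀ x : ℝ × ℝ, 0 < x.1 → ContDiffAt ℝ ∞ V x) {x : ℝ × ℝ} (hx : 0 < x.1) :
    ContDiffAt ℝ ∞ A x := by
  have hopen : IsOpen {x : ℝ × ℝ | 0 < x.1} := isOpen_lt (by fun_prop) (by fun_prop)
  refine ContDiffOn.contDiffAt ((contDiffOn_infty_iff_fderiv_of_isOpen hopen).2
    ⟨fun y hy => (h y hy).differentiableAt.differentiableWithinAt, fun y hy => ?_⟩)
    (hopen.mem_nhds hx)
  have h1 : ContDiffAt ℝ ∞ (fun x => quadratureS U V x • ContinuousLinearMap.fst ℝ ℝ ℝ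
      + quadratureZ U V x • ContinuousLinearMap.snd ℝ ℝ ℝ) y :=
    ((contDiffAt_quadratureS (hU y hy) (hV y hy)).smul contDiffAt_const).add
      ((contDiffAt_quadratureZ (hU y hy) (hV y hy)).smul contDiffAt_const)
  refine (h1.congr_of_eventuallyEq ?_).contDiffWithinAt
  filter_upwards [hopen.mem_nhds hy] with w hw
  exact (h w hw).fderiv

/-- Functions on the half plane with the same partial derivatives differ by a constant. -/
theorem eq_add_const_of_hasDerivAt {A B : ℝ × ℝ → ℝ} {S Z : ℝ × ℝ → ℝ}
    (h1 : ∀ x : ℝ × ℝ, 0 < x.1 → HasDerivAt (fun s => A (s, x.2)) (S x) x.1)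
    (h2 : ∀ x : ℝ × ℝ, 0 < x.1 → HasDerivAt (fun z => A (x.1, z)) (Z x) x.2)
    (h3 : ∀ x : ℝ × ℝ, 0 < x.1 → HasDerivAt (fun s => B (s, x.2)) (S x) x.1)
    (h4 : ∀ x : ℝ × ℝ, 0 < x.1 → HasDerivAt (fun z => B (x.1, z)) (Z x) x.2) :
    ∃ k, ∀ x : ℝ × ℝ, 0 < x.1 → A x = B x + k := by
  refine ⟨A (1, 0) - B (1, 0), fun x hx => ?_⟩
  have e1 : A (x.1, x.2) - B (x.1, x.2) = A (1, x.2) - B (1, x.2) := by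
    refine isOpen_Ioi.is_const_of_deriv_eq_zero (𝕜 := ℝ) (f := fun s => A (s, x.2) - B (s, x.2))
      (s := Ioi (0 : ℝ)) (convex_Ioi 0).isPreconnected ?_ ?_ hx (by simp)
    · exact fun s hs => ((h1 (s, x.2) hs).sub
        (h3 (s, x.2) hs)).differentiableAt.differentiableWithinAt
    · intro s hs
      have h5 := ((h1 (s, x.2) hs).sub (h3 (s, x.2) hs)).deriv
      rw [sub_self] at h5
      exact h5
  have e2 : A (1, x.2) - B (1, x.2) = A (1, 0) - B (1, 0) := by
    have hd : ∀ z, HasDerivAt (fun z => A (1, z) - B (1, z)) (Z (1, z) - Z (1, z)) z := fun z =>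
      (h2 (1, z) one_pos).sub (h4 (1, z) one_pos)
    exact is_const_of_deriv_eq_zero (fun z => (hd z).differentiableAt)
      (fun z => by rw [(hd z).deriv, sub_self]) _ _
  linarith

theorem hasDerivAt_comp_sq {W : ℝ × ℝ → ℝ} {d ρ z : ℝ}
    (h : HasDerivAt (fun s => W (s, z)) d (ρ ^ 2)) :
    HasDerivAt (fun ρ => W (ρ ^ 2, z)) (2 * ρ * d) ρ := by
  have h1 : HasDerivAt (fun ρ : ℝ => ρ ^ 2) (2 * ρ) ρ := by simpa using hasDerivAt_pow 2 ρ
  exact (HasDerivAt.comp (h₂ := fun s => W (s, z)) (h := fun ρ => ρ ^ 2) ρ h h1).congr_deriv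
    (mul_comm _ _)

section Change

variable {u v α : ℝ → ℝ → ℝ} {U V : ℝ × ℝ → ℝ}

theorem dρ_eq (hu : ∀ ρ z, 0 < ρ → u ρ z = U (ρ ^ 2, z)) {ρ z : ℝ} (hρ : 0 < ρ)
    (hU : DifferentiableAt ℝ U (ρ ^ 2, z)) : dρ u ρ z = 2 * ρ * fderiv ℝ U (ρ ^ 2, z) (1, 0) := by
  have h1 : (fun s => u s z) =ᶠ[𝓝 ρ] fun s => U (s ^ 2, z) := by
    filter_upwards [lt_mem_nhds hρ] with s hs using hu s z hs
  rw [dρ, h1.deriv_eq, (hasDerivAt_comp_sq (hasDerivAt_fst hU)).deriv]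

theorem dz_eq (hu : ∀ ρ z, 0 < ρ → u ρ z = U (ρ ^ 2, z)) {ρ z : ℝ} (hρ : 0 < ρ)
    (hU : DifferentiableAt ℝ U (ρ ^ 2, z)) : dz u ρ z = fderiv ℝ U (ρ ^ 2, z) (0, 1) := by
  have h1 : (fun s => u ρ s) = fun s => U (ρ ^ 2, s) := by
    funext s
    exact hu ρ s hρ
  rw [dz, h1, (hasDerivAt_snd hU).deriv]

/-- The quadrature in the variables `(ρ, z)` and in the variables `(ρ², z)`. -/
theorem isQuadrature_iff (hu : ∀ ρ z, 0 < ρ → u ρ z = U (ρ ^ 2, z))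
    (hv : ∀ ρ z, 0 < ρ → v ρ z = V (ρ ^ 2, z))
    (hU : ∀ x : ℝ × ℝ, 0 < x.1 → ContDiffAt ℝ ∞ U x)
    (hV : ∀ x : ℝ × ℝ, 0 < x.1 → ContDiffAt ℝ ∞ V x) :
    IsQuadrature u v α ↔ ∀ ρ z : ℝ, 0 < ρ →
      HasDerivAt (fun s => α s z) (2 * ρ * quadratureS U V (ρ ^ 2, z)) ρ ∧
      HasDerivAt (fun s => α ρ s) (quadratureZ U V (ρ ^ 2, z)) z := by
  refine forall_congr' fun ρ => forall_congr' fun z => imp_congr_right fun hρ => ?_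
  have hU' := (hU (ρ ^ 2, z) (by positivity)).differentiableAt (by simp)
  have hV' := (hV (ρ ^ 2, z) (by positivity)).differentiableAt (by simp)
  rw [dρ_eq hu hρ hU', dρ_eq hv hρ hV', dz_eq hu hρ hU', dz_eq hv hρ hV']
  refine and_congr (iff_of_eq ?_) (iff_of_eq ?_)
  · congr 1
    rw [quadratureS]
    field_simp
    ring
  · congr 1
    rw [quadratureZ]
    field_simp
    ring

theorem exists_eq_quadrature (hu : ∀ ρ z, 0 < ρ → u ρ z = U (ρ ^ 2, z))
    (hv : ∀ ρ z, 0 < ρ → v ρ z = V (ρ ^ 2, z))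
    (hU : ∀ x : ℝ × ℝ, 0 < x.1 → ContDiffAt ℝ ∞ U x)
    (hV : ∀ x : ℝ × ℝ, 0 < x.1 → ContDiffAt ℝ ∞ V x) {A : ℝ × ℝ → ℝ}
    (hA : IsSquareQuadrature U V A) (hα : IsQuadrature u v α) :
    ∃ k, ∀ ρ z, 0 < ρ → α ρ z = A (ρ ^ 2, z) + k := by
  rw [isQuadrature_iff hu hv hU hV] at hα
  obtain ⟨k, hk⟩ := eq_add_const_of_hasDerivAt (A := fun x => α x.1 x.2)
    (B := fun x => A (x.1 ^ 2, x.2)) (fun x hx => (hα x.1 x.2 hx).1) (fun x hx => (hα x.1 x.2 hx).2)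
    (fun x hx => hasDerivAt_comp_sq
      (hA.hasDerivAt_fst (x := (x.1 ^ 2, x.2)) (pow_pos hx 2)))
    (fun x hx => hA.hasDerivAt_snd (x := (x.1 ^ 2, x.2)) (pow_pos hx 2))
  exact ⟨k, fun ρ z hρ => hk (ρ, z) hρ⟩

end Change

/-! ### The function `α` near a rod -/

/-- The combination of the potentials which determines `α` on a rod: `u / 2` for an axis rod of
kind `φ`, where `(e₁, e₂) = (1, 0)`, `v / 2` for kind `ψ`, where `(e₁, e₂) = (0, 1)`, and
`-(u + v) / 2` for a horizon rod, where `(e₁, e₂) = (0, 0)`. -/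
noncomputable def rodLinear (e₁ e₂ y₁ y₂ : ℝ) : ℝ :=
  (e₁ + e₂ / 2 - 1 / 2) * y₁ + (e₂ + e₁ / 2 - 1 / 2) * y₂

/-- On an axis rod the boundary value of this function is the logarithmic angle defect, on a horizon
rod it is minus the logarithm of the surface gravity. -/
noncomputable def rodDefect (e₁ e₂ : ℝ) (U V A : ℝ × ℝ → ℝ) (x : ℝ × ℝ) : ℝ :=
  A x - rodLinear e₁ e₂ (U x) (V x) + (e₁ + e₂) / 2 * Real.log x.1

section Rod

variable {a b e₁ e₂ : ℝ} {U V A f g : ℝ × ℝ → ℝ}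

theorem eventually_pos_fst {x : ℝ × ℝ} (hx : 0 < x.1) : ∀ᶠ y : ℝ × ℝ in 𝓝 x, 0 < y.1 :=
  (isOpen_lt (by fun_prop) (by fun_prop) : IsOpen {y : ℝ × ℝ | 0 < y.1}).mem_nhds hx

theorem fderiv_log_add {e : ℝ} {x : ℝ × ℝ} (hx : 0 < x.1) (hf : DifferentiableAt ℝ f x)
    (hU : ∀ᶠ y in 𝓝 x, U y = e * Real.log y.1 + f y) :
    fderiv ℝ U x (1, 0) = e / x.1 + fderiv ℝ f x (1, 0) ∧
      fderiv ℝ U x (0, 1) = fderiv ℝ f x (0, 1) := by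
  rw [EventuallyEq.fderiv_eq hU]
  have h1 : HasDerivAt (fun s : ℝ => e * Real.log s) (e / x.1) x.1 := by
    simpa [div_eq_mul_inv] using (Real.hasDerivAt_log hx.ne').const_mul e
  have hd : DifferentiableAt ℝ (fun y : ℝ × ℝ => e * Real.log y.1 + f y) x :=
    (((differentiableAt_fst).log hx.ne').const_mul e).add hf
  exact ⟨fderiv_fst_eq hd (h1.add (hasDerivAt_fst hf)),
    fderiv_snd_eq hd ((hasDerivAt_snd hf).const_add (e * Real.log x.1))⟩

/-- Near a rod `α` extends smoothly across the axis, and its boundary value is, up to a constant,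
the combination `rodLinear` of the potentials. The hypothesis on the weights `e₁`, `e₂` makes the
terms of order `1 / ρ²` in the quadrature cancel. -/
theorem exists_rod_extension (hab : a < b) (he : e₁ ^ 2 + e₂ ^ 2 + e₁ * e₂ = e₁ + e₂)
    (hf : ∀ x ∈ rodDomain a b, ContDiffAt ℝ ∞ f x) (hg : ∀ x ∈ rodDomain a b, ContDiffAt ℝ ∞ g x)
    (hU : ∀ x ∈ rodDomain a b, 0 < x.1 → U x = e₁ * Real.log x.1 + f x)
    (hV : ∀ x ∈ rodDomain a b, 0 < x.1 → V x = e₂ * Real.log x.1 + g x)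
    (hA : IsSquareQuadrature U V A) :
    ∃ A' : ℝ × ℝ → ℝ, (∀ x ∈ rodDomain a b, ContDiffAt ℝ ∞ A' x) ∧
      (∀ x ∈ rodDomain a b, 0 < x.1 → A' x = A x) ∧
      ∃ κ, ∀ z ∈ Ioo a b, A' (0, z) - rodLinear e₁ e₂ (f (0, z)) (g (0, z)) = κ := by
  have hO := isOpen_rodDomain a b
  -- The extension of `∂_s α` across the axis, in terms of the regular parts of the potentials.
  set w : ℝ × ℝ → ℝ := fun x => quadratureS f g x + (e₁ + e₂ / 2) * fderiv ℝ f x (1, 0)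
    + (e₂ + e₁ / 2) * fderiv ℝ g x (1, 0) with hw
  have hwsm : ∀ x ∈ rodDomain a b, ContDiffAt ℝ ∞ w x := fun x hx =>
    ((contDiffAt_quadratureS (hf x hx) (hg x hx)).add
      (contDiffAt_const.mul (contDiffAt_fderiv_apply (hf x hx) _))).add
      (contDiffAt_const.mul (contDiffAt_fderiv_apply (hg x hx) _))
  have hder : ∀ x ∈ rodDomain a b, 0 < x.1 →
      quadratureS U V x = w x ∧ quadratureZ U V x = quadratureZ f g x +
        (e₁ + e₂ / 2) * fderiv ℝ f x (0, 1) + (e₂ + e₁ / 2) * fderiv ℝ g x (0, 1) := by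
    intro x hx hx0
    have hev : ∀ᶠ y in 𝓝 x, y ∈ rodDomain a b ∧ 0 < y.1 :=
      Filter.Eventually.and (hO.mem_nhds hx) (eventually_pos_fst hx0)
    obtain ⟨u1, u2⟩ := fderiv_log_add (U := U) hx0 ((hf x hx).differentiableAt (by simp))
      (hev.mono fun y hy => hU y hy.1 hy.2)
    obtain ⟨v1, v2⟩ := fderiv_log_add (U := V) hx0 ((hg x hx).differentiableAt (by simp))
      (hev.mono fun y hy => hV y hy.1 hy.2)
    simp only [hw, quadratureS, quadratureZ, u1, u2, v1, v2]
    constructor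
    · have h1 : ∀ X Y : ℝ, x.1 / 2 * ((e₁ / x.1 + X) ^ 2 + (e₂ / x.1 + Y) ^ 2 +
          (e₁ / x.1 + X) * (e₂ / x.1 + Y)) - (e₁ / x.1 + X + (e₂ / x.1 + Y)) / 2 =
          x.1 / 2 * (X ^ 2 + Y ^ 2 + X * Y) - (X + Y) / 2 + (e₁ + e₂ / 2) * X
            + (e₂ + e₁ / 2) * Y := by
        intro X Y
        have h2 : (e₁ ^ 2 + e₂ ^ 2 + e₁ * e₂) / (2 * x.1) = (e₁ + e₂) / (2 * x.1) := by rw [he]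
        have h3 : x.1 / 2 * ((e₁ / x.1 + X) ^ 2 + (e₂ / x.1 + Y) ^ 2 +
          (e₁ / x.1 + X) * (e₂ / x.1 + Y)) = (e₁ ^ 2 + e₂ ^ 2 + e₁ * e₂) / (2 * x.1) +
          (e₁ + e₂ / 2) * X + (e₂ + e₁ / 2) * Y + x.1 / 2 * (X ^ 2 + Y ^ 2 + X * Y) := by
          field_simp
          ring
        rw [h3, h2]
        field_simp
        ring
      have h4 := h1 (fderiv ℝ f x (1, 0)) (fderiv ℝ g x (1, 0))
      linear_combination h4
    · field_simp
      ring
  have hseg : ∀ x ∈ rodDomain a b, ∀ t ∈ Icc (0 : ℝ) 1,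
      (1 + t * (x.1 - 1), x.2) ∈ rodDomain a b := fun x hx t ht =>
    mem_rodDomain_segment zero_le_one hx ht
  obtain ⟨B, hB, hB'⟩ := exists_primitive_fst hO 1 hseg hwsm
  have hAz : ∀ x ∈ rodDomain a b, ContDiffAt ℝ ∞ (fun x : ℝ × ℝ => A (1, x.2)) x := by
    intro x hx
    have hUs : ContDiffAt ℝ ∞ (fun z => A (1, z)) x.2 := by
      have hmem : ∀ z ∈ Ioo a b, ((1 : ℝ), z) ∈ rodDomain a b := fun z hz =>
        mem_rodDomain_of_nonneg zero_le_one hz.1 hz.2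
      refine ContDiffOn.contDiffAt (s := Ioo a b) ?_ (isOpen_Ioo.mem_nhds hx.1)
      refine (contDiffOn_infty_iff_deriv_of_isOpen isOpen_Ioo).2
        ⟨fun z _ => (hA.hasDerivAt_snd (x := (1, z))
          one_pos).differentiableAt.differentiableWithinAt, fun z hz => ?_⟩
      have h1 : ContDiffAt ℝ ∞ (fun x => quadratureZ f g x +
        (e₁ + e₂ / 2) * fderiv ℝ f x (0, 1) + (e₂ + e₁ / 2) * fderiv ℝ g x (0, 1)) (1, z) :=
        ((contDiffAt_quadratureZ (hf _ (hmem z hz)) (hg _ (hmem z hz))).add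
          (contDiffAt_const.mul (contDiffAt_fderiv_apply (hf _ (hmem z hz)) _))).add
          (contDiffAt_const.mul (contDiffAt_fderiv_apply (hg _ (hmem z hz)) _))
      have h2 := ContDiffAt.comp (f := fun z : ℝ => ((1 : ℝ), z)) z h1 (by fun_prop)
      refine (h2.congr_of_eventuallyEq ?_).contDiffWithinAt
      filter_upwards [isOpen_Ioo.mem_nhds hz] with y hy
      rw [(hA.hasDerivAt_snd (x := (1, y)) one_pos).deriv, (hder _ (hmem y hy) one_pos).2]
      rfl
    exact hUs.comp x contDiffAt_snd
  have hA'sm : ∀ x ∈ rodDomain a b, ContDiffAt ℝ ∞ (fun x : ℝ × ℝ => A (1, x.2) + B x) x :=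
    fun x hx => (hAz x hx).add (hB x hx)
  have hA'eq : ∀ x ∈ rodDomain a b, 0 < x.1 → A (1, x.2) + B x = A x := by
    intro x hx hx0
    have hpos : ∀ s ∈ uIcc 1 x.1, 0 < s := fun s hs =>
      (lt_min one_pos hx0).trans_le hs.1
    rw [hB' x hx (fun s => A (s, x.2)) fun s hs => ?_]
    · ring
    · have h1 := hA.hasDerivAt_fst (x := (s, x.2)) (hpos s hs)
      rwa [(hder (s, x.2) (mem_rodDomain_of_nonneg (hpos s hs).le hx.1.1 hx.1.2) (hpos s hs)).1]
        at h1
  refine ⟨fun x => A (1, x.2) + B x, hA'sm, hA'eq, ?_⟩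
  -- The derivative `∂_z Z` contains the factor `s`, so that `Z` is constant on the rod.
  set Z : ℝ × ℝ → ℝ := fun x => A (1, x.2) + B x - rodLinear e₁ e₂ (f x) (g x) with hZ
  have hZsm : ∀ x ∈ rodDomain a b, ContDiffAt ℝ ∞ Z x := fun x hx => by
    have h1 := hA'sm x hx
    have h2 := hf x hx
    have h3 := hg x hx
    simp only [hZ, rodLinear]
    exact h1.sub ((contDiffAt_const.mul h2).add (contDiffAt_const.mul h3))
  have hZd : ∀ x ∈ rodDomain a b, 0 < x.1 → fderiv ℝ Z x (0, 1) =
      quadratureZ f g x + (fderiv ℝ f x (0, 1) + fderiv ℝ g x (0, 1)) / 2 := by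
    intro x hx hx0
    have h1 : HasDerivAt (fun z => A (x.1, z) - rodLinear e₁ e₂ (f (x.1, z)) (g (x.1, z)))
        (quadratureZ f g x + (fderiv ℝ f x (0, 1) + fderiv ℝ g x (0, 1)) / 2) x.2 := by
      have h2 := hasDerivAt_snd ((hf x hx).differentiableAt (by simp))
      have h3 := hasDerivAt_snd ((hg x hx).differentiableAt (by simp))
      have h4 := hA.hasDerivAt_snd hx0
      rw [(hder x hx hx0).2] at h4
      refine (h4.sub ((h2.const_mul (e₁ + e₂ / 2 - 1 / 2)).add
        (h3.const_mul (e₂ + e₁ / 2 - 1 / 2)))).congr_deriv ?_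
      ring
    refine fderiv_snd_eq ((hZsm x hx).differentiableAt (by simp)) (h1.congr_of_eventuallyEq ?_)
    have h5 : ∀ᶠ z in 𝓝 x.2, (x.1, z) ∈ rodDomain a b :=
      (Continuous.continuousAt (by fun_prop : Continuous fun z : ℝ => (x.1, z))).eventually
        (hO.mem_nhds hx)
    filter_upwards [h5] with z hz
    simp only [hZ]
    rw [hA'eq _ hz hx0]
  have hZ0 : ∀ z ∈ Ioo a b, fderiv ℝ Z (0, z) (0, 1) = 0 := by
    intro z hz
    have hmem := mem_rodDomain_of_nonneg le_rfl hz.1 hz.2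
    have hpath : Tendsto (fun s : ℝ => (s, z)) (𝓝[>] 0) (𝓝 (0, z)) :=
      (Continuous.continuousAt (by fun_prop : Continuous fun s : ℝ => (s, z))).tendsto.mono_left
        nhdsWithin_le_nhds
    have h1 := ((contDiffAt_fderiv_apply (hZsm _ hmem) (0, 1)).continuousAt.tendsto).comp hpath
    have h2 : ContinuousAt (fun x => quadratureZ f g x +
        (fderiv ℝ f x (0, 1) + fderiv ℝ g x (0, 1)) / 2) (0, z) :=
      (contDiffAt_quadratureZ (hf _ hmem) (hg _ hmem)).continuousAt.add
        (((contDiffAt_fderiv_apply (hf _ hmem) (0, 1)).continuousAt.add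
          (contDiffAt_fderiv_apply (hg _ hmem) (0, 1)).continuousAt).div_const 2)
    have h3 := h2.tendsto.comp hpath
    have h4 : (quadratureZ f g (0, z) +
        (fderiv ℝ f (0, z) (0, 1) + fderiv ℝ g (0, z) (0, 1)) / 2) = 0 := by
      rw [quadratureZ]
      ring
    rw [h4] at h3
    refine tendsto_nhds_unique h1 (h3.congr' ?_)
    filter_upwards [self_mem_nhdsWithin] with s hs
    exact (hZd (s, z) (mem_rodDomain_of_nonneg (le_of_lt hs) hz.1 hz.2) hs).symm
  have hZder : ∀ z ∈ Ioo a b, HasDerivAt (fun z => Z (0, z)) 0 z := fun z hz => by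
    have h1 := hasDerivAt_snd ((hZsm _ (mem_rodDomain_of_nonneg le_rfl hz.1
      hz.2)).differentiableAt (by simp) : DifferentiableAt ℝ Z (0, z))
    rwa [hZ0 z hz] at h1
  refine ⟨Z (0, (a + b) / 2), fun z hz => ?_⟩
  exact isOpen_Ioo.is_const_of_deriv_eq_zero isPreconnected_Ioo
    (fun z hz => (hZder z hz).differentiableAt.differentiableWithinAt)
    (fun z hz => (hZder z hz).deriv) hz ⟨by linarith, by linarith⟩

/-- The defect is independent of the decomposition into singular and regular parts, so that the
constant of `exists_rod_extension` is determined by the solution. -/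
theorem tendsto_rodDefect (he : e₁ ^ 2 + e₂ ^ 2 + e₁ * e₂ = e₁ + e₂)
    (hf : ∀ x ∈ rodDomain a b, ContDiffAt ℝ ∞ f x) (hg : ∀ x ∈ rodDomain a b, ContDiffAt ℝ ∞ g x)
    (hU : ∀ x ∈ rodDomain a b, 0 < x.1 → U x = e₁ * Real.log x.1 + f x)
    (hV : ∀ x ∈ rodDomain a b, 0 < x.1 → V x = e₂ * Real.log x.1 + g x)
    {A' : ℝ × ℝ → ℝ} (hA' : ∀ x ∈ rodDomain a b, ContDiffAt ℝ ∞ A' x)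
    (hAA' : ∀ x ∈ rodDomain a b, 0 < x.1 → A' x = A x) {z : ℝ} (hz : z ∈ Ioo a b) :
    Tendsto (rodDefect e₁ e₂ U V A) (𝓝[{x | 0 < x.1}] (0, z))
      (𝓝 (A' (0, z) - rodLinear e₁ e₂ (f (0, z)) (g (0, z)))) := by
  have hmem := mem_rodDomain_of_nonneg le_rfl hz.1 hz.2
  have h1 : ContinuousAt (fun x => A' x - rodLinear e₁ e₂ (f x) (g x)) (0, z) :=
    (hA' _ hmem).continuousAt.sub ((continuousAt_const.mul (hf _ hmem).continuousAt).add
      (continuousAt_const.mul (hg _ hmem).continuousAt))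
  refine (h1.tendsto.mono_left nhdsWithin_le_nhds).congr' ?_
  filter_upwards [self_mem_nhdsWithin,
    nhdsWithin_le_nhds ((isOpen_rodDomain a b).mem_nhds hmem)] with x hx0 hx
  rw [rodDefect, hAA' x hx hx0, hU x hx hx0, hV x hx hx0, rodLinear, rodLinear]
  linear_combination (Real.log x.1) * he

end Rod

/-! ### The function `α` near a common end point of two rods -/

/-- The parabolic chart `ρ² = p q`, `z = z₀ + σ (p - q) / 2` about the point `z₀` of the axis. -/
noncomputable def parabolic (z₀ σ : ℝ) (x : ℝ × ℝ) : ℝ × ℝ := (x.1 * x.2, z₀ + σ * (x.1 - x.2) / 2)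

/-- The function `log (r + σ (z - z₀))`, which is `log p` in the parabolic chart. -/
noncomputable def poleLog (z₀ σ : ℝ) (x : ℝ × ℝ) : ℝ :=
  Real.log (√(x.1 + (x.2 - z₀) ^ 2) + σ * (x.2 - z₀))

theorem contDiff_parabolic (z₀ σ : ℝ) : ContDiff ℝ ∞ (parabolic z₀ σ) := by
  unfold parabolic
  fun_prop

theorem parabolic_swap (z₀ σ p q : ℝ) : parabolic z₀ σ (q, p) = parabolic z₀ (-σ) (p, q) := by
  simp only [parabolic, Prod.mk.injEq]
  constructor <;> ring

section Endpoint

variable {z₀ σ ε : ℝ}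

theorem sqrt_parabolic (hσ : σ ^ 2 = 1) {p q : ℝ} (hp : 0 < p) (hq : 0 < q) :
    √((parabolic z₀ σ (p, q)).1 + ((parabolic z₀ σ (p, q)).2 - z₀) ^ 2) = (p + q) / 2 := by
  have h1 : (parabolic z₀ σ (p, q)).1 + ((parabolic z₀ σ (p, q)).2 - z₀) ^ 2
      = ((p + q) / 2) ^ 2 := by
    simp only [parabolic]
    linear_combination ((p - q) ^ 2 / 4) * hσ
  rw [h1, Real.sqrt_sq (by positivity)]

theorem poleLog_parabolic (hσ : σ ^ 2 = 1) {p q : ℝ} (hp : 0 < p) (hq : 0 < q) :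
    poleLog z₀ σ (parabolic z₀ σ (p, q)) = Real.log p := by
  rw [poleLog, sqrt_parabolic hσ hp hq]
  congr 1
  simp only [parabolic]
  linear_combination ((p - q) / 2) * hσ

theorem poleLog_neg_parabolic (hσ : σ ^ 2 = 1) {p q : ℝ} (hp : 0 < p) (hq : 0 < q) :
    poleLog z₀ (-σ) (parabolic z₀ σ (p, q)) = Real.log q := by
  rw [poleLog, sqrt_parabolic hσ hp hq]
  congr 1
  simp only [parabolic]
  linear_combination (-(p - q) / 2) * hσ

theorem contDiffAt_poleLog (hσ : σ ^ 2 = 1) {x : ℝ × ℝ} (hx : 0 < x.1) :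
    ContDiffAt ℝ ∞ (poleLog z₀ σ) x ∧
      fderiv ℝ (poleLog z₀ σ) x (1, 0) = 1 / (2 * √(x.1 + (x.2 - z₀) ^ 2) *
        (√(x.1 + (x.2 - z₀) ^ 2) + σ * (x.2 - z₀))) ∧
      fderiv ℝ (poleLog z₀ σ) x (0, 1) = σ / √(x.1 + (x.2 - z₀) ^ 2) := by
  have hr : 0 < x.1 + (x.2 - z₀) ^ 2 := by positivity
  have hr' := Real.sqrt_pos.2 hr
  have hpos : √(x.1 + (x.2 - z₀) ^ 2) + σ * (x.2 - z₀) ≠ 0 := by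
    have h1 := abs_lt.1 (abs_lt_sqrt_add_sq hx (x.2 - z₀))
    rcases sq_eq_one_iff.1 hσ with h | h <;> rw [h] <;> linarith [h1.1, h1.2]
  have hsm : ContDiffAt ℝ ∞ (poleLog z₀ σ) x :=
    ContDiffAt.log (ContDiffAt.add (ContDiffAt.sqrt (by fun_prop) hr.ne') (by fun_prop)) hpos
  refine ⟨hsm, fderiv_fst_eq (hsm.differentiableAt (by simp)) ?_,
    fderiv_snd_eq (hsm.differentiableAt (by simp)) ?_⟩
  · have h1 : HasDerivAt (fun s => s + (x.2 - z₀) ^ 2) 1 x.1 := (hasDerivAt_id x.1).add_const _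
    refine (((h1.sqrt hr.ne').add_const (σ * (x.2 - z₀))).log hpos).congr_deriv ?_
    field_simp
  · have h0 : HasDerivAt (fun z => z - z₀) 1 x.2 := (hasDerivAt_id x.2).sub_const _
    have h1 : HasDerivAt (fun z => x.1 + (z - z₀) ^ 2) (2 * (x.2 - z₀)) x.2 := by
      simpa using (h0.pow 2).const_add x.1
    refine (((h1.sqrt hr.ne').add (h0.const_mul σ)).log hpos).congr_deriv ?_
    simp only [Pi.add_apply]
    rw [div_eq_div_iff hpos hr'.ne']
    linear_combination (norm := (field_simp; ring)) (-(x.2 - z₀)) * hσ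

theorem parabolic_mem (hσ : σ ^ 2 = 1) {x : ℝ × ℝ} (hx : x ∈ Ioo (-ε) ε ×ˢ Ioo (-ε) ε) :
    |(parabolic z₀ σ x).1| < ε ^ 2 ∧ |(parabolic z₀ σ x).2 - z₀| < ε := by
  rw [mem_box] at hx
  have h1 : |x.1| < ε := abs_lt.2 hx.1
  have h2 : |x.2| < ε := abs_lt.2 hx.2
  have h3 : |σ| = 1 := by
    rw [← sq_eq_sq₀ (abs_nonneg _) zero_le_one, sq_abs, hσ, one_pow]
  simp only [parabolic]
  constructor
  · rw [abs_mul, sq]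
    exact mul_lt_mul'' h1 h2 (abs_nonneg _) (abs_nonneg _)
  · rw [add_sub_cancel_left, abs_div, abs_mul, h3, one_mul, abs_two]
    linarith [abs_sub x.1 x.2]

theorem hasDerivAt_parabolic_fst {F : ℝ × ℝ → ℝ} {x : ℝ × ℝ}
    (h : DifferentiableAt ℝ F (parabolic z₀ σ x)) :
    HasDerivAt (fun p => F (parabolic z₀ σ (p, x.2)))
      (x.2 * fderiv ℝ F (parabolic z₀ σ x) (1, 0)
        + σ / 2 * fderiv ℝ F (parabolic z₀ σ x) (0, 1)) x.1 := by
  have h1 : HasDerivAt (fun p => parabolic z₀ σ (p, x.2)) (x.2, σ / 2) x.1 := by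
    refine HasDerivAt.prodMk ?_ ?_
    · simpa using (hasDerivAt_id x.1).mul_const x.2
    · have := ((((hasDerivAt_id x.1).sub_const x.2).const_mul σ).div_const 2).const_add z₀
      simpa using this
  refine (HasFDerivAt.comp_hasDerivAt (f := fun p => parabolic z₀ σ (p, x.2)) x.1
    h.hasFDerivAt h1).congr_deriv ?_
  have : (x.2, σ / 2) = x.2 • ((1 : ℝ), (0 : ℝ)) + (σ / 2) • ((0 : ℝ), (1 : ℝ)) := by
    ext <;> simp
  rw [this, map_add, map_smul, map_smul, smul_eq_mul, smul_eq_mul]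

theorem hasDerivAt_parabolic_snd {F : ℝ × ℝ → ℝ} {x : ℝ × ℝ}
    (h : DifferentiableAt ℝ F (parabolic z₀ σ x)) :
    HasDerivAt (fun q => F (parabolic z₀ σ (x.1, q)))
      (x.1 * fderiv ℝ F (parabolic z₀ σ x) (1, 0)
        - σ / 2 * fderiv ℝ F (parabolic z₀ σ x) (0, 1)) x.2 := by
  have h1 := hasDerivAt_parabolic_fst (z₀ := z₀) (σ := -σ) (F := F) (x := (x.2, x.1))
    (by rwa [← parabolic_swap])
  simp only [← parabolic_swap] at h1
  exact h1.congr_deriv (by ring)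

variable {P₁ P₂ Q₁ Q₂ : ℝ} {U V A f g : ℝ × ℝ → ℝ}

/-- Across a common end point of two rods, `2 α + log (p + q)` extends smoothly as a function of
the parabolic coordinates. The rods at `p = 0` and `q = 0` have the weights `(P₁, P₂)` and
`(Q₁, Q₂)`. By the hypotheses on the weights the terms of order `1 / p` and `1 / q` in the partial
derivatives cancel, and those of order `1 / (p + q)` are the derivatives of `-log (p + q)`. -/
theorem exists_endpoint_extension (hε : 0 < ε) (hσ : σ ^ 2 = 1)
    (hP : P₁ ^ 2 + P₂ ^ 2 + P₁ * P₂ = P₁ + P₂) (hQ : Q₁ ^ 2 + Q₂ ^ 2 + Q₁ * Q₂ = Q₁ + Q₂)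
    (hPQ : (P₁ - Q₁) ^ 2 + (P₂ - Q₂) ^ 2 + (P₁ - Q₁) * (P₂ - Q₂) = 1)
    (hf : ∀ x : ℝ × ℝ, |x.1| < ε ^ 2 → |x.2 - z₀| < ε → ContDiffAt ℝ ∞ f x)
    (hg : ∀ x : ℝ × ℝ, |x.1| < ε ^ 2 → |x.2 - z₀| < ε → ContDiffAt ℝ ∞ g x)
    (hU : ∀ x : ℝ × ℝ, |x.1| < ε ^ 2 → |x.2 - z₀| < ε → 0 < x.1 →
      U x = P₁ * poleLog z₀ σ x + Q₁ * poleLog z₀ (-σ) x + f x)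
    (hV : ∀ x : ℝ × ℝ, |x.1| < ε ^ 2 → |x.2 - z₀| < ε → 0 < x.1 →
      V x = P₂ * poleLog z₀ σ x + Q₂ * poleLog z₀ (-σ) x + g x)
    (hA : IsSquareQuadrature U V A) :
    ∃ S : ℝ × ℝ → ℝ, (∀ x ∈ Ioo (-ε) ε ×ˢ Ioo (-ε) ε, ContDiffAt ℝ ∞ S x) ∧
      ∀ x ∈ Ioo 0 ε ×ˢ Ioo 0 ε, S x = 2 * A (parabolic z₀ σ x) + Real.log (x.1 + x.2) := by
  have hσ' : (-σ) ^ 2 = 1 := by rw [neg_sq, hσ]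
  have hbox : ∀ x ∈ Ioo 0 ε ×ˢ Ioo 0 ε, x ∈ Ioo (-ε) ε ×ˢ Ioo (-ε) ε := fun x hx =>
    ⟨⟨by linarith [hx.1.1], hx.1.2⟩, ⟨by linarith [hx.2.1], hx.2.2⟩⟩
  have hpos : ∀ x ∈ Ioo (0 : ℝ) ε ×ˢ Ioo (0 : ℝ) ε, 0 < (parabolic z₀ σ x).1 := fun x hx =>
    mul_pos hx.1.1 hx.2.1
  have hdlog : ∀ {W h : ℝ × ℝ → ℝ} {a b : ℝ}, (∀ x : ℝ × ℝ, |x.1| < ε ^ 2 → |x.2 - z₀| < ε →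
      0 < x.1 → W x = a * poleLog z₀ σ x + b * poleLog z₀ (-σ) x + h x) →
      (∀ x : ℝ × ℝ, |x.1| < ε ^ 2 → |x.2 - z₀| < ε → ContDiffAt ℝ ∞ h x) →
      ∀ x ∈ Ioo (0 : ℝ) ε ×ˢ Ioo (0 : ℝ) ε,
      fderiv ℝ W (parabolic z₀ σ x) (1, 0) = fderiv ℝ h (parabolic z₀ σ x) (1, 0)
        + (a / x.1 + b / x.2) / (x.1 + x.2) ∧
      fderiv ℝ W (parabolic z₀ σ x) (0, 1) = fderiv ℝ h (parabolic z₀ σ x) (0, 1)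
        + 2 * σ * (a - b) / (x.1 + x.2) := by
    intro W h a b hW hh x hx
    have hm := parabolic_mem (z₀ := z₀) hσ (hbox x hx)
    obtain ⟨c1, c2, c3⟩ := contDiffAt_poleLog (z₀ := z₀) hσ (hpos x hx)
    obtain ⟨d1, d2, d3⟩ := contDiffAt_poleLog (z₀ := z₀) hσ' (hpos x hx)
    have hp := hx.1.1
    have hq := hx.2.1
    have e1 : √((parabolic z₀ σ x).1 + ((parabolic z₀ σ x).2 - z₀) ^ 2) = (x.1 + x.2) / 2 :=
      sqrt_parabolic hσ hp hq
    have e2 : (x.1 + x.2) / 2 + σ * ((parabolic z₀ σ x).2 - z₀) = x.1 := by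
      simp only [parabolic]
      linear_combination ((x.1 - x.2) / 2) * hσ
    have e3 : (x.1 + x.2) / 2 + -σ * ((parabolic z₀ σ x).2 - z₀) = x.2 := by
      simp only [parabolic]
      linear_combination (-(x.1 - x.2) / 2) * hσ
    rw [e1, e2] at c2
    rw [e1, e3] at d2
    rw [e1] at c3 d3
    have hd := (hh _ hm.1 hm.2).differentiableAt (by simp : (∞ : WithTop ℕ∞) ≠ 0)
    have hev : W =ᶠ[𝓝 (parabolic z₀ σ x)]
        fun y => a * poleLog z₀ σ y + b * poleLog z₀ (-σ) y + h y := by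
      have h1 : IsOpen {y : ℝ × ℝ | |y.1| < ε ^ 2 ∧ |y.2 - z₀| < ε} :=
        IsOpen.and (isOpen_lt (by fun_prop) continuous_const)
          (isOpen_lt (by fun_prop) continuous_const)
      filter_upwards [h1.mem_nhds (show parabolic z₀ σ x ∈ _ from hm),
        eventually_pos_fst (hpos x hx)] with y hy hy0
      exact hW y hy.1 hy.2 hy0
    have hF : ∀ v, fderiv ℝ W (parabolic z₀ σ x) v =
        a * fderiv ℝ (poleLog z₀ σ) (parabolic z₀ σ x) v +
        b * fderiv ℝ (poleLog z₀ (-σ)) (parabolic z₀ σ x) v +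
        fderiv ℝ h (parabolic z₀ σ x) v := by
      intro v
      rw [hev.fderiv_eq]
      have hc := c1.differentiableAt (by simp)
      have hc' := d1.differentiableAt (by simp)
      have := (((hc.hasFDerivAt.const_mul a).add (hc'.hasFDerivAt.const_mul b)).add
        hd.hasFDerivAt).fderiv
      rw [show fderiv ℝ (fun y => a * poleLog z₀ σ y + b * poleLog z₀ (-σ) y + h y)
        (parabolic z₀ σ x) = _ from this]
      rfl
    rw [hF, hF, c2, c3, d2, d3]
    constructor
    · field_simp
      ring
    · field_simp
      ring
  -- The functions `S₁` and `S₂` are the partial derivatives of `S` after these cancellations.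
  refine exists_smooth_extension_quadrant (S := fun x => 2 * A (parabolic z₀ σ x) +
      Real.log (x.1 + x.2)) (δ := ε) hε
    (S₁ := fun x => 2 * (x.2 * ((P₁ + P₂ / 2) * fderiv ℝ f (parabolic z₀ σ x) (1, 0)
      + (P₂ + P₁ / 2) * fderiv ℝ g (parabolic z₀ σ x) (1, 0) + quadratureS f g (parabolic z₀ σ x))
      + σ / 2 * ((Q₁ + Q₂ / 2) * fderiv ℝ f (parabolic z₀ σ x) (0, 1)
      + (Q₂ + Q₁ / 2) * fderiv ℝ g (parabolic z₀ σ x) (0, 1) + quadratureZ f g (parabolic z₀ σ x))))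
    (S₂ := fun x => 2 * (x.1 * ((Q₁ + Q₂ / 2) * fderiv ℝ f (parabolic z₀ σ x) (1, 0)
      + (Q₂ + Q₁ / 2) * fderiv ℝ g (parabolic z₀ σ x) (1, 0) + quadratureS f g (parabolic z₀ σ x))
      - σ / 2 * ((P₁ + P₂ / 2) * fderiv ℝ f (parabolic z₀ σ x) (0, 1)
      + (P₂ + P₁ / 2) * fderiv ℝ g (parabolic z₀ σ x) (0, 1) + quadratureZ f g (parabolic z₀ σ x))))
    ?_ ?_ ?_ ?_
  rotate_left 2
  · intro x hx
    obtain ⟨u1, u2⟩ := hdlog hU hf x hx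
    obtain ⟨v1, v2⟩ := hdlog hV hg x hx
    have hp := hx.1.1
    have hq := hx.2.1
    have hAd := hA _ (hpos x hx)
    have h1 := hasDerivAt_parabolic_fst (z₀ := z₀) (σ := σ) hAd.differentiableAt
    rw [hAd.fderiv] at h1
    simp only [_root_.add_apply, _root_.smul_apply, ContinuousLinearMap.coe_fst',
      ContinuousLinearMap.coe_snd', smul_eq_mul, mul_one, mul_zero, add_zero, zero_add] at h1
    have h2 : HasDerivAt (fun p => Real.log (p + x.2)) (1 / (x.1 + x.2)) x.1 :=
      ((hasDerivAt_id x.1).add_const x.2).log (by simp only [id]; positivity)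
    refine ((h1.const_mul 2).add h2).congr_deriv ?_
    simp only [quadratureS, quadratureZ, u1, u2, v1, v2]
    generalize fderiv ℝ f (parabolic z₀ σ x) (1, 0) = fs
    generalize fderiv ℝ f (parabolic z₀ σ x) (0, 1) = fz
    generalize fderiv ℝ g (parabolic z₀ σ x) (1, 0) = gs
    generalize fderiv ℝ g (parabolic z₀ σ x) (0, 1) = gz
    simp only [parabolic]
    rcases sq_eq_one_iff.1 hσ with rfl | rfl <;>
    linear_combination (norm := (field_simp; ring)) (1 / x.1) * hP - (1 / (x.1 + x.2)) * hPQ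
  · intro x hx
    obtain ⟨u1, u2⟩ := hdlog hU hf x hx
    obtain ⟨v1, v2⟩ := hdlog hV hg x hx
    have hp := hx.1.1
    have hq := hx.2.1
    have hAd := hA _ (hpos x hx)
    have h1 := hasDerivAt_parabolic_snd (z₀ := z₀) (σ := σ) hAd.differentiableAt
    rw [hAd.fderiv] at h1
    simp only [_root_.add_apply, _root_.smul_apply, ContinuousLinearMap.coe_fst',
      ContinuousLinearMap.coe_snd', smul_eq_mul, mul_one, mul_zero, add_zero, zero_add] at h1
    have h2 : HasDerivAt (fun q => Real.log (x.1 + q)) (1 / (x.1 + x.2)) x.2 :=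
      ((hasDerivAt_id x.2).const_add x.1).log (by simp only [id]; positivity)
    refine ((h1.const_mul 2).add h2).congr_deriv ?_
    simp only [quadratureS, quadratureZ, u1, u2, v1, v2]
    generalize fderiv ℝ f (parabolic z₀ σ x) (1, 0) = fs
    generalize fderiv ℝ f (parabolic z₀ σ x) (0, 1) = fz
    generalize fderiv ℝ g (parabolic z₀ σ x) (1, 0) = gs
    generalize fderiv ℝ g (parabolic z₀ σ x) (0, 1) = gz
    simp only [parabolic]
    rcases sq_eq_one_iff.1 hσ with rfl | rfl <;>
    linear_combination (norm := (field_simp; ring)) (1 / x.2) * hQ - (1 / (x.1 + x.2)) * hPQ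
  all_goals
    intro x hx
    have hm := parabolic_mem (z₀ := z₀) hσ hx
    have hp := (contDiff_parabolic z₀ σ).contDiffAt (x := x)
    have hf' := hf _ hm.1 hm.2
    have hg' := hg _ hm.1 hm.2
    have c1 := ContDiffAt.comp x (contDiffAt_fderiv_apply hf' (1, 0)) hp
    have c2 := ContDiffAt.comp x (contDiffAt_fderiv_apply hf' (0, 1)) hp
    have c3 := ContDiffAt.comp x (contDiffAt_fderiv_apply hg' (1, 0)) hp
    have c4 := ContDiffAt.comp x (contDiffAt_fderiv_apply hg' (0, 1)) hp
    have c5 := ContDiffAt.comp x (contDiffAt_quadratureS hf' hg') hp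
    have c6 := ContDiffAt.comp x (contDiffAt_quadratureZ hf' hg') hp
    simp only [Function.comp_def] at c1 c2 c3 c4 c5 c6
    fun_prop

/-- The boundary value of the extension on the rod `q = 0` is determined by the boundary value of
the defect of that rod. The rod at `p = 0` is treated by the exchange of `p` and `q`, which
replaces `σ` by `-σ`. -/
theorem endpoint_boundary_value
    (hP : P₁ ^ 2 + P₂ ^ 2 + P₁ * P₂ = P₁ + P₂) (hQ : Q₁ ^ 2 + Q₂ ^ 2 + Q₁ * Q₂ = Q₁ + Q₂)
    (hPQ : (P₁ - Q₁) ^ 2 + (P₂ - Q₂) ^ 2 + (P₁ - Q₁) * (P₂ - Q₂) = 1)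
    {S F G : ℝ × ℝ → ℝ} {p κ : ℝ} (hp : p ∈ Ioo 0 ε)
    (hS : ContinuousAt S (p, 0)) (hF : ContinuousAt F (p, 0)) (hG : ContinuousAt G (p, 0))
    (hSA : ∀ x ∈ Ioo 0 ε ×ˢ Ioo 0 ε, S x = 2 * A (parabolic z₀ σ x) + Real.log (x.1 + x.2))
    (hU : ∀ x ∈ Ioo 0 ε ×ˢ Ioo 0 ε,
      U (parabolic z₀ σ x) = P₁ * Real.log x.1 + Q₁ * Real.log x.2 + F x)
    (hV : ∀ x ∈ Ioo 0 ε ×ˢ Ioo 0 ε,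
      V (parabolic z₀ σ x) = P₂ * Real.log x.1 + Q₂ * Real.log x.2 + G x)
    (hκ : Tendsto (rodDefect Q₁ Q₂ U V A) (𝓝[{x | 0 < x.1}] (0, z₀ + σ * p / 2)) (𝓝 κ)) :
    S (p, 0) - 2 * rodLinear Q₁ Q₂ (F (p, 0)) (G (p, 0)) = 2 * κ := by
  have hε : 0 < ε := hp.1.trans hp.2
  have hpath : Tendsto (fun q : ℝ => (p, q)) (𝓝[>] 0) (𝓝 (p, 0)) :=
    (Continuous.continuousAt (by fun_prop : Continuous fun q : ℝ => (p, q))).tendsto.mono_left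
      nhdsWithin_le_nhds
  have h1 : Tendsto (fun q : ℝ => parabolic z₀ σ (p, q)) (𝓝[>] 0)
      (𝓝[{x | 0 < x.1}] (0, z₀ + σ * p / 2)) := by
    refine tendsto_nhdsWithin_iff.2 ⟨?_, ?_⟩
    · have := ((contDiff_parabolic z₀ σ).continuous.tendsto (p, 0)).comp hpath
      simpa [parabolic, Function.comp_def] using this
    · filter_upwards [self_mem_nhdsWithin] with q hq using mul_pos hp.1 hq
  have h2 := (hκ.comp h1).const_mul 2
  have h3 : ContinuousAt (fun x => S x - Real.log (x.1 + x.2) + Real.log x.1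
      - 2 * rodLinear Q₁ Q₂ (F x) (G x)) (p, 0) := by
    refine ((hS.sub (ContinuousAt.log (by fun_prop) ?_)).add
      (ContinuousAt.log (by fun_prop) hp.1.ne')).sub (continuousAt_const.mul
      ((continuousAt_const.mul hF).add (continuousAt_const.mul hG)))
    simpa using hp.1.ne'
  have h4 := tendsto_nhds_unique h2 ((h3.tendsto.comp hpath).congr' ?_)
  · simpa using h4.symm
  · filter_upwards [Ioo_mem_nhdsGT hε] with q hq
    have hx : (p, q) ∈ Ioo 0 ε ×ˢ Ioo 0 ε := ⟨hp, hq⟩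
    simp only [Function.comp_apply]
    rw [rodDefect, hSA _ hx, hU _ hx, hV _ hx]
    simp only [parabolic, rodLinear]
    rw [Real.log_mul hp.1.ne' hq.1.ne']
    linear_combination (2 * Real.log q) * hQ + Real.log p * (hP + hQ - hPQ)

end Endpoint

/-! ### Normal forms of solutions at rods and at their end points -/

/-- The coefficient of `log ρ²` in the potential of the axis rods of kind `i` near a rod. -/
def RodKind.weight (k : RodKind) (i : Angle) : ℝ := if k = .axis i then 1 else 0

/-- The identity by which the singular terms of the quadrature cancel at a rod. -/
theorem RodKind.weight_quadratic (k : RodKind) :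
    k.weight .phi ^ 2 + k.weight .psi ^ 2 + k.weight .phi * k.weight .psi =
      k.weight .phi + k.weight .psi := by
  rcases k with (_ | _) | _ <;> simp [RodKind.weight]

/-- The identity by which the singular terms of the quadrature at a common end point reduce to the
derivatives of `-log (p + q)`. It fails if both rods are of the same kind. -/
theorem RodKind.weight_sub_quadratic {k l : RodKind} (h : k ≠ l) :
    (k.weight .phi - l.weight .phi) ^ 2 + (k.weight .psi - l.weight .psi) ^ 2 +
      (k.weight .phi - l.weight .phi) * (k.weight .psi - l.weight .psi) = 1 := by
  rcases k with (_ | _) | _ <;> rcases l with (_ | _) | _ <;> simp [RodKind.weight] at h ⊢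

theorem ite_eq_weight_mul (k : RodKind) (i : Angle) (y : ℝ) :
    (if k = .axis i then y else 0) = k.weight i * y := by
  simp [RodKind.weight]

/-- A solution in the variables `(ρ², z)`: potentials of the diagram, up to additive constants, and
a function obtained from them by quadrature. It need not be balanced. -/
structure IsWeylSolution (D : RodDiagram) (U V A : ℝ × ℝ → ℝ) : Prop where
  potential_fst : ∃ k, ∀ x : ℝ × ℝ, 0 < x.1 → U x = diagramPotential D .phi x + k
  potential_snd : ∃ k, ∀ x : ℝ × ℝ, 0 < x.1 → V x = diagramPotential D .psi x + k
  quadrature : IsSquareQuadrature U V A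

/-- The defect of the rod `R` has the boundary value `κ`. A solution is balanced if this holds with
`κ = 0` for all axis rods. -/
def HasDefect (U V A : ℝ × ℝ → ℝ) (R : Rod) (κ : ℝ) : Prop :=
  ∀ z ∈ Ioo R.a R.b, Tendsto (rodDefect (R.kind.weight .phi) (R.kind.weight .psi) U V A)
    (𝓝[{x | 0 < x.1}] (0, z)) (𝓝 κ)

/-- The regular parts `f, g, α` of a solution at a rod of kind `k` with end points `a` and `b` and
defect `κ`. -/
structure RodForm (k : RodKind) (a b κ : ℝ) (U V A f g α : ℝ × ℝ → ℝ) : Prop where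
  smooth_fst : ∀ x ∈ rodDomain a b, ContDiffAt ℝ ∞ f x
  smooth_snd : ∀ x ∈ rodDomain a b, ContDiffAt ℝ ∞ g x
  smooth : ∀ x ∈ rodDomain a b, ContDiffAt ℝ ∞ α x
  fst_eq : ∀ x ∈ rodDomain a b, 0 < x.1 → U x = k.weight .phi * Real.log x.1 + f x
  snd_eq : ∀ x ∈ rodDomain a b, 0 < x.1 → V x = k.weight .psi * Real.log x.1 + g x
  eq : ∀ x ∈ rodDomain a b, 0 < x.1 → α x = A x
  boundary : ∀ z ∈ Ioo a b,
    α (0, z) = rodLinear (k.weight .phi) (k.weight .psi) (f (0, z)) (g (0, z)) + κ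

/-- The regular parts `F, G, S` of a solution in parabolic coordinates at a common end point of two
rods, of kind `k` and defect `κ` (at `p = 0`) and of kind `l` and defect `μ` (at `q = 0`). -/
structure EndpointForm (z₀ σ ε : ℝ) (k l : RodKind) (κ μ : ℝ) (U V A F G S : ℝ × ℝ → ℝ) :
    Prop where
  pos : 0 < ε
  smooth_fst : ∀ x ∈ Ioo (-ε) ε ×ˢ Ioo (-ε) ε, ContDiffAt ℝ ∞ F x
  smooth_snd : ∀ x ∈ Ioo (-ε) ε ×ˢ Ioo (-ε) ε, ContDiffAt ℝ ∞ G x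
  smooth : ∀ x ∈ Ioo (-ε) ε ×ˢ Ioo (-ε) ε, ContDiffAt ℝ ∞ S x
  fst_eq : ∀ x ∈ Ioo 0 ε ×ˢ Ioo 0 ε, U (parabolic z₀ σ x) =
    k.weight .phi * Real.log x.1 + l.weight .phi * Real.log x.2 + F x
  snd_eq : ∀ x ∈ Ioo 0 ε ×ˢ Ioo 0 ε, V (parabolic z₀ σ x) =
    k.weight .psi * Real.log x.1 + l.weight .psi * Real.log x.2 + G x
  eq : ∀ x ∈ Ioo 0 ε ×ˢ Ioo 0 ε, S x = 2 * A (parabolic z₀ σ x) + Real.log (x.1 + x.2)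
  boundary_snd : ∀ p ∈ Ioo 0 ε, S (p, 0) =
    2 * rodLinear (l.weight .phi) (l.weight .psi) (F (p, 0)) (G (p, 0)) + 2 * μ
  boundary_fst : ∀ q ∈ Ioo 0 ε, S (0, q) =
    2 * rodLinear (k.weight .phi) (k.weight .psi) (F (0, q)) (G (0, q)) + 2 * κ

section

variable {D : RodDiagram} {U V A : ℝ × ℝ → ℝ}

theorem IsWeylSolution.exists_rodForm (h : IsWeylSolution D U V A) (hD : D.IsSeparated) {R : Rod}
    (hR : R ∈ D.rods) : ∃ κ, HasDefect U V A R κ ∧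
      ∃ f g α, RodForm R.kind R.a R.b κ U V A f g α := by
  obtain ⟨R₀, hR₀, j, rfl⟩ := hR
  obtain ⟨k₁, h₁⟩ := h.potential_fst
  obtain ⟨k₂, h₂⟩ := h.potential_snd
  obtain ⟨f, hf⟩ := exists_smooth_part_rod hD .phi hR₀ j
  obtain ⟨g, hg⟩ := exists_smooth_part_rod hD .psi hR₀ j
  have hab : (R₀.shift (j * D.period)).a < (R₀.shift (j * D.period)).b := by
    have := hD.lt R₀ hR₀
    simp only [Rod.shift]
    linarith
  simp only [ite_eq_weight_mul] at hf hg
  have hf' : ∀ x ∈ rodDomain (R₀.shift (j * D.period)).a (R₀.shift (j * D.period)).b,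
      ContDiffAt ℝ ∞ (fun x => f x + k₁) x := fun x hx => (hf x hx).1.add contDiffAt_const
  have hg' : ∀ x ∈ rodDomain (R₀.shift (j * D.period)).a (R₀.shift (j * D.period)).b,
      ContDiffAt ℝ ∞ (fun x => g x + k₂) x := fun x hx => (hg x hx).1.add contDiffAt_const
  have hU : ∀ x ∈ rodDomain (R₀.shift (j * D.period)).a (R₀.shift (j * D.period)).b, 0 < x.1 →
      U x = (R₀.shift (j * D.period)).kind.weight .phi * Real.log x.1 + (f x + k₁) := by
    intro x hx hx0
    rw [h₁ x hx0, (hf x hx).2 hx0, add_assoc]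
    rfl
  have hV : ∀ x ∈ rodDomain (R₀.shift (j * D.period)).a (R₀.shift (j * D.period)).b, 0 < x.1 →
      V x = (R₀.shift (j * D.period)).kind.weight .psi * Real.log x.1 + (g x + k₂) := by
    intro x hx hx0
    rw [h₂ x hx0, (hg x hx).2 hx0, add_assoc]
    rfl
  have hw := (R₀.shift (j * D.period)).kind.weight_quadratic
  obtain ⟨A', hA', hAA', κ, hκ⟩ := exists_rod_extension hab hw hf' hg' hU hV h.quadrature
  refine ⟨κ, fun z hz => ?_, _, _, A', hf', hg', hA', hU, hV, hAA', fun z hz => ?_⟩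
  · rw [← hκ z hz]
    exact tendsto_rodDefect hw hf' hg' hU hV hA' hAA' hz
  · rw [← hκ z hz]
    ring

theorem northLog_eq_poleLog (z₀ : ℝ) : northLog z₀ = poleLog z₀ (-1) := by
  funext x
  simp only [northLog, poleLog]
  ring_nf

theorem southLog_eq_poleLog (z₀ : ℝ) : southLog z₀ = poleLog z₀ 1 := by
  funext x
  simp only [southLog, poleLog]
  ring_nf

/-- The normal form at a common end point `z₀` of two rods, `R` on the side `-σ` and `R'` on the
side `σ` of `z₀`. -/
theorem IsWeylSolution.exists_endpointForm (h : IsWeylSolution D U V A) (hD : D.IsSeparated)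
    {R R' : Rod} (hR : R ∈ D.rods) (hR' : R' ∈ D.rods) {z₀ σ : ℝ}
    (hσ : σ = 1 ∧ R.b = z₀ ∧ R'.a = z₀ ∨ σ = -1 ∧ R'.b = z₀ ∧ R.a = z₀)
    (hk : R.kind ≠ R'.kind) {κ μ : ℝ} (hκ : HasDefect U V A R κ) (hμ : HasDefect U V A R' μ) :
    ∃ ε F G S, EndpointForm z₀ σ ε R.kind R'.kind κ μ U V A F G S := by
  obtain ⟨R₀, hR₀, j, rfl⟩ := hR
  obtain ⟨R₀', hR₀', j', rfl⟩ := hR'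
  obtain ⟨k₁, h₁⟩ := h.potential_fst
  obtain ⟨k₂, h₂⟩ := h.potential_snd
  have hσ2 : σ ^ 2 = 1 := by rcases hσ with ⟨rfl, -⟩ | ⟨rfl, -⟩ <;> norm_num
  set k := (R₀.shift (j * D.period)).kind with hk_def
  set l := (R₀'.shift (j' * D.period)).kind with hl_def
  obtain ⟨ε, hε, hIp, hIq, hf⟩ : ∃ ε > 0,
      (∀ q ∈ Ioo 0 ε, z₀ - σ * q / 2 ∈ Ioo (R₀.shift (j * D.period)).a (R₀.shift (j * D.period)).b)
      ∧ (∀ p ∈ Ioo 0 ε,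
        z₀ + σ * p / 2 ∈ Ioo (R₀'.shift (j' * D.period)).a (R₀'.shift (j' * D.period)).b) ∧
      ∀ i : Angle, ∃ f : ℝ × ℝ → ℝ,
      ∀ x : ℝ × ℝ, |x.1| < ε ^ 2 → |x.2 - z₀| < ε → ContDiffAt ℝ ∞ f x ∧
        (0 < x.1 → diagramPotential D i x =
          k.weight i * poleLog z₀ σ x + l.weight i * poleLog z₀ (-σ) x + f x) := by
    rcases hσ with ⟨rfl, e1, e2⟩ | ⟨rfl, e1, e2⟩
    · obtain ⟨ε, hε, h3, h4, h5⟩ := exists_smooth_part_endpoint hD hR₀ hR₀' e1 e2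
      simp only [ite_eq_weight_mul, northLog_eq_poleLog, southLog_eq_poleLog] at h5
      refine ⟨ε, hε, fun q hq => ?_, fun p hp => ?_, h5⟩
      · rw [e1]
        exact ⟨h4.trans_lt (by linarith [hq.2]), by linarith [hq.1]⟩
      · rw [e2]
        exact ⟨by linarith [hp.1], lt_of_lt_of_le (by linarith [hp.2]) h3⟩
    · obtain ⟨ε, hε, h3, h4, h5⟩ := exists_smooth_part_endpoint hD hR₀' hR₀ e1 e2
      simp only [ite_eq_weight_mul, northLog_eq_poleLog, southLog_eq_poleLog] at h5
      refine ⟨ε, hε, fun q hq => ?_, fun p hp => ?_, fun i => ?_⟩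
      · rw [e2]
        exact ⟨by linarith [hq.1], lt_of_lt_of_le (by linarith [hq.2]) h3⟩
      · rw [e1]
        exact ⟨h4.trans_lt (by linarith [hp.2]), by linarith [hp.1]⟩
      · obtain ⟨f, hf⟩ := h5 i
        refine ⟨f, fun x hx1 hx2 => ⟨(hf x hx1 hx2).1, fun hx0 => ?_⟩⟩
        rw [(hf x hx1 hx2).2 hx0, neg_neg, add_comm (k.weight i * _)]
        rfl
  obtain ⟨f, hf1⟩ := hf .phi
  obtain ⟨g, hg1⟩ := hf .psi
  have hf' : ∀ x : ℝ × ℝ, |x.1| < ε ^ 2 → |x.2 - z₀| < ε →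
      ContDiffAt ℝ ∞ (fun x => f x + k₁) x := fun x h1 h2 => (hf1 x h1 h2).1.add contDiffAt_const
  have hg' : ∀ x : ℝ × ℝ, |x.1| < ε ^ 2 → |x.2 - z₀| < ε →
      ContDiffAt ℝ ∞ (fun x => g x + k₂) x := fun x h1 h2 => (hg1 x h1 h2).1.add contDiffAt_const
  have hU : ∀ x : ℝ × ℝ, |x.1| < ε ^ 2 → |x.2 - z₀| < ε → 0 < x.1 →
      U x = k.weight .phi * poleLog z₀ σ x + l.weight .phi * poleLog z₀ (-σ) x + (f x + k₁) := by
    intro x hx1 hx2 hx0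
    rw [h₁ x hx0, (hf1 x hx1 hx2).2 hx0, add_assoc]
  have hV : ∀ x : ℝ × ℝ, |x.1| < ε ^ 2 → |x.2 - z₀| < ε → 0 < x.1 →
      V x = k.weight .psi * poleLog z₀ σ x + l.weight .psi * poleLog z₀ (-σ) x + (g x + k₂) := by
    intro x hx1 hx2 hx0
    rw [h₂ x hx0, (hg1 x hx1 hx2).2 hx0, add_assoc]
  have hP := k.weight_quadratic
  have hQ := l.weight_quadratic
  have hPQ := RodKind.weight_sub_quadratic hk
  have hQP := RodKind.weight_sub_quadratic (Ne.symm hk)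
  obtain ⟨S, hS, hSA⟩ := exists_endpoint_extension hε hσ2 hP hQ hPQ hf' hg' hU hV h.quadrature
  have hbox : ∀ x ∈ Ioo 0 ε ×ˢ Ioo 0 ε, x ∈ Ioo (-ε) ε ×ˢ Ioo (-ε) ε := fun x hx =>
    ⟨⟨by linarith [hx.1.1], hx.1.2⟩, ⟨by linarith [hx.2.1], hx.2.2⟩⟩
  have hpar := contDiff_parabolic z₀ σ
  have hF : ∀ x ∈ Ioo (-ε) ε ×ˢ Ioo (-ε) ε,
      ContDiffAt ℝ ∞ (fun x => f (parabolic z₀ σ x) + k₁) x := fun x hx =>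
    ContDiffAt.comp x (hf' _ (parabolic_mem hσ2 hx).1 (parabolic_mem hσ2 hx).2) hpar.contDiffAt
  have hG : ∀ x ∈ Ioo (-ε) ε ×ˢ Ioo (-ε) ε,
      ContDiffAt ℝ ∞ (fun x => g (parabolic z₀ σ x) + k₂) x := fun x hx =>
    ContDiffAt.comp x (hg' _ (parabolic_mem hσ2 hx).1 (parabolic_mem hσ2 hx).2) hpar.contDiffAt
  have hU' : ∀ x ∈ Ioo 0 ε ×ˢ Ioo 0 ε, U (parabolic z₀ σ x) = k.weight .phi * Real.log x.1 +
      l.weight .phi * Real.log x.2 + (f (parabolic z₀ σ x) + k₁) := by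
    intro x hx
    have hm := parabolic_mem (z₀ := z₀) hσ2 (hbox x hx)
    rw [hU _ hm.1 hm.2 (mul_pos hx.1.1 hx.2.1), ← poleLog_parabolic hσ2 hx.1.1 hx.2.1,
      ← poleLog_neg_parabolic hσ2 hx.1.1 hx.2.1]
  have hV' : ∀ x ∈ Ioo 0 ε ×ˢ Ioo 0 ε, V (parabolic z₀ σ x) = k.weight .psi * Real.log x.1 +
      l.weight .psi * Real.log x.2 + (g (parabolic z₀ σ x) + k₂) := by
    intro x hx
    have hm := parabolic_mem (z₀ := z₀) hσ2 (hbox x hx)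
    rw [hV _ hm.1 hm.2 (mul_pos hx.1.1 hx.2.1), ← poleLog_parabolic hσ2 hx.1.1 hx.2.1,
      ← poleLog_neg_parabolic hσ2 hx.1.1 hx.2.1]
  refine ⟨ε, _, _, S, hε, hF, hG, hS, hU', hV', hSA, fun p hp => ?_, fun q hq => ?_⟩
  · have hx : (p, (0 : ℝ)) ∈ Ioo (-ε) ε ×ˢ Ioo (-ε) ε :=
      ⟨⟨by linarith [hp.1], hp.2⟩, ⟨by linarith, hε⟩⟩
    rw [← endpoint_boundary_value hP hQ hPQ hp (hS _ hx).continuousAt (hF _ hx).continuousAt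
      (hG _ hx).continuousAt hSA hU' hV' (hμ _ (hIq p hp))]
    ring
  · have hx : ((0 : ℝ), q) ∈ Ioo (-ε) ε ×ˢ Ioo (-ε) ε :=
      ⟨⟨by linarith, hε⟩, ⟨by linarith [hq.1], hq.2⟩⟩
    have hs : ContinuousAt (fun x : ℝ × ℝ => (x.2, x.1)) (q, 0) := by fun_prop
    have hκ' := hκ _ (hIp q hq)
    rw [show z₀ - σ * q / 2 = z₀ + -σ * q / 2 by ring] at hκ'
    have := endpoint_boundary_value (S := fun x => S (x.2, x.1))
      (F := fun x => f (parabolic z₀ σ (x.2, x.1)) + k₁)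
      (G := fun x => g (parabolic z₀ σ (x.2, x.1)) + k₂) hQ hP hQP hq
      (ContinuousAt.comp (f := fun x : ℝ × ℝ => (x.2, x.1)) (g := S) (x := (q, 0))
        (hS _ hx).continuousAt hs)
      (ContinuousAt.comp (f := fun x : ℝ × ℝ => (x.2, x.1)) (x := (q, 0))
        (hF _ hx).continuousAt hs)
      (ContinuousAt.comp (f := fun x : ℝ × ℝ => (x.2, x.1)) (x := (q, 0))
        (hG _ hx).continuousAt hs)
      (fun x hx => ?_) (fun x hx => ?_) (fun x hx => ?_) hκ'
    · rw [← this]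
      ring
    · rw [hSA (x.2, x.1) ⟨hx.2, hx.1⟩, parabolic_swap, add_comm x.2]
    · have := hU' (x.2, x.1) ⟨hx.2, hx.1⟩
      rw [← parabolic_swap, this]
      ring
    · have := hV' (x.2, x.1) ⟨hx.2, hx.1⟩
      rw [← parabolic_swap, this]
      ring

end

/-! ### Solutions in the variables `(ρ², z)` -/

section

variable {D : RodDiagram} {U V A : ℝ × ℝ → ℝ} {u v α : ℝ → ℝ → ℝ}

theorem IsWeylSolution.isAxiHarmonicAt_fst (h : IsWeylSolution D U V A) (hD : D.IsSeparated)
    {x : ℝ × ℝ} (hx : 0 < x.1) : IsAxiHarmonicAt U x := by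
  obtain ⟨k, hk⟩ := h.potential_fst
  exact ((isAxiHarmonicAt_diagramPotential hD.period_pos (fun R hR => (hD.lt R hR).le) .phi
    hx).add (.const k)).congr ((eventually_pos_fst hx).mono hk)

theorem IsWeylSolution.isAxiHarmonicAt_snd (h : IsWeylSolution D U V A) (hD : D.IsSeparated)
    {x : ℝ × ℝ} (hx : 0 < x.1) : IsAxiHarmonicAt V x := by
  obtain ⟨k, hk⟩ := h.potential_snd
  exact ((isAxiHarmonicAt_diagramPotential hD.period_pos (fun R hR => (hD.lt R hR).le) .psi
    hx).add (.const k)).congr ((eventually_pos_fst hx).mono hk)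

theorem IsWeylSolution.contDiffAt (h : IsWeylSolution D U V A) (hD : D.IsSeparated)
    {x : ℝ × ℝ} (hx : 0 < x.1) : ContDiffAt ℝ ∞ A x :=
  h.quadrature.contDiffAt (fun _ hx => (h.isAxiHarmonicAt_fst hD hx).1)
    (fun _ hx => (h.isAxiHarmonicAt_snd hD hx).1) hx

theorem isRenormalizedPotential_iff (hD : D.IsSeparated) (i : Angle) (w : ℝ → ℝ → ℝ) :
    IsRenormalizedPotential D i w ↔
      ∃ k, ∀ ρ z, 0 < ρ → w ρ z = diagramPotential D i (ρ ^ 2, z) + k := by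
  refine exists_congr fun k => forall_congr' fun ρ => forall_congr' fun z =>
    imp_congr_right fun hρ => ?_
  have h1 := (tendsto_partialPotential hD.period_pos (fun R hR => (hD.lt R hR).le) i hρ
    z).add_const k
  exact ⟨fun h => tendsto_nhds_unique h h1, fun h => h ▸ h1⟩

/-- The functions of `(ρ, z)` given by a renormalized series and by the quadrature are functions of
`(ρ², z)`; the constants `k_u`, `k_v` and the constant of integration of `α` are absorbed. -/
theorem exists_isWeylSolution (hD : D.IsSeparated) (hu : IsRenormalizedPotential D .phi u)
    (hv : IsRenormalizedPotential D .psi v) (hα : IsQuadrature u v α) :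
    ∃ U V A, IsWeylSolution D U V A ∧ ∀ ρ z, 0 < ρ →
      u ρ z = U (ρ ^ 2, z) ∧ v ρ z = V (ρ ^ 2, z) ∧ α ρ z = A (ρ ^ 2, z) := by
  obtain ⟨k, hk⟩ := (isRenormalizedPotential_iff hD _ _).1 hu
  obtain ⟨l, hl⟩ := (isRenormalizedPotential_iff hD _ _).1 hv
  have hle : ∀ R ∈ D.cell, R.a ≤ R.b := fun R hR => (hD.lt R hR).le
  have hU : ∀ x : ℝ × ℝ, 0 < x.1 → IsAxiHarmonicAt (fun x => diagramPotential D .phi x + k) x :=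
    fun x hx => (isAxiHarmonicAt_diagramPotential hD.period_pos hle .phi hx).add (.const k)
  have hV : ∀ x : ℝ × ℝ, 0 < x.1 → IsAxiHarmonicAt (fun x => diagramPotential D .psi x + l) x :=
    fun x hx => (isAxiHarmonicAt_diagramPotential hD.period_pos hle .psi hx).add (.const l)
  obtain ⟨A, hA⟩ := exists_isSquareQuadrature hU hV
  obtain ⟨c, hc⟩ := exists_eq_quadrature hk hl (fun x hx => (hU x hx).1) (fun x hx => (hV x hx).1)
    hA hα
  exact ⟨_, _, fun x => A x + c, ⟨⟨k, fun _ _ => rfl⟩, ⟨l, fun _ _ => rfl⟩,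
    fun x hx => (hA x hx).add_const c⟩, fun ρ z hρ => ⟨hk ρ z hρ, hl ρ z hρ, hc ρ z hρ⟩⟩

/-- The boundary value of the defect of an axis rod is the logarithmic angle defect. -/
theorem tendsto_angle_defect (hu : ∀ ρ z, 0 < ρ → u ρ z = U (ρ ^ 2, z))
    (hv : ∀ ρ z, 0 < ρ → v ρ z = V (ρ ^ 2, z)) (hα : ∀ ρ z, 0 < ρ → α ρ z = A (ρ ^ 2, z))
    {R : Rod} {i : Angle} (hi : R.kind = .axis i) {κ : ℝ} (hκ : HasDefect U V A R κ) {z : ℝ}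
    (hz : z ∈ Ioo R.a R.b) :
    Tendsto (fun ρ => Real.log ρ + α ρ z - fiber u v i ρ z / 2) (𝓝[>] 0) (𝓝 κ) := by
  have h1 : Tendsto (fun ρ : ℝ => (ρ ^ 2, z)) (𝓝[>] 0) (𝓝[{x | 0 < x.1}] (0, z)) := by
    refine tendsto_nhdsWithin_iff.2 ⟨?_, ?_⟩
    · have : Continuous fun ρ : ℝ => (ρ ^ 2, z) := by fun_prop
      simpa using (this.tendsto 0).mono_left (nhdsWithin_le_nhds (s := Ioi 0))
    · filter_upwards [self_mem_nhdsWithin] with ρ hρ using pow_pos hρ 2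
  refine ((hκ z hz).comp h1).congr' ?_
  filter_upwards [self_mem_nhdsWithin] with ρ hρ
  rw [mem_Ioi] at hρ
  simp only [Function.comp_apply, rodDefect, rodLinear, hα ρ z hρ, Real.log_pow, hi]
  cases i <;> simp [RodKind.weight, fiber, hu ρ z hρ, hv ρ z hρ] <;> ring

theorem IsWeylSolution.hasDefect_zero (h : IsWeylSolution D U V A) (hD : D.IsSeparated)
    (hu : ∀ ρ z, 0 < ρ → u ρ z = U (ρ ^ 2, z))
    (hv : ∀ ρ z, 0 < ρ → v ρ z = V (ρ ^ 2, z)) (hα : ∀ ρ z, 0 < ρ → α ρ z = A (ρ ^ 2, z))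
    (hb : IsBalanced D u v α) {R : Rod} (hR : R ∈ D.rods) {i : Angle} (hi : R.kind = .axis i) :
    HasDefect U V A R 0 := by
  obtain ⟨κ, hκ, -⟩ := h.exists_rodForm hD hR
  have hab : R.a < R.b := by
    obtain ⟨R₀, hR₀, j, rfl⟩ := hR
    have := hD.lt R₀ hR₀
    simp only [Rod.shift]
    linarith
  obtain ⟨z, hz⟩ := nonempty_Ioo.2 hab
  rwa [tendsto_nhds_unique (hb R hR i hi z hz) (tendsto_angle_defect hu hv hα hi hκ hz)]

end

/-! ### Symmetry and the existence of balanced solutions -/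

section Symmetry

/-- The isometry `z ↦ h + ε z` of the axis, acting on functions of `(ρ², z)`. -/
def axisMap (ε h : ℝ) (x : ℝ × ℝ) : ℝ × ℝ := (x.1, h + ε * x.2)

theorem fderiv_comp_axisMap {ε h : ℝ} {W : ℝ × ℝ → ℝ} {x : ℝ × ℝ}
    (hW : DifferentiableAt ℝ W (axisMap ε h x)) :
    fderiv ℝ (W ∘ axisMap ε h) x (1, 0) = fderiv ℝ W (axisMap ε h x) (1, 0) ∧
    fderiv ℝ (W ∘ axisMap ε h) x (0, 1) = ε * fderiv ℝ W (axisMap ε h x) (0, 1) := by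
  have hd : Differentiable ℝ (axisMap ε h) := by
    unfold axisMap
    fun_prop
  have hc := hW.comp x (hd x)
  refine ⟨fderiv_fst_eq hc (hasDerivAt_fst hW), fderiv_snd_eq hc ?_⟩
  have h1 : HasDerivAt (fun z => h + ε * z) ε x.2 := by
    simpa using ((hasDerivAt_id x.2).const_mul ε).const_add h
  have h2 : HasDerivAt (fun z => W (x.1, h + ε * z)) _ x.2 :=
    HasDerivAt.comp (h₂ := fun z => W (x.1, z)) (h := fun z => h + ε * z) x.2 (hasDerivAt_snd hW) h1
  exact h2.congr_deriv (mul_comm _ _)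

variable {U V A U' V' A' : ℝ × ℝ → ℝ} {ε h : ℝ}

theorem IsSquareQuadrature.eq_add_const (hA : IsSquareQuadrature U V A)
    (hA' : IsSquareQuadrature U V A') : ∃ k, ∀ x : ℝ × ℝ, 0 < x.1 → A' x = A x + k :=
  eq_add_const_of_hasDerivAt (fun _ => hA'.hasDerivAt_fst) (fun _ => hA'.hasDerivAt_snd)
    (fun _ => hA.hasDerivAt_fst) (fun _ => hA.hasDerivAt_snd)

theorem IsSquareQuadrature.congr_add_const (hA : IsSquareQuadrature U V A) {k l : ℝ}
    (hU : ∀ x : ℝ × ℝ, 0 < x.1 → U' x = U x + k) (hV : ∀ x : ℝ × ℝ, 0 < x.1 → V' x = V x + l) :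
    IsSquareQuadrature U' V' A := by
  intro x hx
  have h1 : fderiv ℝ U' x = fderiv ℝ U x := by
    rw [EventuallyEq.fderiv_eq (f₁ := U') (f := fun x => U x + k)
      ((eventually_pos_fst hx).mono hU), fderiv_add_const]
  have h2 : fderiv ℝ V' x = fderiv ℝ V x := by
    rw [EventuallyEq.fderiv_eq (f₁ := V') (f := fun x => V x + l)
      ((eventually_pos_fst hx).mono hV), fderiv_add_const]
  have h3 := hA x hx
  simp only [quadratureS, quadratureZ] at h3 ⊢
  rwa [h1, h2]

theorem IsSquareQuadrature.swap (hA : IsSquareQuadrature U V A) : IsSquareQuadrature V U A := by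
  intro x hx
  have h3 := hA x hx
  have h1 : quadratureS V U x = quadratureS U V x := by
    simp only [quadratureS]
    ring
  have h2 : quadratureZ V U x = quadratureZ U V x := by
    simp only [quadratureZ]
    ring
  rwa [h1, h2]

theorem IsSquareQuadrature.comp_axisMap (hA : IsSquareQuadrature U V A) (hε : ε ^ 2 = 1)
    (hU : ∀ x : ℝ × ℝ, 0 < x.1 → DifferentiableAt ℝ U x)
    (hV : ∀ x : ℝ × ℝ, 0 < x.1 → DifferentiableAt ℝ V x) :
    IsSquareQuadrature (U ∘ axisMap ε h) (V ∘ axisMap ε h) (A ∘ axisMap ε h) := by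
  intro x hx
  obtain ⟨u1, u2⟩ := fderiv_comp_axisMap (hU (axisMap ε h x) hx)
  obtain ⟨v1, v2⟩ := fderiv_comp_axisMap (hV (axisMap ε h x) hx)
  have h1 : quadratureS (U ∘ axisMap ε h) (V ∘ axisMap ε h) x =
      quadratureS U V (axisMap ε h x) := by
    simp only [quadratureS, u1, u2, v1, v2]
    simp only [axisMap]
    linear_combination (-(fderiv ℝ U (x.1, h + ε * x.2) (0, 1) ^ 2 +
      fderiv ℝ V (x.1, h + ε * x.2) (0, 1) ^ 2 +
      fderiv ℝ U (x.1, h + ε * x.2) (0, 1) * fderiv ℝ V (x.1, h + ε * x.2) (0, 1)) / 8) * hε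
  have h2 : quadratureZ (U ∘ axisMap ε h) (V ∘ axisMap ε h) x =
      ε * quadratureZ U V (axisMap ε h x) := by
    simp only [quadratureZ, u1, u2, v1, v2]
    simp only [axisMap]
    ring
  have h3 : HasFDerivAt (axisMap ε h) ((ContinuousLinearMap.fst ℝ ℝ ℝ).prod
      (ε • ContinuousLinearMap.snd ℝ ℝ ℝ)) x :=
    hasFDerivAt_fst.prodMk ((hasFDerivAt_snd.const_mul ε).const_add h)
  rw [h1, h2]
  refine ((hA (axisMap ε h x) hx).comp x h3).congr_fderiv ?_
  ext <;> simp [mul_comm]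

/-- A symmetry of the pair of potentials is a symmetry of `α` up to a constant. -/
theorem IsSquareQuadrature.comp_axisMap_eq (hA : IsSquareQuadrature U V A) (hε : ε ^ 2 = 1)
    (hU : ∀ x : ℝ × ℝ, 0 < x.1 → DifferentiableAt ℝ U x)
    (hV : ∀ x : ℝ × ℝ, 0 < x.1 → DifferentiableAt ℝ V x)
    (hs : (∀ x : ℝ × ℝ, U (axisMap ε h x) = U x ∧ V (axisMap ε h x) = V x) ∨
      ∀ x : ℝ × ℝ, U (axisMap ε h x) = V x ∧ V (axisMap ε h x) = U x) :
    ∃ k, ∀ x : ℝ × ℝ, 0 < x.1 → A (axisMap ε h x) = A x + k := by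
  have h1 := hA.comp_axisMap (h := h) hε hU hV
  rcases hs with hs | hs
  · exact hA.eq_add_const (h1.congr_add_const (k := 0) (l := 0)
      (fun x _ => by simp [(hs x).1]) (fun x _ => by simp [(hs x).2]))
  · exact hA.eq_add_const (h1.congr_add_const (k := 0) (l := 0)
      (fun x _ => by simp [(hs x).1]) (fun x _ => by simp [(hs x).2])).swap

/-- A reflection of the axis which preserves or exchanges the potentials leaves `α` invariant. The
constant vanishes because the reflection has a fixed point. -/
theorem IsSquareQuadrature.reflect_eq (hA : IsSquareQuadrature U V A)
    (hU : ∀ x : ℝ × ℝ, 0 < x.1 → DifferentiableAt ℝ U x)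
    (hV : ∀ x : ℝ × ℝ, 0 < x.1 → DifferentiableAt ℝ V x)
    (hs : (∀ x : ℝ × ℝ, U (axisMap (-1) h x) = U x ∧ V (axisMap (-1) h x) = V x) ∨
      ∀ x : ℝ × ℝ, U (axisMap (-1) h x) = V x ∧ V (axisMap (-1) h x) = U x)
    {x : ℝ × ℝ} (hx : 0 < x.1) : A (axisMap (-1) h x) = A x := by
  obtain ⟨k, hk⟩ := hA.comp_axisMap_eq (by norm_num) hU hV hs
  have h1 := hk (1, h / 2) one_pos
  rw [show axisMap (-1) h ((1 : ℝ), h / 2) = (1, h / 2) by simp only [axisMap]; ring_nf] at h1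
  rw [hk x hx]
  linarith

/-- In the presence of a reflection symmetry `α` has the period of the potentials. -/
theorem IsSquareQuadrature.translate_eq (hA : IsSquareQuadrature U V A)
    (hU : ∀ x : ℝ × ℝ, 0 < x.1 → DifferentiableAt ℝ U x)
    (hV : ∀ x : ℝ × ℝ, 0 < x.1 → DifferentiableAt ℝ V x) {P : ℝ}
    (hP : ∀ x : ℝ × ℝ, U (axisMap 1 P x) = U x ∧ V (axisMap 1 P x) = V x)
    (hs : (∀ x : ℝ × ℝ, U (axisMap (-1) h x) = U x ∧ V (axisMap (-1) h x) = V x) ∨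
      ∀ x : ℝ × ℝ, U (axisMap (-1) h x) = V x ∧ V (axisMap (-1) h x) = U x)
    {x : ℝ × ℝ} (hx : 0 < x.1) : A (axisMap 1 P x) = A x := by
  obtain ⟨k, hk⟩ := hA.comp_axisMap_eq (by norm_num) hU hV (Or.inl hP)
  -- The reflection exchanges two points at the distance `P`.
  have h1 := hk (1, (h - P) / 2) one_pos
  have h2 := hA.reflect_eq hU hV hs (x := (1, (h - P) / 2)) one_pos
  rw [show axisMap 1 P ((1 : ℝ), (h - P) / 2) = axisMap (-1) h (1, (h - P) / 2) by
    simp only [axisMap]; ring_nf] at h1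
  rw [hk x hx]
  linarith

theorem HasDefect.comp_axisMap {R R' : Rod} {κ : ℝ} (hκ : HasDefect U V A R κ)
    (hU : ∀ x : ℝ × ℝ, 0 < x.1 → U (axisMap ε h x) = U x)
    (hV : ∀ x : ℝ × ℝ, 0 < x.1 → V (axisMap ε h x) = V x)
    (hA : ∀ x : ℝ × ℝ, 0 < x.1 → A (axisMap ε h x) = A x) (hk : R'.kind = R.kind)
    (hR : ∀ z ∈ Ioo R'.a R'.b, h + ε * z ∈ Ioo R.a R.b) :
    HasDefect U V A R' κ := by
  intro z hz
  have h1 : Tendsto (axisMap ε h) (𝓝[{x | 0 < x.1}] (0, z))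
      (𝓝[{x | 0 < x.1}] (0, h + ε * z)) := by
    refine tendsto_nhdsWithin_iff.2 ⟨?_, ?_⟩
    · have : Continuous (axisMap ε h) := by
        unfold axisMap
        fun_prop
      exact (this.tendsto (0, z)).mono_left nhdsWithin_le_nhds
    · filter_upwards [self_mem_nhdsWithin] with x hx using hx
  refine ((hκ _ (hR z hz)).comp h1).congr' ?_
  filter_upwards [self_mem_nhdsWithin] with x hx
  rw [Function.comp_apply, rodDefect, rodDefect, hU x hx, hV x hx, hA x hx, hk]
  rfl

/-- Additive constants in the potentials leave `α` unchanged and shift the defect. -/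
theorem HasDefect.add_const {k l : ℝ} {R : Rod} {κ : ℝ} (hκ : HasDefect U V A R κ)
    (hU : ∀ x : ℝ × ℝ, 0 < x.1 → U' x = U x + k) (hV : ∀ x : ℝ × ℝ, 0 < x.1 → V' x = V x + l) :
    HasDefect U' V' A R (κ - rodLinear (R.kind.weight .phi) (R.kind.weight .psi) k l) := by
  intro z hz
  refine ((hκ z hz).sub_const _).congr' ?_
  filter_upwards [self_mem_nhdsWithin] with x hx
  rw [rodDefect, rodDefect, hU x hx, hV x hx, rodLinear, rodLinear, rodLinear]
  ring

end Symmetry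

section Existence

variable {D : RodDiagram}

theorem diagramPotential_add_period (hD : D.IsSeparated) (i : Angle) (x : ℝ × ℝ) :
    diagramPotential D i (axisMap 1 D.period x) = diagramPotential D i x := by
  simp only [diagramPotential]
  congr 1
  refine List.map_congr_left fun R hR => ?_
  have h1 := periodicPotential_add_period hD.period_pos (c := R.a - D.period)
    (d := R.b - D.period) (by linarith [hD.lt R hR]) x
  rw [sub_add_cancel, sub_add_cancel] at h1
  rw [h1, axisMap, one_mul, add_comm, periodicPotential_translate]

/-- The pair of potentials is preserved or exchanged by the reflection `z ↦ h - z` of the axis. -/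
def RodDiagram.IsReflective (D : RodDiagram) (h : ℝ) : Prop :=
  (∀ x : ℝ × ℝ, ∀ i, diagramPotential D i (axisMap (-1) h x) = diagramPotential D i x) ∨
    ∀ x : ℝ × ℝ, diagramPotential D .phi (axisMap (-1) h x) = diagramPotential D .psi x ∧
      diagramPotential D .psi (axisMap (-1) h x) = diagramPotential D .phi x

/-- Balanced solutions exist if a reflection maps the rod diagram to itself and all axis rods of one
kind are equivalent under the translations and, if it preserves the kinds, the reflection. The
defects then depend only on the kind and are removed by additive constants in the potentials. -/
theorem exists_isBalancedSolution (hD : D.IsSeparated) {h : ℝ} (hs : D.IsReflective h)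
    (huniq : ∀ R ∈ D.cell, ∀ R' ∈ D.cell, ∀ i, R.kind = .axis i → R'.kind = .axis i →
      R = R' ∨ (∀ x : ℝ × ℝ, ∀ i, diagramPotential D i (axisMap (-1) h x) =
        diagramPotential D i x) ∧ R'.a = h - R.b ∧ R'.b = h - R.a) :
    ∃ u v α, IsBalancedSolution D u v α := by
  have hle : ∀ R ∈ D.cell, R.a ≤ R.b := fun R hR => (hD.lt R hR).le
  have hW : ∀ i, ∀ x : ℝ × ℝ, 0 < x.1 → IsAxiHarmonicAt (diagramPotential D i) x :=
    fun i x hx => isAxiHarmonicAt_diagramPotential hD.period_pos hle i hx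
  have hWd : ∀ i, ∀ x : ℝ × ℝ, 0 < x.1 → DifferentiableAt ℝ (diagramPotential D i) x :=
    fun i x hx => (hW i x hx).1.differentiableAt (by simp)
  set U := diagramPotential D .phi with hU
  set V := diagramPotential D .psi with hV
  obtain ⟨A, hA⟩ := exists_isSquareQuadrature (hW .phi) (hW .psi)
  have hs' : (∀ x : ℝ × ℝ, U (axisMap (-1) h x) = U x ∧ V (axisMap (-1) h x) = V x) ∨
      ∀ x : ℝ × ℝ, U (axisMap (-1) h x) = V x ∧ V (axisMap (-1) h x) = U x :=
    hs.imp_left fun hs x => ⟨hs x .phi, hs x .psi⟩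
  have hsol : IsWeylSolution D U V A := ⟨⟨0, by simp [hU]⟩, ⟨0, by simp [hV]⟩, hA⟩
  have hper : ∀ x : ℝ × ℝ, U (axisMap 1 D.period x) = U x ∧ V (axisMap 1 D.period x) = V x :=
    fun x => ⟨diagramPotential_add_period hD .phi x, diagramPotential_add_period hD .psi x⟩
  have hAper : ∀ x : ℝ × ℝ, 0 < x.1 → A (axisMap 1 D.period x) = A x := fun x hx =>
    hA.translate_eq (hWd .phi) (hWd .psi) hper hs' hx
  have hAref : ∀ x : ℝ × ℝ, 0 < x.1 → A (axisMap (-1) h x) = A x := fun x hx =>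
    hA.reflect_eq (hWd .phi) (hWd .psi) hs' hx
  have hshift : ∀ R : Rod, ∀ κ, HasDefect U V A R κ →
      HasDefect U V A (R.shift D.period) κ ∧ HasDefect U V A (R.shift (-D.period)) κ := by
    intro R κ hκ
    have hneg : ∀ {W : ℝ × ℝ → ℝ}, (∀ x : ℝ × ℝ, 0 < x.1 → W (axisMap 1 D.period x) = W x) →
        ∀ x : ℝ × ℝ, 0 < x.1 → W (axisMap 1 (-D.period) x) = W x := fun hW x hx => by
      rw [← hW (axisMap 1 (-D.period) x) hx]
      simp [axisMap]
    refine ⟨hκ.comp_axisMap (ε := 1) (h := -D.period) (R' := R.shift D.period)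
      (hneg fun x _ => (hper x).1) (hneg fun x _ => (hper x).2) (hneg hAper) rfl fun z hz => ?_,
      hκ.comp_axisMap (ε := 1) (h := D.period) (R' := R.shift (-D.period)) (fun x _ => (hper x).1)
      (fun x _ => (hper x).2) hAper rfl fun z hz => ?_⟩ <;>
    · simp only [Rod.shift] at hz
      constructor <;> linarith [hz.1, hz.2]
  have hshiftZ : ∀ R : Rod, ∀ κ, HasDefect U V A R κ → ∀ j : ℤ,
      HasDefect U V A (R.shift (j * D.period)) κ := by
    intro R κ hκ j
    induction j with
    | zero => simpa [Rod.shift] using hκ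
    | succ n ih =>
      have := (hshift _ _ ih).1
      simp only [Rod.shift, add_assoc] at this ⊢
      push_cast
      rwa [add_one_mul]
    | pred n ih =>
      have := (hshift _ _ ih).2
      simp only [Rod.shift, add_assoc] at this ⊢
      push_cast at this ⊢
      rwa [sub_one_mul, sub_eq_add_neg]
  have hcell : ∀ R ∈ D.cell, R ∈ D.rods := fun R hR => ⟨R, hR, 0, by simp [Rod.shift]⟩
  have hconst : ∀ i : Angle, ∃ d, ∀ R ∈ D.cell, R.kind = .axis i → HasDefect U V A R d := by
    intro i
    by_cases hi : ∃ R ∈ D.cell, R.kind = .axis i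
    · obtain ⟨R, hR, hRi⟩ := hi
      obtain ⟨κ, hκ, -⟩ := hsol.exists_rodForm hD (hcell R hR)
      refine ⟨κ, fun R' hR' hRi' => ?_⟩
      rcases huniq R hR R' hR' i hRi hRi' with rfl | ⟨hr, ha, hb⟩
      · exact hκ
      · refine hκ.comp_axisMap (ε := -1) (h := h) (fun x _ => hr x .phi)
          (fun x _ => hr x .psi) hAref (hRi'.trans hRi.symm) fun z hz => ?_
        constructor <;> linarith [hz.1, hz.2]
    · push Not at hi
      exact ⟨0, fun R hR h => absurd h (hi R hR)⟩
  choose d hd using hconst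
  -- Adding `k` to `u` lowers the defect `α - u / 2` of a rod of kind `φ` by `k / 2`.
  set k := 2 * d .phi with hk
  set l := 2 * d .psi with hl
  refine ⟨fun ρ z => U (ρ ^ 2, z) + k, fun ρ z => V (ρ ^ 2, z) + l, fun ρ z => A (ρ ^ 2, z),
    (isRenormalizedPotential_iff hD _ _).2 ⟨k, fun _ _ _ => rfl⟩,
    (isRenormalizedPotential_iff hD _ _).2 ⟨l, fun _ _ _ => rfl⟩, ?_, ?_⟩
  · have hA' := hA.congr_add_const (U' := fun x => U x + k) (V' := fun x => V x + l)
      (fun _ _ => rfl) (fun _ _ => rfl)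
    refine (isQuadrature_iff (U := fun x => U x + k) (V := fun x => V x + l) (fun _ _ _ => rfl)
      (fun _ _ _ => rfl) (fun x hx => (hW .phi x hx).1.add contDiffAt_const)
      (fun x hx => (hW .psi x hx).1.add contDiffAt_const)).2 fun ρ z hρ => ?_
    exact ⟨hasDerivAt_comp_sq (hA'.hasDerivAt_fst (x := (ρ ^ 2, z)) (pow_pos hρ 2)),
      hA'.hasDerivAt_snd (x := (ρ ^ 2, z)) (pow_pos hρ 2)⟩
  · rintro R ⟨R₀, hR₀, j, rfl⟩ i hi z hz
    have h1 := (hshiftZ R₀ _ (hd i R₀ hR₀ hi) j).add_const (U' := fun x => U x + k)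
      (V' := fun x => V x + l) (fun _ _ => rfl) (fun _ _ => rfl)
    have h2 : d i - rodLinear ((R₀.shift (j * D.period)).kind.weight .phi)
        ((R₀.shift (j * D.period)).kind.weight .psi) k l = 0 := by
      rw [hi]
      cases i <;> simp [RodKind.weight, rodLinear, hk, hl] <;> ring
    rw [h2] at h1
    exact tendsto_angle_defect (U := fun x => U x + k) (V := fun x => V x + l) (fun _ _ _ => rfl)
      (fun _ _ _ => rfl) (fun _ _ _ => rfl) hi h1 hz

end Existence

/-! ### Combinatorics of the rod diagrams -/

/-- The rods of the list `l` fill the interval from `a` to `b` in their order. Neighbors are of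
different kinds, where `k` is the kind of a rod which precedes `l`; the last rod has kind `k'`. -/
def Tiles (a : ℝ) (k : RodKind) : List Rod → ℝ → RodKind → Prop
  | [], b, k' => a = b ∧ k = k'
  | R :: l, b, k' => R.a = a ∧ R.a < R.b ∧ k ≠ R.kind ∧ Tiles R.b R.kind l b k'

section Tiles

variable {a b : ℝ} {k k' : RodKind} {l : List Rod}

theorem Tiles.bounds (h : Tiles a k l b k') :
    a ≤ b ∧ ∀ R ∈ l, a ≤ R.a ∧ R.a < R.b ∧ R.b ≤ b := by
  induction l generalizing a k with
  | nil => exact ⟨h.1.le, by simp⟩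
  | cons R l ih =>
    obtain ⟨rfl, h2, -, h4⟩ := h
    obtain ⟨h5, h6⟩ := ih h4
    refine ⟨h2.le.trans h5, fun R' hR' => ?_⟩
    rcases List.mem_cons.1 hR' with rfl | hR'
    · exact ⟨le_rfl, h2, h5⟩
    · obtain ⟨h7, h8, h9⟩ := h6 R' hR'
      exact ⟨h2.le.trans h7, h8, h9⟩

theorem Tiles.pairwise (h : Tiles a k l b k') : l.Pairwise fun R R' => R.b ≤ R'.a := by
  induction l generalizing a k with
  | nil => exact List.Pairwise.nil
  | cons R l ih =>
    obtain ⟨-, -, -, h4⟩ := h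
    exact List.pairwise_cons.2 ⟨fun R' hR' => (h4.bounds.2 R' hR').1, ih h4⟩

theorem Tiles.exists_mem_Icc (h : Tiles a k l b k') {z : ℝ} (hz : z ∈ Ico a b) :
    ∃ R ∈ l, z ∈ Icc R.a R.b := by
  induction l generalizing a k with
  | nil => exact absurd (hz.1.trans_lt hz.2) (by simp [h.1])
  | cons R l ih =>
    obtain ⟨rfl, -, -, h4⟩ := h
    rcases lt_or_ge z R.b with h5 | h5
    · exact ⟨R, List.mem_cons_self, hz.1, h5.le⟩
    · obtain ⟨R', hR', h6⟩ := ih h4 ⟨h5, hz.2⟩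
      exact ⟨R', List.mem_cons_of_mem _ hR', h6⟩

theorem Tiles.exists_eq_left (h : Tiles a k l b k') (hl : l ≠ []) : ∃ R ∈ l, R.a = a := by
  cases l with
  | nil => exact absurd rfl hl
  | cons R l => exact ⟨R, List.mem_cons_self, h.1⟩

theorem Tiles.exists_eq_right (h : Tiles a k l b k') (hl : l ≠ []) : ∃ R ∈ l, R.b = b := by
  induction l generalizing a k with
  | nil => exact absurd rfl hl
  | cons R l ih =>
    obtain ⟨-, -, -, h4⟩ := h
    by_cases hl' : l = []
    · subst hl'
      exact ⟨R, List.mem_cons_self, h4.1⟩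
    · obtain ⟨R', hR', h5⟩ := ih h4 hl'
      exact ⟨R', List.mem_cons_of_mem _ hR', h5⟩

theorem Tiles.exists_next (h : Tiles a k l b k') {R : Rod} (hR : R ∈ l) :
    R.b = b ∨ ∃ R' ∈ l, R'.a = R.b := by
  induction l generalizing a k with
  | nil => simp at hR
  | cons R₁ l ih =>
    obtain ⟨-, -, -, h4⟩ := h
    rcases List.mem_cons.1 hR with rfl | hR
    · by_cases hl : l = []
      · subst hl
        exact Or.inl h4.1
      · obtain ⟨R', hR', h5⟩ := h4.exists_eq_left hl
        exact Or.inr ⟨R', List.mem_cons_of_mem _ hR', h5⟩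
    · exact (ih h4 hR).imp_right fun ⟨R', hR', h5⟩ => ⟨R', List.mem_cons_of_mem _ hR', h5⟩

theorem Tiles.exists_prev (h : Tiles a k l b k') {R : Rod} (hR : R ∈ l) :
    R.a = a ∨ ∃ R' ∈ l, R'.b = R.a := by
  induction l generalizing a k with
  | nil => simp at hR
  | cons R₁ l ih =>
    obtain ⟨h1, -, -, h4⟩ := h
    rcases List.mem_cons.1 hR with rfl | hR
    · exact Or.inl h1
    · rcases ih h4 hR with h5 | ⟨R', hR', h5⟩
      · exact Or.inr ⟨R₁, List.mem_cons_self, h5.symm⟩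
      · exact Or.inr ⟨R', List.mem_cons_of_mem _ hR', h5⟩

theorem Tiles.kind_ne_of_eq_left (h : Tiles a k l b k') {R : Rod} (hR : R ∈ l) (ha : R.a = a) :
    k ≠ R.kind := by
  cases l with
  | nil => simp at hR
  | cons R₁ l =>
    obtain ⟨h1, h2, h3, h4⟩ := h
    rcases List.mem_cons.1 hR with rfl | hR
    · exact h3
    · linarith [(h4.bounds.2 R hR).1]

theorem Tiles.kind_eq_of_eq_right (h : Tiles a k l b k') {R : Rod} (hR : R ∈ l) (hb : R.b = b) :
    R.kind = k' := by
  induction l generalizing a k with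
  | nil => simp at hR
  | cons R₁ l ih =>
    obtain ⟨h1, h2, h3, h4⟩ := h
    rcases List.mem_cons.1 hR with rfl | hR
    · cases l with
      | nil => exact h4.2
      | cons R₂ l =>
        have := h4.bounds.2 R₂ List.mem_cons_self
        linarith
    · exact ih h4 hR

theorem Tiles.kind_ne (h : Tiles a k l b k') {R R' : Rod} (hR : R ∈ l) (hR' : R' ∈ l)
    (he : R.b = R'.a) : R.kind ≠ R'.kind := by
  induction l generalizing a k with
  | nil => simp at hR
  | cons R₁ l ih =>
    obtain ⟨h1, h2, h3, h4⟩ := h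
    rcases List.mem_cons.1 hR with rfl | hRl
    · rcases List.mem_cons.1 hR' with rfl | hRl'
      · exact absurd he h2.ne'
      · exact h4.kind_ne_of_eq_left hRl' he.symm
    · rcases List.mem_cons.1 hR' with rfl | hRl'
      · have := h4.bounds.2 R hRl
        linarith
      · exact ih h4 hRl hRl'

end Tiles

section PeriodicTiling

variable {D : RodDiagram} {a : ℝ} {k : RodKind}

theorem Tiles.period_pos (h : Tiles a k D.cell (a + D.period) k) (hl : D.cell ≠ []) :
    0 < D.period := by
  obtain ⟨R, hR, h1⟩ := h.exists_eq_left hl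
  have := h.bounds.2 R hR
  linarith

theorem int_lt_cases {P : ℝ} (hP : 0 < P) {j j' : ℤ} (h : j < j') : (j : ℝ) * P + P ≤ j' * P := by
  have h1 : (j : ℝ) + 1 ≤ j' := by exact_mod_cast h
  nlinarith

theorem Tiles.isSeparated (h : Tiles a k D.cell (a + D.period) k) (hl : D.cell ≠ []) :
    D.IsSeparated := by
  have hP := h.period_pos hl
  obtain ⟨-, hb⟩ := h.bounds
  refine ⟨hP, h.pairwise.imp_of_mem fun {R R'} hR hR' hle he => ?_, fun R hR => (hb R hR).2.1,
    fun R hR => ?_, fun R hR R' hR' j j' => ?_⟩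
  · subst he
    linarith [(hb R hR).2.1]
  · obtain ⟨h1, h2, h3⟩ := hb R hR
    by_contra hcon
    push Not at hcon
    -- A single rod would be its own neighbor.
    exact h.kind_ne_of_eq_left hR (by linarith) (h.kind_eq_of_eq_right hR (by linarith)).symm
  · have hbR := hb R hR
    have hbR' := hb R' hR'
    rcases lt_trichotomy j j' with hj | rfl | hj
    · have := int_lt_cases hP hj
      exact Or.inr (Or.inl (by linarith))
    · have hsym : ∀ x ∈ D.cell, ∀ y ∈ D.cell, x = y ∨ x.b ≤ y.a ∨ y.b ≤ x.a := by
        have : Std.Symm (fun x y : Rod => x = y ∨ x.b ≤ y.a ∨ y.b ≤ x.a) := ⟨by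
          rintro x y (rfl | h | h)
          · exact Or.inl rfl
          · exact Or.inr (Or.inr h)
          · exact Or.inr (Or.inl h)⟩
        refine fun x hx y hy => List.Pairwise.forall_of_forall
          (R := fun x y : Rod => x = y ∨ x.b ≤ y.a ∨ y.b ≤ x.a) ?_ ?_ hx hy
        · exact fun x _ => Or.inl rfl
        · exact h.pairwise.imp fun h => Or.inr (Or.inl h)
      rcases hsym R hR R' hR' with he | he | he
      · exact Or.inl ⟨he, rfl⟩
      · exact Or.inr (Or.inl (by linarith))
      · exact Or.inr (Or.inr (by linarith))
    · have := int_lt_cases hP hj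
      exact Or.inr (Or.inr (by linarith))

theorem Tiles.exists_rod_mem_Icc (h : Tiles a k D.cell (a + D.period) k) (hl : D.cell ≠ [])
    (z : ℝ) : ∃ R ∈ D.rods, z ∈ Icc R.a R.b := by
  have hP := h.period_pos hl
  obtain ⟨j, hj, -⟩ := existsUnique_sub_zsmul_mem_Ico hP z a
  obtain ⟨R, hR, h1⟩ := h.exists_mem_Icc hj
  rw [zsmul_eq_mul] at h1
  refine ⟨_, ⟨R, hR, j, rfl⟩, ?_⟩
  simp only [Rod.shift]
  constructor <;> linarith [h1.1, h1.2]

theorem Tiles.exists_rod_neighbors (h : Tiles a k D.cell (a + D.period) k) (hl : D.cell ≠ [])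
    {R : Rod} (hR : R ∈ D.rods) :
    (∃ R' ∈ D.rods, R'.a = R.b) ∧ (∃ R' ∈ D.rods, R'.b = R.a) := by
  obtain ⟨R₀, hR₀, j, rfl⟩ := hR
  constructor
  · rcases h.exists_next hR₀ with h1 | ⟨R', hR', h1⟩
    · obtain ⟨R', hR', h2⟩ := h.exists_eq_left hl
      refine ⟨_, ⟨R', hR', j + 1, rfl⟩, ?_⟩
      simp only [Rod.shift, h1, h2]
      push_cast
      ring
    · exact ⟨_, ⟨R', hR', j, rfl⟩, by simp only [Rod.shift, h1]⟩
  · rcases h.exists_prev hR₀ with h1 | ⟨R', hR', h1⟩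
    · obtain ⟨R', hR', h2⟩ := h.exists_eq_right hl
      refine ⟨_, ⟨R', hR', j - 1, rfl⟩, ?_⟩
      simp only [Rod.shift, h1, h2]
      push_cast
      ring
    · exact ⟨_, ⟨R', hR', j, rfl⟩, by simp only [Rod.shift, h1]⟩

theorem Tiles.rod_kind_ne (h : Tiles a k D.cell (a + D.period) k) (hl : D.cell ≠ []) {R R' : Rod}
    (hR : R ∈ D.rods) (hR' : R' ∈ D.rods) (he : R.b = R'.a) : R.kind ≠ R'.kind := by
  have hP := h.period_pos hl
  obtain ⟨R₀, hR₀, j, rfl⟩ := hR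
  obtain ⟨R₀', hR₀', j', rfl⟩ := hR'
  obtain ⟨-, hb⟩ := h.bounds
  have h1 := hb R₀ hR₀
  have h2 := hb R₀' hR₀'
  simp only [Rod.shift] at he ⊢
  rcases lt_trichotomy j j' with hj | rfl | hj
  · have h3 := int_lt_cases hP hj
    rw [h.kind_eq_of_eq_right hR₀ (by linarith)]
    exact h.kind_ne_of_eq_left hR₀' (by linarith)
  · exact h.kind_ne hR₀ hR₀' (by linarith)
  · have h3 := int_lt_cases hP hj
    linarith

end PeriodicTiling

section Families

variable {L m : ℝ}

theorem Family.exists_tiles (e : Family) (hm : 0 < m) (hmL : m < L) :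
    ∃ a k, Tiles a k (e.diagram L m).cell (a + (e.diagram L m).period) k := by
  cases e
  · refine ⟨-2 * L + m, .horizon, ?_⟩
    simp only [diagram, Tiles]
    refine ⟨?_, ?_, ?_, ?_, ?_, ?_, ?_, ?_⟩ <;> first | linarith | simp
  · refine ⟨0, .axis .psi, ?_⟩
    simp only [diagram, Tiles]
    refine ⟨?_, ?_, ?_, ?_, ?_, ?_, ?_, ?_⟩ <;> first | linarith | simp
  · refine ⟨-L, .axis .phi, ?_⟩
    simp only [diagram, Tiles]
    refine ⟨?_, ?_, ?_, ?_, ?_, ?_, ?_, ?_, ?_, ?_, ?_⟩ <;> first | linarith | simp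
  · refine ⟨-2 * L + m, .horizon, ?_⟩
    simp only [diagram, Tiles]
    refine ⟨?_, ?_, ?_, ?_, ?_, ?_, ?_, ?_, ?_, ?_, ?_, ?_, ?_, ?_⟩ <;> first | linarith | simp
  · refine ⟨-2 * L - m, .axis .phi, ?_⟩
    simp only [diagram, Tiles]
    refine ⟨?_, ?_, ?_, ?_, ?_, ?_, ?_, ?_, ?_, ?_, ?_, ?_, ?_, ?_, ?_, ?_, ?_, ?_, ?_, ?_⟩ <;>
      first | linarith | simp

theorem Family.cell_ne_nil (e : Family) : (e.diagram L m).cell ≠ [] := by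
  cases e <;> simp [diagram]

theorem periodicPotential_axisMap_neg (P c d h : ℝ) (x : ℝ × ℝ) :
    periodicPotential P c d ∅ (axisMap (-1) h x) = periodicPotential P (h - d) (h - c) ∅ x := by
  rw [axisMap, neg_one_mul, add_comm, periodicPotential_translate, periodicPotential_reflect,
    neg_sub, neg_sub]

/-- The reflection maps the rod of kind `φ` of the black rings to itself; it exchanges the two
kinds for solitons, spheres and double spheres; for black Saturns it exchanges the two rods of kind
`ψ` and maps the rod of kind `φ` to a translate of itself. -/
theorem Family.exists_isReflective (e : Family) (hm : 0 < m) (hmL : m < L) :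
    ∃ h, (e.diagram L m).IsReflective h ∧
      ∀ R ∈ (e.diagram L m).cell, ∀ R' ∈ (e.diagram L m).cell, ∀ i, R.kind = .axis i →
        R'.kind = .axis i → R = R' ∨ (∀ x : ℝ × ℝ, ∀ i,
          diagramPotential (e.diagram L m) i (axisMap (-1) h x) =
            diagramPotential (e.diagram L m) i x) ∧ R'.a = h - R.b ∧ R'.b = h - R.a := by
  have hpot : ∀ {P c d c' d' : ℝ}, ∀ x, c' = c → d' = d →
      periodicPotential P c' d' ∅ x = periodicPotential P c d ∅ x := by
    rintro P c d c' d' x rfl rfl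
    rfl
  cases e
  · refine ⟨-2 * L, Or.inl fun x i => ?_, ?_⟩
    · cases i
      · simp only [diagram, diagramPotential, List.map_cons, List.map_nil, List.sum_cons,
          List.sum_nil, if_true, reduceCtorEq, if_false, periodicPotential_axisMap_neg]
        congr 1
        exact hpot _ (by ring) (by ring)
      · simp [diagram, diagramPotential]
    · intro R hR R' hR' i hi hi'
      simp only [diagram, List.mem_cons, List.not_mem_nil, or_false] at hR hR'
      rcases hR with rfl | rfl <;> rcases hR' with rfl | rfl <;>
        cases i <;> simp_all
  · refine ⟨2 * L, Or.inr fun x => ?_, ?_⟩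
    · simp only [diagram, diagramPotential, List.map_cons, List.map_nil, List.sum_cons,
          List.sum_nil, if_true, reduceCtorEq, if_false, periodicPotential_axisMap_neg,
          RodKind.axis.injEq, add_zero, zero_add]
      exact ⟨hpot _ (by ring) (by ring), hpot _ (by ring) (by ring)⟩
    · intro R hR R' hR' i hi hi'
      simp only [diagram, List.mem_cons, List.not_mem_nil, or_false] at hR hR'
      rcases hR with rfl | rfl <;> rcases hR' with rfl | rfl <;>
        cases i <;> simp_all
  · refine ⟨0, Or.inr fun x => ?_, ?_⟩
    · simp only [diagram, diagramPotential, List.map_cons, List.map_nil, List.sum_cons,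
          List.sum_nil, if_true, reduceCtorEq, if_false, periodicPotential_axisMap_neg,
          RodKind.axis.injEq, add_zero, zero_add]
      exact ⟨hpot _ (by ring) (by ring), hpot _ (by ring) (by ring)⟩
    · intro R hR R' hR' i hi hi'
      simp only [diagram, List.mem_cons, List.not_mem_nil, or_false] at hR hR'
      rcases hR with rfl | rfl | rfl <;> rcases hR' with rfl | rfl | rfl <;>
        cases i <;> simp_all
  · refine ⟨0, Or.inr fun x => ?_, ?_⟩
    · simp only [diagram, diagramPotential, List.map_cons, List.map_nil, List.sum_cons,
          List.sum_nil, if_true, reduceCtorEq, if_false, periodicPotential_axisMap_neg,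
          RodKind.axis.injEq, add_zero, zero_add]
      exact ⟨hpot _ (by ring) (by ring), hpot _ (by ring) (by ring)⟩
    · intro R hR R' hR' i hi hi'
      simp only [diagram, List.mem_cons, List.not_mem_nil, or_false] at hR hR'
      rcases hR with rfl | rfl | rfl | rfl <;> rcases hR' with rfl | rfl | rfl | rfl <;>
        cases i <;> simp_all
  · have hrefl : ∀ x : ℝ × ℝ, ∀ i, diagramPotential (diagram L m .blackSaturns) i
        (axisMap (-1) 0 x) = diagramPotential (diagram L m .blackSaturns) i x := by
      intro x i
      cases i
      · simp only [diagram, diagramPotential, List.map_cons, List.map_nil, List.sum_cons,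
          List.sum_nil, if_true, reduceCtorEq, if_false, periodicPotential_axisMap_neg,
          RodKind.axis.injEq, add_zero, zero_add]
        rw [← periodicPotential_add_period (by linarith) (by linarith)]
        exact hpot _ (by ring) (by ring)
      · simp only [diagram, diagramPotential, List.map_cons, List.map_nil, List.sum_cons,
          List.sum_nil, if_true, reduceCtorEq, if_false, periodicPotential_axisMap_neg,
          RodKind.axis.injEq, add_zero, zero_add]
        rw [add_comm]
        congr 1 <;> exact hpot _ (by ring) (by ring)
    refine ⟨0, Or.inl hrefl, ?_⟩
    intro R hR R' hR' i hi hi'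
    by_cases he : R = R'
    · exact Or.inl he
    · refine Or.inr ⟨hrefl, ?_⟩
      simp only [diagram, List.mem_cons, List.not_mem_nil, or_false] at hR hR'
      rcases hR with rfl | rfl | rfl | rfl | rfl | rfl <;>
        rcases hR' with rfl | rfl | rfl | rfl | rfl | rfl <;>
        cases i <;> simp_all <;> ring

theorem Family.exists_isBalancedSolution (e : Family) (hm : 0 < m) (hmL : m < L) :
    ∃ u v α, IsBalancedSolution (e.diagram L m) u v α := by
  obtain ⟨a, k, h⟩ := e.exists_tiles hm hmL
  obtain ⟨c, h1, h2⟩ := e.exists_isReflective hm hmL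
  exact StaticWeyl.exists_isBalancedSolution (h.isSeparated e.cell_ne_nil) h1 h2

end Families

/-! ### Metrics as quadratic forms -/

/-- The quadratic form of a matrix. Symmetric matrices, and hence pulled back metrics, are compared
by means of their quadratic forms. -/
def quad (M : Matrix (Fin 5) (Fin 5) ℝ) (w : E) : ℝ := w ⬝ᵥ M *ᵥ w

theorem eq_of_quad_eq {M N : Matrix (Fin 5) (Fin 5) ℝ} (hM : M.IsSymm) (hN : N.IsSymm)
    (h : ∀ w, quad M w = quad N w) : M = N := by
  have hb : ∀ (M : Matrix (Fin 5) (Fin 5) ℝ) (i j : Fin 5), quad M (Pi.single i 1 + Pi.single j 1) =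
      quad M (Pi.single i 1) + quad M (Pi.single j 1) + M i j + M j i := by
    intro M i j
    simp only [quad, Matrix.mulVec_add, add_dotProduct, dotProduct_add, Matrix.mulVec_single_one,
      single_dotProduct, one_mul, Matrix.col_apply]
    ring
  ext i j
  have h1 := h (Pi.single i 1 + Pi.single j 1)
  rw [hb, hb, h, h, hM.apply i j, hN.apply i j] at h1
  linarith

theorem quad_pullback (F : E → E) (G : MetricField) (q w : E) :
    quad (pullback F G q) w = quad (G (F q)) (fderiv ℝ F q w) := by
  have h1 : jacobian F q *ᵥ w = fderiv ℝ F q w := by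
    rw [jacobian, LinearMap.toMatrix'_mulVec]
    rfl
  rw [quad, quad, pullback, ← Matrix.mulVec_mulVec, ← Matrix.mulVec_mulVec,
    Matrix.dotProduct_mulVec, ← Matrix.mulVec_transpose, Matrix.transpose_transpose, h1]

theorem pullback_isSymm {F : E → E} {G : MetricField} {q : E} (h : (G (F q)).IsSymm) :
    (pullback F G q).IsSymm := by
  rw [Matrix.IsSymm, pullback, Matrix.transpose_mul, Matrix.transpose_mul,
    Matrix.transpose_transpose, h.eq, Matrix.mul_assoc]

theorem pullback_eq {A B : E → E} {g G : MetricField} {q : E} (hg : (g (A q)).IsSymm)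
    (hG : (G (B q)).IsSymm)
    (h : ∀ w, quad (g (A q)) (fderiv ℝ A q w) = quad (G (B q)) (fderiv ℝ B q w)) :
    pullback A g q = pullback B G q :=
  eq_of_quad_eq (pullback_isSymm hg) (pullback_isSymm hG) fun w => by
    rw [quad_pullback, quad_pullback, h]

/-- The symmetric tridiagonal matrix with diagonal `a` and off-diagonal `b`. In all the charts the
extended metric is of this form. -/
def tridiag (a : Fin 5 → ℝ) (b : Fin 4 → ℝ) : Matrix (Fin 5) (Fin 5) ℝ :=
  !![a 0, b 0, 0, 0, 0; b 0, a 1, b 1, 0, 0; 0, b 1, a 2, b 2, 0; 0, 0, b 2, a 3, b 3;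
    0, 0, 0, b 3, a 4]

theorem tridiag_isSymm (a : Fin 5 → ℝ) (b : Fin 4 → ℝ) : (tridiag a b).IsSymm := by
  ext i j
  fin_cases i <;> fin_cases j <;> rfl

theorem quad_tridiag (a : Fin 5 → ℝ) (b : Fin 4 → ℝ) (w : E) : quad (tridiag a b) w =
    a 0 * w 0 ^ 2 + 2 * b 0 * w 0 * w 1 + a 1 * w 1 ^ 2 + 2 * b 1 * w 1 * w 2 + a 2 * w 2 ^ 2 +
      2 * b 2 * w 2 * w 3 + a 3 * w 3 ^ 2 + 2 * b 3 * w 3 * w 4 + a 4 * w 4 ^ 2 := by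
  simp only [quad, tridiag, dotProduct, Matrix.mulVec, Fin.sum_univ_five, Matrix.of_apply,
    Matrix.cons_val]
  ring

theorem contDiffAt_tridiag {a₀ a₁ a₂ a₃ a₄ b₀ b₁ b₂ b₃ : E → ℝ} {p : E}
    (h0 : ContDiffAt ℝ ∞ a₀ p) (h1 : ContDiffAt ℝ ∞ a₁ p) (h2 : ContDiffAt ℝ ∞ a₂ p)
    (h3 : ContDiffAt ℝ ∞ a₃ p) (h4 : ContDiffAt ℝ ∞ a₄ p) (k0 : ContDiffAt ℝ ∞ b₀ p)
    (k1 : ContDiffAt ℝ ∞ b₁ p) (k2 : ContDiffAt ℝ ∞ b₂ p) (k3 : ContDiffAt ℝ ∞ b₃ p) (i j : Fin 5) :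
    ContDiffAt ℝ ∞ (fun p => tridiag ![a₀ p, a₁ p, a₂ p, a₃ p, a₄ p] ![b₀ p, b₁ p, b₂ p, b₃ p] i j)
      p := by
  fin_cases i <;> fin_cases j <;> first | exact contDiffAt_const (c := (0 : ℝ)) | assumption

/-- A quadratic form which is `-ℓ₀² + ℓ₁² + ℓ₂² + ℓ₃² + ℓ₄²` in linearly independent linear forms
has Lorentzian signature. -/
theorem exists_signature {G M : Matrix (Fin 5) (Fin 5) ℝ} {l : E → E} (hG : G.IsSymm)
    (hl : ∀ w, M *ᵥ w = l w) (hM : ∀ w, l w = 0 → w = 0)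
    (h : ∀ w, quad G w = -l w 0 ^ 2 + l w 1 ^ 2 + l w 2 ^ 2 + l w 3 ^ 2 + l w 4 ^ 2) :
    ∃ P : Matrix (Fin 5) (Fin 5) ℝ, IsUnit P.det ∧
      Pᵀ * G * P = Matrix.diagonal ![-1, 1, 1, 1, 1] := by
  have hu : IsUnit M := Matrix.mulVec_injective_iff_isUnit.1
    ((injective_iff_map_eq_zero M.mulVecLin).2 fun w hw => hM w ((hl w).symm.trans hw))
  have hdet : IsUnit M.det := (Matrix.isUnit_iff_isUnit_det M).1 hu
  refine ⟨M⁻¹, Matrix.isUnit_nonsing_inv_det M hdet, ?_⟩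
  refine eq_of_quad_eq ?_ (Matrix.diagonal_transpose _) fun w => ?_
  · rw [Matrix.IsSymm, Matrix.transpose_mul, Matrix.transpose_mul, Matrix.transpose_transpose,
      hG.eq, Matrix.mul_assoc]
  · have h1 : quad (M⁻¹ᵀ * G * M⁻¹) w = quad G (M⁻¹ *ᵥ w) := by
      rw [quad, quad, ← Matrix.mulVec_mulVec, ← Matrix.mulVec_mulVec, Matrix.dotProduct_mulVec,
        ← Matrix.mulVec_transpose, Matrix.transpose_transpose]
    rw [h1, h, ← hl, Matrix.mulVec_mulVec, Matrix.mul_nonsing_inv _ hdet, Matrix.one_mulVec]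
    simp only [quad, Matrix.mulVec_diagonal, dotProduct, Fin.sum_univ_five, Matrix.cons_val]
    ring

/-- A positive definite block is a sum of two squares. -/
theorem posDef_block {a b d : ℝ} (ha : 0 < a) (h : 0 < a * d - b ^ 2) (x y : ℝ) :
    a * x ^ 2 + 2 * b * x * y + d * y ^ 2 =
      (√a * x + b / √a * y) ^ 2 + (√((a * d - b ^ 2) / a) * y) ^ 2 := by
  have h1 := Real.sqrt_pos.2 ha
  have h2 : √a ^ 2 = a := Real.sq_sqrt ha.le
  have h3 : √((a * d - b ^ 2) / a) ^ 2 = (a * d - b ^ 2) / a := Real.sq_sqrt (by positivity)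
  have h4 : (b / √a) ^ 2 = b ^ 2 / a := by rw [div_pow, h2]
  have h5 : √a * (b / √a) = b := by field_simp
  have h6 : b ^ 2 / a + (a * d - b ^ 2) / a = d := by
    field_simp
    ring
  linear_combination (-x ^ 2) * h2 - y ^ 2 * h3 - y ^ 2 * h4 - 2 * x * y * h5 - y ^ 2 * h6

/-- A negative time entry and two positive definite blocks, in the coordinates `1, 2` and `3, 4`. -/
theorem signature_time_block {a : Fin 5 → ℝ} {b : Fin 4 → ℝ} (h0 : a 0 < 0) (hb0 : b 0 = 0)
    (hb2 : b 2 = 0) (h1 : 0 < a 1) (h12 : 0 < a 1 * a 2 - b 1 ^ 2) (h3 : 0 < a 3)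
    (h34 : 0 < a 3 * a 4 - b 3 ^ 2) : ∃ P : Matrix (Fin 5) (Fin 5) ℝ, IsUnit P.det ∧
      Pᵀ * tridiag a b * P = Matrix.diagonal ![-1, 1, 1, 1, 1] := by
  have e0 : 0 < √(-a 0) := Real.sqrt_pos.2 (by linarith)
  have e1 : 0 < √(a 1) := Real.sqrt_pos.2 h1
  have e2 : 0 < √((a 1 * a 2 - b 1 ^ 2) / a 1) := Real.sqrt_pos.2 (by positivity)
  have e3 : 0 < √(a 3) := Real.sqrt_pos.2 h3
  have e4 : 0 < √((a 3 * a 4 - b 3 ^ 2) / a 3) := Real.sqrt_pos.2 (by positivity)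
  have key : ∀ w : E, (!![√(-a 0), 0, 0, 0, 0; 0, √(a 1), b 1 / √(a 1), 0, 0;
      0, 0, √((a 1 * a 2 - b 1 ^ 2) / a 1), 0, 0; 0, 0, 0, √(a 3), b 3 / √(a 3);
      0, 0, 0, 0, √((a 3 * a 4 - b 3 ^ 2) / a 3)] : Matrix (Fin 5) (Fin 5) ℝ) *ᵥ w =
      ![√(-a 0) * w 0, √(a 1) * w 1 + b 1 / √(a 1) * w 2, √((a 1 * a 2 - b 1 ^ 2) / a 1) * w 2,
        √(a 3) * w 3 + b 3 / √(a 3) * w 4, √((a 3 * a 4 - b 3 ^ 2) / a 3) * w 4] := by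
    intro w
    ext i
    fin_cases i <;> simp [Matrix.mulVec, dotProduct, Fin.sum_univ_five]
  refine exists_signature (tridiag_isSymm a b) key (fun w hw => ?_) fun w => ?_
  · have q0 := congrFun hw 0
    have q1 := congrFun hw 1
    have q2 := congrFun hw 2
    have q3 := congrFun hw 3
    have q4 := congrFun hw 4
    simp only [Matrix.cons_val, Pi.zero_apply, mul_eq_zero, e0.ne', e2.ne', e4.ne',
      false_or] at q0 q2 q4
    simp only [Matrix.cons_val, Pi.zero_apply, q2, q4, mul_zero, add_zero, mul_eq_zero, e1.ne',
      e3.ne', false_or] at q1 q3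
    ext i
    fin_cases i <;> assumption
  · rw [quad_tridiag]
    simp only [Matrix.cons_val]
    have f1 := posDef_block h1 h12 (w 1) (w 2)
    have f3 := posDef_block h3 h34 (w 3) (w 4)
    have f0 : √(-a 0) ^ 2 = -a 0 := Real.sq_sqrt (by linarith)
    rw [hb0, hb2]
    linear_combination f1 + f3 + w 0 ^ 2 * f0

/-- An indefinite block in the coordinates `0, 1`, whose diagonal may vanish, a positive definite
block in the coordinates `2, 3` and a positive entry. The discriminant of the indefinite block
factors it into two linear forms, and thus splits it into the difference of two squares. -/
theorem signature_null_block {a : Fin 5 → ℝ} {b : Fin 4 → ℝ} (h0 : 0 < b 0)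
    (h01 : 0 < b 0 ^ 2 - a 0 * a 1) (hb1 : b 1 = 0) (hb3 : b 3 = 0) (h2 : 0 < a 2)
    (h23 : 0 < a 2 * a 3 - b 2 ^ 2) (h4 : 0 < a 4) : ∃ P : Matrix (Fin 5) (Fin 5) ℝ, IsUnit P.det ∧
      Pᵀ * tridiag a b * P = Matrix.diagonal ![-1, 1, 1, 1, 1] := by
  obtain ⟨r, hr, hr2⟩ : ∃ r, 0 < r ∧ r ^ 2 = b 0 ^ 2 - a 0 * a 1 :=
    ⟨√(b 0 ^ 2 - a 0 * a 1), Real.sqrt_pos.2 h01, Real.sq_sqrt h01.le⟩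
  obtain ⟨β, hβ⟩ : ∃ β, β = b 0 + r := ⟨_, rfl⟩
  have hβ0 : 0 < β := by linarith
  -- With this choice of `β` the indefinite block is a multiple of `(a₀ w₀ + β w₁) (β w₀ + a₁ w₁)`.
  have hroot : β ^ 2 + a 0 * a 1 = 2 * b 0 * β := by
    rw [hβ]
    linear_combination hr2
  obtain ⟨k, hk, hk2⟩ : ∃ k, 0 < k ∧ 4 * β * k ^ 2 = 1 := by
    refine ⟨1 / (2 * √β), by positivity, ?_⟩
    have := Real.sq_sqrt hβ0.le
    field_simp
    linarith
  have e2 : 0 < √(a 2) := Real.sqrt_pos.2 h2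
  have e3 : 0 < √((a 2 * a 3 - b 2 ^ 2) / a 2) := Real.sqrt_pos.2 (by positivity)
  have e4 : 0 < √(a 4) := Real.sqrt_pos.2 h4
  have key : ∀ w : E, (!![k * (a 0 - β), k * (β - a 1), 0, 0, 0; k * (a 0 + β), k * (β + a 1), 0, 0,
      0; 0, 0, √(a 2), b 2 / √(a 2), 0; 0, 0, 0, √((a 2 * a 3 - b 2 ^ 2) / a 2), 0;
      0, 0, 0, 0, √(a 4)] : Matrix (Fin 5) (Fin 5) ℝ) *ᵥ w =
      ![k * (a 0 - β) * w 0 + k * (β - a 1) * w 1, k * (a 0 + β) * w 0 + k * (β + a 1) * w 1,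
        √(a 2) * w 2 + b 2 / √(a 2) * w 3, √((a 2 * a 3 - b 2 ^ 2) / a 2) * w 3,
        √(a 4) * w 4] := by
    intro w
    ext i
    fin_cases i <;> simp [Matrix.mulVec, dotProduct, Fin.sum_univ_five]
  refine exists_signature (tridiag_isSymm a b) key (fun w hw => ?_) fun w => ?_
  · have q0 := congrFun hw 0
    have q1 := congrFun hw 1
    have q2 := congrFun hw 2
    have q3 := congrFun hw 3
    have q4 := congrFun hw 4
    simp only [Matrix.cons_val, Pi.zero_apply, mul_eq_zero, e3.ne', e4.ne', false_or] at q3 q4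
    simp only [Matrix.cons_val, Pi.zero_apply, q3, mul_zero, add_zero, mul_eq_zero, e2.ne',
      false_or] at q2
    simp only [Matrix.cons_val, Pi.zero_apply] at q0 q1
    have l1 : a 0 * w 0 + β * w 1 = 0 := by
      have : 2 * k * (a 0 * w 0 + β * w 1) = 0 := by linear_combination q0 + q1
      simpa [hk.ne'] using this
    have l2 : β * w 0 + a 1 * w 1 = 0 := by
      have : 2 * k * (β * w 0 + a 1 * w 1) = 0 := by linear_combination q1 - q0
      simpa [hk.ne'] using this
    have hd : β ^ 2 - a 0 * a 1 ≠ 0 := by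
      have : β ^ 2 - a 0 * a 1 = 2 * r * β := by
        rw [hβ] at hroot ⊢
        linear_combination -hr2
      rw [this]
      positivity
    have q0 : w 0 = 0 := by
      have : (β ^ 2 - a 0 * a 1) * w 0 = 0 := by linear_combination β * l2 - a 1 * l1
      simpa [hd] using this
    have q1 : w 1 = 0 := by
      have : (β ^ 2 - a 0 * a 1) * w 1 = 0 := by linear_combination β * l1 - a 0 * l2
      simpa [hd] using this
    ext i
    fin_cases i <;> assumption
  · rw [quad_tridiag]
    simp only [Matrix.cons_val]
    have f2 := posDef_block h2 h23 (w 2) (w 3)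
    have f4 : √(a 4) ^ 2 = a 4 := Real.sq_sqrt h4.le
    rw [hb1, hb3]
    have f0 : a 0 * w 0 ^ 2 + 2 * b 0 * w 0 * w 1 + a 1 * w 1 ^ 2 =
        4 * k ^ 2 * (a 0 * w 0 + β * w 1) * (β * w 0 + a 1 * w 1) := by
      linear_combination (-(a 0 * w 0 ^ 2 + 2 * b 0 * w 0 * w 1 + a 1 * w 1 ^ 2)) * hk2 -
        4 * k ^ 2 * w 0 * w 1 * hroot
    linear_combination f0 + f2 - w 4 ^ 2 * f4

theorem quad_weylMetric (u v α : ℝ → ℝ → ℝ) (q w : E) : quad (weylMetric u v α q) w =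
    -(Real.exp (-u (q 1) (q 2) - v (q 1) (q 2)) * q 1 ^ 2) * w 0 ^ 2 +
      Real.exp (2 * α (q 1) (q 2)) * (w 1 ^ 2 + w 2 ^ 2) + Real.exp (u (q 1) (q 2)) * w 3 ^ 2 +
      Real.exp (v (q 1) (q 2)) * w 4 ^ 2 := by
  simp only [quad, weylMetric, Matrix.mulVec_diagonal, dotProduct, Fin.sum_univ_five,
    Matrix.cons_val]
  ring

theorem weylMetric_isSymm (u v α : ℝ → ℝ → ℝ) (q : E) : (weylMetric u v α q).IsSymm :=
  Matrix.diagonal_transpose _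

/-! ### Isometries and Killing fields -/

/-- The flow of the boost field, linear in the point. -/
noncomputable def boostFlow (c s : ℝ) : E → E := fun p =>
  ![Real.exp (c * s) * p 0, Real.exp (-(c * s)) * p 1, p 2, p 3, p 4]

theorem boost_single (c : ℝ) (i : Fin 5) :
    boost c (Pi.single i 1) = (![c, -c, 0, 0, 0] : E) i • Pi.single i 1 := by
  ext j
  fin_cases i <;> fin_cases j <;> simp [boost]

theorem fderiv_boost (c : ℝ) (p v : E) : fderiv ℝ (boost c) p v = boost c v := by
  have h : IsLinearMap ℝ (boost c) := by
    refine ⟨fun x y => ?_, fun r x => ?_⟩ <;> ext i <;> fin_cases i <;> simp [boost] <;> ring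
  exact congrFun (congrArg DFunLike.coe
    ((LinearMap.toContinuousLinearMap (IsLinearMap.mk' _ h)).hasFDerivAt (x := p)).fderiv) v

theorem hasDerivAt_boostFlow (c : ℝ) (p : E) :
    HasDerivAt (fun s => boostFlow c s p) (boost c p) 0 := by
  rw [hasDerivAt_pi]
  have h1 : HasDerivAt (fun s : ℝ => c * s) c 0 := by
    simpa using (hasDerivAt_id (0 : ℝ)).const_mul c
  intro i
  fin_cases i
  · simpa [boostFlow, boost] using h1.exp.mul_const (p 0)
  · simpa [boostFlow, boost] using h1.fun_neg.exp.mul_const (p 1)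
  · exact hasDerivAt_const _ _
  · exact hasDerivAt_const _ _
  · exact hasDerivAt_const _ _

/-- If the flow of the boost field is isometric, the boost field is a Killing field: the Killing
equation is the derivative of the isometry condition at `s = 0`. -/
theorem isKillingField_boost {G : MetricField} {W : Set E} {c : ℝ}
    (hd : ∀ p ∈ W, ∀ i j, DifferentiableAt ℝ (fun p => G p i j) p) (hs : ∀ p, (G p).IsSymm)
    (h : ∀ p, ∀ s : ℝ, ∀ w, quad (G (boostFlow c s p)) (boostFlow c s w) = quad (G p) w) :
    IsKillingField G W (boost c) := by
  intro p hp i j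
  set d : E := ![c, -c, 0, 0, 0] with hdd
  have hflow : ∀ s : ℝ, G (boostFlow c s p) i j = Real.exp (-(d i + d j) * s) * G p i j := by
    intro s
    set D : Matrix (Fin 5) (Fin 5) ℝ := Matrix.diagonal fun i => Real.exp (d i * s) with hD
    have hDw : ∀ w, D *ᵥ w = boostFlow c s w := by
      intro w
      ext k
      fin_cases k <;> simp [hD, boostFlow, Matrix.mulVec_diagonal, hdd]
    have h1 : D * G (boostFlow c s p) * D = G p := by
      refine eq_of_quad_eq ?_ (hs p) fun w => ?_
      · rw [Matrix.IsSymm, Matrix.transpose_mul, Matrix.transpose_mul, (hs _).eq,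
          Matrix.diagonal_transpose, Matrix.mul_assoc]
      · rw [← h p s w, quad, quad, ← Matrix.mulVec_mulVec, ← Matrix.mulVec_mulVec,
          Matrix.dotProduct_mulVec, ← Matrix.mulVec_transpose, Matrix.diagonal_transpose, hDw]
    have h2 := congrFun (congrFun h1 i) j
    rw [hD, Matrix.mul_diagonal, Matrix.diagonal_mul] at h2
    rw [← h2, show -(d i + d j) * s = -(d i * s) + -(d j * s) by ring, Real.exp_add, Real.exp_neg,
      Real.exp_neg]
    field_simp
  have h0 : boostFlow c 0 p = p := by
    ext k
    fin_cases k <;> simp [boostFlow]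
  have h1 : HasDerivAt (fun s => G (boostFlow c s p) i j)
      (fderiv ℝ (fun x => G x i j) p (boost c p)) 0 := by
    have h2 : HasFDerivAt (fun x => G x i j) (fderiv ℝ (fun x => G x i j) p) (boostFlow c 0 p) := by
      rw [h0]
      exact (hd p hp i j).hasFDerivAt
    exact h2.comp_hasDerivAt (0 : ℝ) (hasDerivAt_boostFlow c p)
  have h2 : HasDerivAt (fun s => G (boostFlow c s p) i j) (-(d i + d j) * G p i j) 0 := by
    simp only [hflow]
    have h3 : HasDerivAt (fun s : ℝ => -(d i + d j) * s) (-(d i + d j)) 0 := by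
      simpa using (hasDerivAt_id (0 : ℝ)).const_mul (-(d i + d j))
    simpa using h3.exp.mul_const (G p i j)
  rw [h1.unique h2]
  simp only [fderiv_boost, boost_single, ← hdd, Pi.smul_apply, smul_eq_mul, Pi.single_apply,
    mul_ite, mul_one, mul_zero, Finset.sum_add_distrib, Finset.sum_ite_eq', Finset.mem_univ,
    if_true]
  ring

/-! ### Derivatives of the charts -/

theorem fderiv_eq_of_components {F : E → E} {q w d : E}
    (hd : ∀ i, DifferentiableAt ℝ (fun q => F q i) q)
    (h : ∀ i, HasDerivAt (fun s : ℝ => F (q + s • w) i) (d i) 0) : fderiv ℝ F q w = d := by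
  have hF : DifferentiableAt ℝ F q := differentiableAt_pi.2 hd
  have h1 : HasDerivAt (fun s : ℝ => F (q + s • w)) d 0 := hasDerivAt_pi.2 h
  have h2 : HasLineDerivAt ℝ F d q w := h1
  exact hF.lineDeriv_eq_fderiv.symm.trans h2.lineDeriv

theorem hasDerivAt_line (q w : E) (i : Fin 5) :
    HasDerivAt (fun s : ℝ => (q + s • w) i) (w i) 0 := by
  simpa using ((hasDerivAt_id (0 : ℝ)).mul_const (w i)).const_add (q i)

theorem hasDerivAt_mul_cos (q w : E) (i j : Fin 5) :
    HasDerivAt (fun s : ℝ => (q + s • w) i * Real.cos ((q + s • w) j))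
      (Real.cos (q j) * w i - q i * Real.sin (q j) * w j) 0 := by
  refine ((hasDerivAt_line q w i).mul (hasDerivAt_line q w j).cos).congr_deriv ?_
  simp
  ring

theorem hasDerivAt_mul_sin (q w : E) (i j : Fin 5) :
    HasDerivAt (fun s : ℝ => (q + s • w) i * Real.sin ((q + s • w) j))
      (Real.sin (q j) * w i + q i * Real.cos (q j) * w j) 0 := by
  refine ((hasDerivAt_line q w i).mul (hasDerivAt_line q w j).sin).congr_deriv ?_
  simp
  ring

theorem hasDerivAt_mul_exp (c : ℝ) (q w : E) :
    HasDerivAt (fun s : ℝ => (q + s • w) 1 * Real.exp (c * (q + s • w) 0))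
      (Real.exp (c * q 0) * (w 1 + c * q 1 * w 0)) 0 := by
  refine ((hasDerivAt_line q w 1).mul ((hasDerivAt_line q w 0).const_mul c).exp).congr_deriv ?_
  simp
  ring

theorem hasDerivAt_mul_exp_neg (c : ℝ) (q w : E) :
    HasDerivAt (fun s : ℝ => (q + s • w) 1 * Real.exp (-(c * (q + s • w) 0)))
      (Real.exp (-(c * q 0)) * (w 1 - c * q 1 * w 0)) 0 := by
  refine ((hasDerivAt_line q w 1).mul
    ((hasDerivAt_line q w 0).const_mul c).fun_neg.exp).congr_deriv ?_
  simp
  ring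

/-- The coordinate number of an angle. -/
def Angle.index : Angle → Fin 5
  | .phi => 3
  | .psi => 4

/-- The other angle. -/
def Angle.other : Angle → Angle
  | .phi => .psi
  | .psi => .phi

theorem fderiv_axisChart (i : Angle) (q w : E) : fderiv ℝ (axisChart i) q w =
    ![w 0, Real.cos (q i.index) * w 1 - q 1 * Real.sin (q i.index) * w i.index,
      Real.sin (q i.index) * w 1 + q 1 * Real.cos (q i.index) * w i.index, w 2,
      w i.other.index] := by
  refine fderiv_eq_of_components (fun k => ?_) fun k => ?_
  · cases i <;> fin_cases k <;> simp only [axisChart, Fin.reduceFinMk, Fin.zero_eta, Fin.mk_one,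
      Matrix.cons_val] <;> fun_prop
  · cases i
    all_goals
      fin_cases k
      · exact hasDerivAt_line q w 0
      · exact hasDerivAt_mul_cos q w 1 _
      · exact hasDerivAt_mul_sin q w 1 _
      · exact hasDerivAt_line q w 2
      · exact hasDerivAt_line q w _

theorem fderiv_cornerChart (q w : E) : fderiv ℝ cornerChart q w =
    ![w 0, Real.cos (q 3) * w 2 - q 2 * Real.sin (q 3) * w 3,
      Real.sin (q 3) * w 2 + q 2 * Real.cos (q 3) * w 3,
      Real.cos (q 4) * w 1 - q 1 * Real.sin (q 4) * w 4,
      Real.sin (q 4) * w 1 + q 1 * Real.cos (q 4) * w 4] := by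
  refine fderiv_eq_of_components (fun k => ?_) fun k => ?_
  · fin_cases k <;> simp only [cornerChart, Fin.reduceFinMk, Fin.zero_eta, Fin.mk_one,
      Matrix.cons_val] <;> fun_prop
  · fin_cases k
    · exact hasDerivAt_line q w 0
    · exact hasDerivAt_mul_cos q w 2 3
    · exact hasDerivAt_mul_sin q w 2 3
    · exact hasDerivAt_mul_cos q w 1 4
    · exact hasDerivAt_mul_sin q w 1 4

theorem fderiv_horizonChart (c : ℝ) (q w : E) : fderiv ℝ (horizonChart c) q w =
    ![Real.exp (c * q 0) * (w 1 + c * q 1 * w 0), Real.exp (-(c * q 0)) * (w 1 - c * q 1 * w 0),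
      w 2, w 3, w 4] := by
  refine fderiv_eq_of_components (fun k => ?_) fun k => ?_
  · fin_cases k <;> simp only [horizonChart, Fin.reduceFinMk, Fin.zero_eta, Fin.mk_one,
      Matrix.cons_val] <;> fun_prop
  · fin_cases k
    · exact hasDerivAt_mul_exp c q w
    · exact hasDerivAt_mul_exp_neg c q w
    · exact hasDerivAt_line q w 2
    · exact hasDerivAt_line q w 3
    · exact hasDerivAt_line q w 4

theorem fderiv_poleChart (c : ℝ) (i : Angle) (q w : E) : fderiv ℝ (poleChart c i) q w =
    ![Real.exp (c * q 0) * (w 1 + c * q 1 * w 0), Real.exp (-(c * q 0)) * (w 1 - c * q 1 * w 0),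
      Real.cos (q i.index) * w 2 - q 2 * Real.sin (q i.index) * w i.index,
      Real.sin (q i.index) * w 2 + q 2 * Real.cos (q i.index) * w i.index, w i.other.index] := by
  refine fderiv_eq_of_components (fun k => ?_) fun k => ?_
  · cases i <;> fin_cases k <;> simp only [poleChart, Fin.reduceFinMk, Fin.zero_eta, Fin.mk_one,
      Matrix.cons_val] <;> fun_prop
  · cases i
    all_goals
      fin_cases k
      · exact hasDerivAt_mul_exp c q w
      · exact hasDerivAt_mul_exp_neg c q w
      · exact hasDerivAt_mul_cos q w 2 _
      · exact hasDerivAt_mul_sin q w 2 _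
      · exact hasDerivAt_line q w _

theorem fderiv_cornerWeyl (z₀ σ : ℝ) (q w : E) : fderiv ℝ (cornerWeyl z₀ σ) q w =
    ![w 0, q 2 * w 1 + q 1 * w 2, σ * (q 1 * w 1 - q 2 * w 2), w 3, w 4] := by
  refine fderiv_eq_of_components (fun k => ?_) fun k => ?_
  · fin_cases k <;> simp only [cornerWeyl, Fin.reduceFinMk, Fin.zero_eta, Fin.mk_one,
      Matrix.cons_val] <;> fun_prop
  · fin_cases k
    · exact hasDerivAt_line q w 0
    · refine ((hasDerivAt_line q w 1).mul (hasDerivAt_line q w 2)).congr_deriv ?_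
      simp
      ring
    · refine ((((((hasDerivAt_line q w 1).pow 2).sub
        ((hasDerivAt_line q w 2).pow 2)).const_mul σ).div_const 2).const_add z₀).congr_deriv ?_
      simp
      ring
    · exact hasDerivAt_line q w 3
    · exact hasDerivAt_line q w 4

theorem fderiv_poleWeyl (z₀ σ : ℝ) (q w : E) : fderiv ℝ (poleWeyl z₀ σ) q w =
    ![w 0, 2 * (q 2 * w 1 + q 1 * w 2), 2 * (σ * (q 1 * w 1 - q 2 * w 2)), w 3, w 4] := by
  refine fderiv_eq_of_components (fun k => ?_) fun k => ?_
  · fin_cases k <;> simp only [poleWeyl, Fin.reduceFinMk, Fin.zero_eta, Fin.mk_one,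
      Matrix.cons_val] <;> fun_prop
  · fin_cases k
    · exact hasDerivAt_line q w 0
    · refine (((hasDerivAt_line q w 1).const_mul 2).mul (hasDerivAt_line q w 2)).congr_deriv ?_
      simp
      ring
    · refine (((((hasDerivAt_line q w 1).pow 2).sub
        ((hasDerivAt_line q w 2).pow 2)).const_mul σ).const_add z₀).congr_deriv ?_
      simp
      ring
    · exact hasDerivAt_line q w 3
    · exact hasDerivAt_line q w 4

theorem timeIsBoost_horizonChart (c : ℝ) (W : Set E) : TimeIsBoost (horizonChart c) W c := by
  intro q _
  rw [fderiv_horizonChart]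
  ext k
  fin_cases k <;> simp [boost, horizonChart] <;> ring

theorem timeIsBoost_poleChart (c : ℝ) (i : Angle) (W : Set E) :
    TimeIsBoost (poleChart c i) W c := by
  intro q _
  rw [fderiv_poleChart]
  ext k
  cases i <;> fin_cases k <;> simp [boost, poleChart, Angle.index, Angle.other] <;> ring

/-! ### Extension across axis rods and horizon rods -/

section Extension

variable {u v α : ℝ → ℝ → ℝ}

/-- The metric with its fibers ordered as the angle `i` and the other angle, which treats both kinds
of axis rods at once. -/
theorem quad_weylMetric_fiber (u v α : ℝ → ℝ → ℝ) (i : Angle) (q w : E) :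
    quad (weylMetric u v α q) w =
    -(Real.exp (-fiber u v i (q 1) (q 2) - fiber u v i.other (q 1) (q 2)) * q 1 ^ 2) * w 0 ^ 2 +
      Real.exp (2 * α (q 1) (q 2)) * (w 1 ^ 2 + w 2 ^ 2) +
      Real.exp (fiber u v i (q 1) (q 2)) * w i.index ^ 2 +
      Real.exp (fiber u v i.other (q 1) (q 2)) * w i.other.index ^ 2 := by
  rw [quad_weylMetric]
  cases i
  · rfl
  · simp only [fiber, Angle.index, Angle.other]
    ring_nf

theorem isLorentzianOn_of_contDiffAt {G : MetricField} {W : Set E}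
    (h1 : ∀ p ∈ W, ∀ i j, ContDiffAt ℝ ∞ (fun p => G p i j) p) (h2 : ∀ p, (G p).IsSymm)
    (h3 : ∀ p ∈ W, ∃ P : Matrix (Fin 5) (Fin 5) ℝ, IsUnit P.det ∧
      Pᵀ * G p * P = Matrix.diagonal ![-1, 1, 1, 1, 1]) : IsLorentzianOn G W :=
  ⟨fun i j p hp => (h1 p hp i j).contDiffWithinAt, fun p _ => h2 p, h3⟩

theorem isLorentzianOn_weylMetric {U V A : ℝ × ℝ → ℝ}
    (hU : ∀ x : ℝ × ℝ, 0 < x.1 → ContDiffAt ℝ ∞ U x)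
    (hV : ∀ x : ℝ × ℝ, 0 < x.1 → ContDiffAt ℝ ∞ V x)
    (hA : ∀ x : ℝ × ℝ, 0 < x.1 → ContDiffAt ℝ ∞ A x)
    (h : ∀ ρ z, 0 < ρ → u ρ z = U (ρ ^ 2, z) ∧ v ρ z = V (ρ ^ 2, z) ∧ α ρ z = A (ρ ^ 2, z)) :
    IsLorentzianOn (weylMetric u v α) {q | 0 < q 1} := by
  have hW : IsOpen {q : E | 0 < q 1} := isOpen_lt (by fun_prop) (by fun_prop)
  have htri : ∀ q, weylMetric u v α q = tridiag ![
    -(Real.exp (-u (q 1) (q 2) - v (q 1) (q 2)) * q 1 ^ 2),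
    Real.exp (2 * α (q 1) (q 2)),
    Real.exp (2 * α (q 1) (q 2)),
    Real.exp (u (q 1) (q 2)),
    Real.exp (v (q 1) (q 2))] ![0, 0, 0, 0] := fun q => by
    refine eq_of_quad_eq (weylMetric_isSymm _ _ _ _) (tridiag_isSymm _ _) fun w => ?_
    rw [quad_weylMetric, quad_tridiag]
    simp only [Matrix.cons_val]
    ring
  refine isLorentzianOn_of_contDiffAt (fun q hq => ?_) (weylMetric_isSymm u v α) fun q hq => ?_
  · have hp : 0 < (q 1 ^ 2, q 2).1 := pow_pos hq 2
    have hc : ContDiffAt ℝ ∞ (fun q : E => (q 1 ^ 2, q 2)) q := by fun_prop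
    have c1 : ContDiffAt ℝ ∞ (fun q : E => u (q 1) (q 2)) q :=
      ((hU _ hp).comp q hc).congr_of_eventuallyEq
        (by filter_upwards [hW.mem_nhds hq] with p hp using (h _ _ hp).1)
    have c2 : ContDiffAt ℝ ∞ (fun q : E => v (q 1) (q 2)) q :=
      ((hV _ hp).comp q hc).congr_of_eventuallyEq
        (by filter_upwards [hW.mem_nhds hq] with p hp using (h _ _ hp).2.1)
    have c3 : ContDiffAt ℝ ∞ (fun q : E => α (q 1) (q 2)) q :=
      ((hA _ hp).comp q hc).congr_of_eventuallyEq
        (by filter_upwards [hW.mem_nhds hq] with p hp using (h _ _ hp).2.2)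
    have key : ∀ {F₁ F₂ F₃ : E → ℝ}, ContDiffAt ℝ ∞ F₁ q → ContDiffAt ℝ ∞ F₂ q →
        ContDiffAt ℝ ∞ F₃ q → ∀ i j, ContDiffAt ℝ ∞ (fun q : E => tridiag
          ![-(Real.exp (-F₁ q - F₂ q) * q 1 ^ 2), Real.exp (2 * F₃ q), Real.exp (2 * F₃ q),
            Real.exp (F₁ q), Real.exp (F₂ q)] ![0, 0, 0, 0] i j) q := by
      intro F₁ F₂ F₃ h1 h2 h3
      apply contDiffAt_tridiag <;> fun_prop
    simp only [htri]
    exact key c1 c2 c3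
  · rw [htri]
    have hq1 : 0 < q 1 := hq
    refine signature_time_block ?_ rfl rfl ?_ ?_ ?_ ?_ <;> simp only [Matrix.cons_val]
    · rw [neg_lt_zero]
      positivity
    all_goals
      ring_nf
      positivity

/-- Positivity of the block `e (dx² + dy²) + k (x dx + y dy)²`. -/
theorem radial_block_pos {e k x y : ℝ} (he : 0 < e) (h : 0 < e + k * (x ^ 2 + y ^ 2)) :
    0 < e + k * x ^ 2 ∧ 0 < (e + k * x ^ 2) * (e + k * y ^ 2) - (k * x * y) ^ 2 := by
  constructor
  · rcases le_or_gt 0 k with hk | hk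
    · positivity
    · nlinarith [mul_nonneg (neg_nonneg.2 hk.le) (sq_nonneg y)]
  · have := mul_pos he h
    linarith

/-- The differentials of polar coordinates: `dx² + dy² = dr² + r² dθ²` and `x dx + y dy = r dr`. -/
theorem radial_identities {C S : ℝ} (h : S ^ 2 + C ^ 2 = 1) (r a b : ℝ) :
    (C * a - r * S * b) ^ 2 + (S * a + r * C * b) ^ 2 = a ^ 2 + r ^ 2 * b ^ 2 ∧
    r * C * (C * a - r * S * b) + r * S * (S * a + r * C * b) = r * a ∧
    (r * C) ^ 2 + (r * S) ^ 2 = r ^ 2 := by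
  refine ⟨?_, ?_, ?_⟩
  · linear_combination (a ^ 2 + r ^ 2 * b ^ 2) * h
  · linear_combination (r * a) * h
  · linear_combination (r ^ 2) * h

/-- If the angle defect vanishes, the metric extends across an axis rod. The vanishing makes
`exp (2 α)` and `exp f` agree on the rod, so that `e^{2α} dρ² + e^u dφ²` becomes
`e^f (dx² + dy²) + κ (x dx + y dy)²` with a smooth function `κ`. -/
theorem extendsAcrossAxis {i : Angle} {a b z₀ : ℝ} {f g A : ℝ × ℝ → ℝ} (hz₀ : z₀ ∈ Ioo a b)
    (hf : ∀ x ∈ rodDomain a b, ContDiffAt ℝ ∞ f x) (hg : ∀ x ∈ rodDomain a b, ContDiffAt ℝ ∞ g x)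
    (hA : ∀ x ∈ rodDomain a b, ContDiffAt ℝ ∞ A x)
    (h : ∀ ρ z, 0 < ρ → z ∈ Ioo a b →
      fiber u v i ρ z = Real.log (ρ ^ 2) + f (ρ ^ 2, z) ∧
      fiber u v i.other ρ z = g (ρ ^ 2, z) ∧ α ρ z = A (ρ ^ 2, z))
    (hb : ∀ z ∈ Ioo a b, 2 * A (0, z) = f (0, z)) :
    ExtendsAcrossAxis (weylMetric u v α) i z₀ := by
  obtain ⟨κ, hκ, hκ'⟩ := exists_hadamard_fst (isOpen_rodDomain a b)
    (Ψ := fun x => Real.exp (2 * A x) - Real.exp (f x)) (fun x hx t ht => by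
      have := mem_rodDomain_segment le_rfl hx ht
      simpa using this) (fun x hx =>
      ((contDiffAt_const.mul (hA x hx)).exp.sub (hf x hx).exp))
  have hAf : ∀ x ∈ rodDomain a b, Real.exp (2 * A x) = Real.exp (f x) + x.1 * κ x := by
    intro x hx
    have h1 := hκ' x hx
    simp only [hb x.2 hx.1, sub_self, zero_add] at h1
    linarith
  set δ := min (z₀ - a) (b - z₀) with hδ
  have hδa : δ ≤ z₀ - a := min_le_left _ _
  have hδb : δ ≤ b - z₀ := min_le_right _ _
  have hmem : ∀ z, |z - z₀| < δ → z ∈ Ioo a b := fun z hz => by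
    rw [abs_lt] at hz
    constructor <;> linarith [hz.1, hz.2]
  set G : MetricField := fun p => tridiag ![
      -Real.exp (-f (p 1 ^ 2 + p 2 ^ 2, p 3) - g (p 1 ^ 2 + p 2 ^ 2, p 3)),
      Real.exp (f (p 1 ^ 2 + p 2 ^ 2, p 3)) + κ (p 1 ^ 2 + p 2 ^ 2, p 3) * p 1 ^ 2,
      Real.exp (f (p 1 ^ 2 + p 2 ^ 2, p 3)) + κ (p 1 ^ 2 + p 2 ^ 2, p 3) * p 2 ^ 2,
      Real.exp (2 * A (p 1 ^ 2 + p 2 ^ 2, p 3)),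
      Real.exp (g (p 1 ^ 2 + p 2 ^ 2, p 3))]
    ![0, κ (p 1 ^ 2 + p 2 ^ 2, p 3) * p 1 * p 2, 0, 0] with hG
  set W : Set E := {p | p 1 ^ 2 + p 2 ^ 2 < δ ^ 2 ∧ |p 3 - z₀| < δ} with hW
  have hdom : ∀ p ∈ W, (p 1 ^ 2 + p 2 ^ 2, p 3) ∈ rodDomain a b := fun p hp =>
    mem_rodDomain_of_nonneg (by positivity) (hmem _ hp.2).1 (hmem _ hp.2).2
  refine ⟨δ, lt_min (by linarith [hz₀.1]) (by linarith [hz₀.2]), G, ⟨?_, fun q hq => ?_,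
    isLorentzianOn_of_contDiffAt (fun p hp => ?_) (fun p => tridiag_isSymm _ _) fun p hp => ?_,
    fun q hq => ?_⟩, fun p hp s => ?_, fun p hp s => ?_⟩
  · exact IsOpen.and (isOpen_lt (by fun_prop) continuous_const)
      (isOpen_lt (by fun_prop) continuous_const)
  · obtain ⟨h1, h2, h3⟩ := hq
    have hr := (radial_identities (Real.sin_sq_add_cos_sq (q i.index)) (q 1) 0 0).2.2
    have : axisChart i q 1 ^ 2 + axisChart i q 2 ^ 2 = q 1 ^ 2 := by
      rw [← hr]
      cases i <;> rfl
    refine ⟨?_, ?_⟩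
    · rw [this]
      exact pow_lt_pow_left₀ h2 h1.le two_ne_zero
    · cases i <;> exact h3
  · have hc : ContDiffAt ℝ ∞ (fun p : E => (p 1 ^ 2 + p 2 ^ 2, p 3)) p := by fun_prop
    have c1 := (hf _ (hdom p hp)).comp p hc
    have c2 := (hg _ (hdom p hp)).comp p hc
    have c3 := (hA _ (hdom p hp)).comp p hc
    have c4 := (hκ _ (hdom p hp)).comp p hc
    have key : ∀ {F₁ F₂ F₃ F₄ : E → ℝ}, ContDiffAt ℝ ∞ F₁ p → ContDiffAt ℝ ∞ F₂ p →
        ContDiffAt ℝ ∞ F₃ p → ContDiffAt ℝ ∞ F₄ p → ∀ i j, ContDiffAt ℝ ∞ (fun p : E => tridiag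
          ![-Real.exp (-F₁ p - F₂ p), Real.exp (F₁ p) + F₄ p * p 1 ^ 2,
            Real.exp (F₁ p) + F₄ p * p 2 ^ 2, Real.exp (2 * F₃ p), Real.exp (F₂ p)]
          ![0, F₄ p * p 1 * p 2, 0, 0] i j) p := by
      intro F₁ F₂ F₃ F₄ h1 h2 h3 h4
      apply contDiffAt_tridiag <;> fun_prop
    exact key c1 c2 c3 c4
  · have h1 := hAf _ (hdom p hp)
    have h2 : 0 < Real.exp (f (p 1 ^ 2 + p 2 ^ 2, p 3)) + κ (p 1 ^ 2 + p 2 ^ 2, p 3) *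
        (p 1 ^ 2 + p 2 ^ 2) := by
      rw [mul_comm, ← h1]
      positivity
    obtain ⟨h3, h4⟩ := radial_block_pos (Real.exp_pos _) h2
    refine signature_time_block ?_ rfl rfl ?_ ?_ ?_ ?_ <;> simp only [Matrix.cons_val]
    · rw [neg_lt_zero]
      positivity
    · exact h3
    · exact h4
    · positivity
    · ring_nf
      positivity
  · obtain ⟨h1, h2, h3⟩ := hq
    refine pullback_eq (weylMetric_isSymm _ _ _ _) (tridiag_isSymm _ _) fun w => ?_
    obtain ⟨r1, r2, r3⟩ := radial_identities (Real.sin_sq_add_cos_sq (q i.index)) (q 1) (w 1)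
      (w i.index)
    have hz := hmem _ h3
    have hq1 : 0 < q 1 ^ 2 := by positivity
    obtain ⟨e1, e2, e3⟩ := h (q 1) (q 2) h1 hz
    have e4 := hAf (q 1 ^ 2, q 2) (mem_rodDomain_of_nonneg hq1.le hz.1 hz.2)
    have hB : axisChart i q 0 = q 0 ∧ axisChart i q 1 = q 1 * Real.cos (q i.index) ∧
        axisChart i q 2 = q 1 * Real.sin (q i.index) ∧ axisChart i q 3 = q 2 := by
      cases i <;> exact ⟨rfl, rfl, rfl, rfl⟩
    rw [quad_weylMetric_fiber _ _ _ i, fderiv_axisChart, fderiv_id, hG]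
    simp only [id, quad_tridiag, hB, Matrix.cons_val, r3, e1, e2, e3, ContinuousLinearMap.id_apply]
    rw [e4, show -(Real.log (q 1 ^ 2) + f (q 1 ^ 2, q 2)) - g (q 1 ^ 2, q 2) =
      (-f (q 1 ^ 2, q 2) - g (q 1 ^ 2, q 2)) - Real.log (q 1 ^ 2) by ring, Real.exp_sub,
      Real.exp_add, Real.exp_log hq1, div_mul_cancel₀ _ hq1.ne']
    linear_combination (-Real.exp (f (q 1 ^ 2, q 2))) * r1 - κ (q 1 ^ 2, q 2) *
      (q 1 * Real.cos (q i.index) *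
        (Real.cos (q i.index) * w 1 - q 1 * Real.sin (q i.index) * w i.index) +
      q 1 * Real.sin (q i.index) *
        (Real.sin (q i.index) * w 1 + q 1 * Real.cos (q i.index) * w i.index) + q 1 * w 1) * r2
  · refine ⟨?_, ?_⟩
    · simpa [hW] using hp
    · simp [hG]
  · refine ⟨?_, ?_⟩
    · simpa [hW] using hp
    · simp [hG]

theorem exp_mul_exp_neg_self (x : ℝ) : Real.exp x * Real.exp (-x) = 1 := by
  rw [← Real.exp_add, add_neg_cancel, Real.exp_zero]

/-- The null block `n dX dY + (k / 4) (Y dX + X dY)²` is indefinite. -/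
theorem null_block_pos {n k X Y : ℝ} (hn : 0 < n) (h : 0 < n + k * (X * Y)) :
    0 < n / 2 + k * X * Y / 4 ∧
      0 < (n / 2 + k * X * Y / 4) ^ 2 - (k * Y ^ 2 / 4) * (k * X ^ 2 / 4) := by
  constructor
  · linarith
  · have := mul_pos hn h
    linarith

/-- The metric extends across a horizon rod. The surface gravity is `exp (-κ)`, where `κ` is the
constant value of `α + (u + v) / 2` on the rod. With `n = e^{-u-v} / c²` the part
`-e^{-u-v} ρ² dt² + e^{2α} dρ²` of the metric becomes `n dX dY + (κ' / 4) (Y dX + X dY)²` with a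
smooth function `κ'`. -/
theorem extendsAcrossHorizon {a b c : ℝ} (hc : 0 < c) {f g A : ℝ × ℝ → ℝ}
    (hf : ∀ x ∈ rodDomain a b, ContDiffAt ℝ ∞ f x) (hg : ∀ x ∈ rodDomain a b, ContDiffAt ℝ ∞ g x)
    (hA : ∀ x ∈ rodDomain a b, ContDiffAt ℝ ∞ A x)
    (h : ∀ ρ z, 0 < ρ → z ∈ Ioo a b →
      u ρ z = f (ρ ^ 2, z) ∧ v ρ z = g (ρ ^ 2, z) ∧ α ρ z = A (ρ ^ 2, z))
    (hb : ∀ z ∈ Ioo a b, Real.exp (2 * A (0, z)) = Real.exp (-f (0, z) - g (0, z)) / c ^ 2) :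
    ExtendsAcrossHorizon (weylMetric u v α) a b c := by
  obtain ⟨κ, hκ, hκ'⟩ := exists_hadamard_fst (isOpen_rodDomain a b)
    (Ψ := fun x => Real.exp (2 * A x) - Real.exp (-f x - g x) / c ^ 2) (fun x hx t ht => by
      have := mem_rodDomain_segment le_rfl hx ht
      simpa using this) (fun x hx =>
      ((contDiffAt_const.mul (hA x hx)).exp.sub (((hf x hx).neg.sub (hg x hx)).exp.div_const _)))
  have hAf : ∀ x ∈ rodDomain a b,
      Real.exp (2 * A x) = Real.exp (-f x - g x) / c ^ 2 + x.1 * κ x := by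
    intro x hx
    have h1 := hκ' x hx
    simp only [hb x.2 hx.1, sub_self, zero_add] at h1
    linarith
  set G : MetricField := fun p => tridiag ![
      κ (p 0 * p 1, p 2) * p 1 ^ 2 / 4, κ (p 0 * p 1, p 2) * p 0 ^ 2 / 4,
      Real.exp (2 * A (p 0 * p 1, p 2)), Real.exp (f (p 0 * p 1, p 2)),
      Real.exp (g (p 0 * p 1, p 2))]
    ![Real.exp (-f (p 0 * p 1, p 2) - g (p 0 * p 1, p 2)) / c ^ 2 / 2 +
      κ (p 0 * p 1, p 2) * p 0 * p 1 / 4, 0, 0, 0] with hG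
  set W : Set E := {p | (p 0 * p 1, p 2) ∈ rodDomain a b} with hW
  have hsm : ∀ p ∈ W, ∀ i j, ContDiffAt ℝ ∞ (fun p => G p i j) p := by
    intro p hp
    have hc : ContDiffAt ℝ ∞ (fun p : E => (p 0 * p 1, p 2)) p := by fun_prop
    have c1 := (hf _ hp).comp p hc
    have c2 := (hg _ hp).comp p hc
    have c3 := (hA _ hp).comp p hc
    have c4 := (hκ _ hp).comp p hc
    have key : ∀ {F₁ F₂ F₃ F₄ : E → ℝ}, ContDiffAt ℝ ∞ F₁ p → ContDiffAt ℝ ∞ F₂ p →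
        ContDiffAt ℝ ∞ F₃ p → ContDiffAt ℝ ∞ F₄ p → ∀ i j, ContDiffAt ℝ ∞ (fun p : E => tridiag
          ![F₄ p * p 1 ^ 2 / 4, F₄ p * p 0 ^ 2 / 4, Real.exp (2 * F₃ p), Real.exp (F₁ p),
            Real.exp (F₂ p)]
          ![Real.exp (-F₁ p - F₂ p) / c ^ 2 / 2 + F₄ p * p 0 * p 1 / 4, 0, 0, 0] i j) p := by
      intro F₁ F₂ F₃ F₄ h1 h2 h3 h4
      apply contDiffAt_tridiag <;> fun_prop
    exact key c1 c2 c3 c4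
  refine ⟨W, fun p hp => mem_rodDomain_of_nonneg hp.1 hp.2.1 hp.2.2, G, ⟨?_, fun q hq => ?_,
    isLorentzianOn_of_contDiffAt hsm (fun p => tridiag_isSymm _ _) fun p hp => ?_,
    fun q hq => ?_⟩, fun p hp s => ?_, fun p hp s => ?_, ⟨isKillingField_boost (fun p hp i j =>
      (hsm p hp i j).differentiableAt (by simp)) (fun p => tridiag_isSymm _ _)
      fun p s w => ?_, fun p hp h1 w hw => ?_, fun p hp h1 w hw => ?_⟩,
    timeIsBoost_horizonChart _ _⟩
  · exact (isOpen_rodDomain a b).preimage (by fun_prop : Continuous fun p : E => (p 0 * p 1, p 2))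
  · refine mem_rodDomain_of_nonneg ?_ hq.2.1 hq.2.2
    have := hq.1
    simp only [horizonChart, Matrix.cons_val]
    positivity
  · have h1 := hAf _ hp
    have h2 : 0 < Real.exp (-f (p 0 * p 1, p 2) - g (p 0 * p 1, p 2)) / c ^ 2 +
        κ (p 0 * p 1, p 2) * (p 0 * p 1) := by
      rw [mul_comm (κ _), ← h1]
      positivity
    obtain ⟨h3, h4⟩ := null_block_pos (by positivity) h2
    refine signature_null_block ?_ ?_ rfl rfl ?_ ?_ ?_ <;> simp only [Matrix.cons_val]
    · exact h3
    · exact h4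
    · positivity
    · ring_nf
      positivity
    · positivity
  · obtain ⟨h1, hz⟩ := hq
    refine pullback_eq (weylMetric_isSymm _ _ _ _) (tridiag_isSymm _ _) fun w => ?_
    obtain ⟨e1, e2, e3⟩ := h (q 1) (q 2) h1 hz
    have e4 := hAf (q 1 ^ 2, q 2) (mem_rodDomain_of_nonneg (sq_nonneg _) hz.1 hz.2)
    have hexp := exp_mul_exp_neg_self (c * q 0)
    have hB : q 1 * Real.exp (c * q 0) * (q 1 * Real.exp (-(c * q 0))) = q 1 ^ 2 := by
      linear_combination q 1 ^ 2 * hexp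
    rw [quad_weylMetric, fderiv_horizonChart, fderiv_id, hG]
    simp only [id, quad_tridiag, horizonChart, Matrix.cons_val, hB, e1, e2, e3,
      ContinuousLinearMap.id_apply]
    rw [e4]
    generalize Real.exp (c * q 0) = X at *
    generalize Real.exp (-(c * q 0)) = Y at *
    generalize κ (q 1 ^ 2, q 2) = k
    obtain ⟨n, hn⟩ : ∃ n, n = Real.exp (-f (q 1 ^ 2, q 2) - g (q 1 ^ 2, q 2)) / c ^ 2 := ⟨_, rfl⟩
    have hn' : Real.exp (-f (q 1 ^ 2, q 2) - g (q 1 ^ 2, q 2)) = n * c ^ 2 := by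
      rw [hn]
      field_simp
    rw [← hn, hn']
    linear_combination (-(n * (w 1 ^ 2 - c ^ 2 * q 1 ^ 2 * w 0 ^ 2)) -
      k * q 1 ^ 2 * w 1 ^ 2 * (X * Y + 1)) * hexp
  · refine ⟨?_, ?_⟩
    · simpa [hW] using hp
    · simp [hG]
  · refine ⟨?_, ?_⟩
    · simpa [hW] using hp
    · simp [hG]
  · have hexp := exp_mul_exp_neg_self (c * s)
    have hB : Real.exp (c * s) * p 0 * (Real.exp (-(c * s)) * p 1) = p 0 * p 1 := by
      linear_combination (p 0 * p 1) * hexp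
    rw [hG]
    simp only [quad_tridiag, boostFlow, Matrix.cons_val, hB]
    generalize Real.exp (c * s) = X at *
    generalize Real.exp (-(c * s)) = Y at *
    generalize κ (p 0 * p 1, p 2) = k
    generalize Real.exp (-f (p 0 * p 1, p 2) - g (p 0 * p 1, p 2)) / c ^ 2 = n
    linear_combination (n * w 0 * w 1 + k / 4 * (p 1 * w 0 + p 0 * w 1) ^ 2 * (X * Y + 1)) * hexp
  · simp [boost, hG, tridiag, dotProduct, Matrix.mulVec, Fin.sum_univ_five, h1, hw]
  · simp [boost, hG, tridiag, dotProduct, Matrix.mulVec, Fin.sum_univ_five, h1, hw]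

end Extension

/-! ### Extension across corners and poles -/

section Endpoints

variable {u v α : ℝ → ℝ → ℝ}

/-- Two functions which are positive and continuous at the origin are positive on a square. -/
theorem exists_box_pos {ε : ℝ} (hε : 0 < ε) {Ψ Φ : ℝ × ℝ → ℝ} (hΨ : ContinuousAt Ψ (0, 0))
    (hΦ : ContinuousAt Φ (0, 0)) (hΨ0 : 0 < Ψ (0, 0)) (hΦ0 : 0 < Φ (0, 0)) :
    ∃ δ > 0, 2 * δ ^ 2 ≤ ε ∧ ∀ x : ℝ × ℝ, |x.1| < 2 * δ ^ 2 → |x.2| < 2 * δ ^ 2 →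
      0 < Ψ x ∧ 0 < Φ x := by
  have h1 : ∀ᶠ x in 𝓝 ((0 : ℝ), (0 : ℝ)), 0 < Ψ x ∧ 0 < Φ x :=
    (hΨ.eventually (lt_mem_nhds hΨ0)).and (hΦ.eventually (lt_mem_nhds hΦ0))
  obtain ⟨r, hr, h2⟩ := Metric.eventually_nhds_iff.1 h1
  obtain ⟨δ, hδ, hδ2⟩ : ∃ δ > 0, 2 * δ ^ 2 = min ε r :=
    ⟨√(min ε r / 2), Real.sqrt_pos.2 (by positivity), by
      rw [Real.sq_sqrt (by positivity)]
      ring⟩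
  refine ⟨δ, hδ, hδ2.le.trans (min_le_left _ _), fun x hx1 hx2 => h2 ?_⟩
  rw [hδ2] at hx1 hx2
  rw [Prod.dist_eq, Real.dist_eq, Real.dist_eq, sub_zero, sub_zero]
  exact max_lt (hx1.trans_le (min_le_right _ _)) (hx2.trans_le (min_le_right _ _))

/-- The metric extends across a corner at which two axis rods without conical singularity meet. Here
`p = ξ²` and `q = η²`, so that `e^{2α} (dρ² + dz²) = e^S (dξ² + dη²)`, and the two planes of the
coordinates are treated as at an axis rod. -/
theorem extendsAcrossCorner {z₀ σ ε : ℝ} (hε : 0 < ε) (hσ : σ ^ 2 = 1) {F G S : ℝ × ℝ → ℝ}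
    (hF : ∀ x ∈ Ioo (-ε) ε ×ˢ Ioo (-ε) ε, ContDiffAt ℝ ∞ F x)
    (hG : ∀ x ∈ Ioo (-ε) ε ×ˢ Ioo (-ε) ε, ContDiffAt ℝ ∞ G x)
    (hS : ∀ x ∈ Ioo (-ε) ε ×ˢ Ioo (-ε) ε, ContDiffAt ℝ ∞ S x)
    (h : ∀ ξ η : ℝ, 0 < ξ → 0 < η → ξ ^ 2 < ε → η ^ 2 < ε →
      u (ξ * η) (z₀ + σ * (ξ ^ 2 - η ^ 2) / 2) = Real.log (η ^ 2) + F (ξ ^ 2, η ^ 2) ∧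
      v (ξ * η) (z₀ + σ * (ξ ^ 2 - η ^ 2) / 2) = Real.log (ξ ^ 2) + G (ξ ^ 2, η ^ 2) ∧
      S (ξ ^ 2, η ^ 2) =
        2 * α (ξ * η) (z₀ + σ * (ξ ^ 2 - η ^ 2) / 2) + Real.log (ξ ^ 2 + η ^ 2))
    (hq : ∀ p ∈ Ioo 0 ε, S (p, 0) = F (p, 0)) (hp : ∀ q ∈ Ioo 0 ε, S (0, q) = G (0, q)) :
    ExtendsAcrossCorner (weylMetric u v α) z₀ σ := by
  obtain ⟨κ, hκ, hκ'⟩ := exists_hadamard_box_snd (δ := ε)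
    (Ψ := fun x => Real.exp (S x) - Real.exp (F x))
    (fun x hx => (hS x hx).exp.sub (hF x hx).exp)
  obtain ⟨μ, hμ, hμ'⟩ := exists_hadamard_box_fst (δ := ε)
    (Ψ := fun x => Real.exp (S x) - Real.exp (G x))
    (fun x hx => (hS x hx).exp.sub (hG x hx).exp)
  have h00 : ((0 : ℝ), (0 : ℝ)) ∈ Ioo (-ε) ε ×ˢ Ioo (-ε) ε := ⟨⟨by linarith, hε⟩, by linarith, hε⟩
  -- The determinants of the two blocks are positive at the origin, and hence near it.
  obtain ⟨δ, hδ, hδε, hpos⟩ := exists_box_pos hε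
    (Ψ := fun x => Real.exp (F x) + κ x * x.2) (Φ := fun x => Real.exp (G x) + μ x * x.1)
    ((hF _ h00).continuousAt.rexp.add ((hκ _ h00).continuousAt.mul continuousAt_snd))
    ((hG _ h00).continuousAt.rexp.add ((hμ _ h00).continuousAt.mul continuousAt_fst))
    (by simp only [mul_zero, add_zero]; positivity) (by simp only [mul_zero, add_zero]; positivity)
  set B : MetricField := fun p => tridiag ![
      -Real.exp (-F (p 3 ^ 2 + p 4 ^ 2, p 1 ^ 2 + p 2 ^ 2) -
        G (p 3 ^ 2 + p 4 ^ 2, p 1 ^ 2 + p 2 ^ 2)),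
      Real.exp (F (p 3 ^ 2 + p 4 ^ 2, p 1 ^ 2 + p 2 ^ 2)) +
        κ (p 3 ^ 2 + p 4 ^ 2, p 1 ^ 2 + p 2 ^ 2) * p 1 ^ 2,
      Real.exp (F (p 3 ^ 2 + p 4 ^ 2, p 1 ^ 2 + p 2 ^ 2)) +
        κ (p 3 ^ 2 + p 4 ^ 2, p 1 ^ 2 + p 2 ^ 2) * p 2 ^ 2,
      Real.exp (G (p 3 ^ 2 + p 4 ^ 2, p 1 ^ 2 + p 2 ^ 2)) +
        μ (p 3 ^ 2 + p 4 ^ 2, p 1 ^ 2 + p 2 ^ 2) * p 3 ^ 2,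
      Real.exp (G (p 3 ^ 2 + p 4 ^ 2, p 1 ^ 2 + p 2 ^ 2)) +
        μ (p 3 ^ 2 + p 4 ^ 2, p 1 ^ 2 + p 2 ^ 2) * p 4 ^ 2]
    ![0, κ (p 3 ^ 2 + p 4 ^ 2, p 1 ^ 2 + p 2 ^ 2) * p 1 * p 2, 0,
      μ (p 3 ^ 2 + p 4 ^ 2, p 1 ^ 2 + p 2 ^ 2) * p 3 * p 4] with hB
  set W : Set E := {p | p 1 ^ 2 + p 2 ^ 2 < δ ^ 2 ∧ p 3 ^ 2 + p 4 ^ 2 < δ ^ 2} with hW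
  have hδ2 : 0 < δ ^ 2 := by positivity
  have hbox : ∀ p ∈ W, (p 3 ^ 2 + p 4 ^ 2, p 1 ^ 2 + p 2 ^ 2) ∈ Ioo (-ε) ε ×ˢ Ioo (-ε) ε := by
    intro p hp
    refine ⟨⟨?_, ?_⟩, ⟨?_, ?_⟩⟩ <;> dsimp only <;>
      linarith [hp.1, hp.2, sq_nonneg (p 1), sq_nonneg (p 2), sq_nonneg (p 3), sq_nonneg (p 4)]
  refine ⟨δ, hδ, B, ⟨?_, fun q hq => ?_,
    isLorentzianOn_of_contDiffAt (fun p hp => ?_) (fun p => tridiag_isSymm _ _) fun p hp => ?_,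
    fun q hq => ?_⟩, fun p hp s => ?_⟩
  · exact IsOpen.and (isOpen_lt (by fun_prop) continuous_const)
      (isOpen_lt (by fun_prop) continuous_const)
  · obtain ⟨h1, h2, h3, h4⟩ := hq
    have r1 := (radial_identities (Real.sin_sq_add_cos_sq (q 3)) (q 2) 0 0).2.2
    have r2 := (radial_identities (Real.sin_sq_add_cos_sq (q 4)) (q 1) 0 0).2.2
    refine ⟨?_, ?_⟩
    · exact r1.trans_lt (pow_lt_pow_left₀ h4 h3.le two_ne_zero)
    · exact r2.trans_lt (pow_lt_pow_left₀ h2 h1.le two_ne_zero)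
  · have hc : ContDiffAt ℝ ∞ (fun p : E => (p 3 ^ 2 + p 4 ^ 2, p 1 ^ 2 + p 2 ^ 2)) p := by fun_prop
    have c1 := (hF _ (hbox p hp)).comp p hc
    have c2 := (hG _ (hbox p hp)).comp p hc
    have c3 := (hκ _ (hbox p hp)).comp p hc
    have c4 := (hμ _ (hbox p hp)).comp p hc
    have key : ∀ {F₁ F₂ F₃ F₄ : E → ℝ}, ContDiffAt ℝ ∞ F₁ p → ContDiffAt ℝ ∞ F₂ p →
        ContDiffAt ℝ ∞ F₃ p → ContDiffAt ℝ ∞ F₄ p → ∀ i j, ContDiffAt ℝ ∞ (fun p : E => tridiag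
          ![-Real.exp (-F₁ p - F₂ p), Real.exp (F₁ p) + F₃ p * p 1 ^ 2,
            Real.exp (F₁ p) + F₃ p * p 2 ^ 2, Real.exp (F₂ p) + F₄ p * p 3 ^ 2,
            Real.exp (F₂ p) + F₄ p * p 4 ^ 2]
          ![0, F₃ p * p 1 * p 2, 0, F₄ p * p 3 * p 4] i j) p := by
      intro F₁ F₂ F₃ F₄ h1 h2 h3 h4
      apply contDiffAt_tridiag <;> fun_prop
    exact key c1 c2 c3 c4
  · obtain ⟨h1, h2⟩ := hpos (p 3 ^ 2 + p 4 ^ 2, p 1 ^ 2 + p 2 ^ 2)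
      (by dsimp only; rw [abs_of_nonneg (by positivity)]; linarith [hp.2])
      (by dsimp only; rw [abs_of_nonneg (by positivity)]; linarith [hp.1])
    obtain ⟨h3, h4⟩ := radial_block_pos (Real.exp_pos _) h1
    obtain ⟨h5, h6⟩ := radial_block_pos (Real.exp_pos _) h2
    refine signature_time_block ?_ rfl rfl ?_ ?_ ?_ ?_ <;> simp only [Matrix.cons_val]
    · rw [neg_lt_zero]
      positivity
    · exact h3
    · exact h4
    · exact h5
    · exact h6
  · obtain ⟨h1, h2, h3, h4⟩ := hq
    refine pullback_eq (weylMetric_isSymm _ _ _ _) (tridiag_isSymm _ _) fun w => ?_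
    obtain ⟨r1, r2, r3⟩ := radial_identities (Real.sin_sq_add_cos_sq (q 3)) (q 2) (w 2) (w 3)
    obtain ⟨s1, s2, s3⟩ := radial_identities (Real.sin_sq_add_cos_sq (q 4)) (q 1) (w 1) (w 4)
    have hξ : 0 < q 1 ^ 2 := by positivity
    have hη : 0 < q 2 ^ 2 := by positivity
    have hξε : q 1 ^ 2 < ε := by
      have := pow_lt_pow_left₀ h2 h1.le two_ne_zero
      linarith
    have hηε : q 2 ^ 2 < ε := by
      have := pow_lt_pow_left₀ h4 h3.le two_ne_zero
      linarith
    have hx : (q 1 ^ 2, q 2 ^ 2) ∈ Ioo (-ε) ε ×ˢ Ioo (-ε) ε :=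
      ⟨⟨by linarith, hξε⟩, by linarith, hηε⟩
    obtain ⟨e1, e2, e3⟩ := h (q 1) (q 2) h1 h3 hξε hηε
    have e4 := hκ' _ hx
    have e5 := hμ' _ hx
    simp only [hq _ ⟨hξ, hξε⟩, hp _ ⟨hη, hηε⟩, sub_self, zero_add] at e4 e5
    have e6 : Real.exp (2 * α (q 1 * q 2) (z₀ + σ * (q 1 ^ 2 - q 2 ^ 2) / 2)) *
        (q 1 ^ 2 + q 2 ^ 2) = Real.exp (S (q 1 ^ 2, q 2 ^ 2)) := by
      rw [e3, Real.exp_add, Real.exp_log (by positivity)]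
    have e7 : Real.exp (-(Real.log (q 2 ^ 2) + F (q 1 ^ 2, q 2 ^ 2)) -
        (Real.log (q 1 ^ 2) + G (q 1 ^ 2, q 2 ^ 2))) * (q 1 * q 2) ^ 2 =
        Real.exp (-F (q 1 ^ 2, q 2 ^ 2) - G (q 1 ^ 2, q 2 ^ 2)) := by
      rw [show -(Real.log (q 2 ^ 2) + F (q 1 ^ 2, q 2 ^ 2)) -
        (Real.log (q 1 ^ 2) + G (q 1 ^ 2, q 2 ^ 2)) = (-F (q 1 ^ 2, q 2 ^ 2) -
        G (q 1 ^ 2, q 2 ^ 2)) - (Real.log (q 1 ^ 2) + Real.log (q 2 ^ 2)) by ring, Real.exp_sub,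
        Real.exp_add, Real.exp_log hξ, Real.exp_log hη, mul_pow,
        div_mul_cancel₀ _ (by positivity)]
    rw [quad_weylMetric, fderiv_cornerChart, fderiv_cornerWeyl, hB]
    simp only [quad_tridiag, cornerWeyl, cornerChart, Matrix.cons_val, r3, s3, e1, e2]
    rw [e7, Real.exp_add, Real.exp_add, Real.exp_log hξ, Real.exp_log hη]
    linear_combination (w 1 ^ 2 + w 2 ^ 2) * e6 + w 2 ^ 2 * e4 + w 1 ^ 2 * e5 +
      (Real.exp (2 * α (q 1 * q 2) (z₀ + σ * (q 1 ^ 2 - q 2 ^ 2) / 2)) *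
        (q 1 * w 1 - q 2 * w 2) ^ 2) * hσ -
      Real.exp (F (q 1 ^ 2, q 2 ^ 2)) * r1 - Real.exp (G (q 1 ^ 2, q 2 ^ 2)) * s1 -
      κ (q 1 ^ 2, q 2 ^ 2) * (q 2 * Real.cos (q 3) *
        (Real.cos (q 3) * w 2 - q 2 * Real.sin (q 3) * w 3) + q 2 * Real.sin (q 3) *
        (Real.sin (q 3) * w 2 + q 2 * Real.cos (q 3) * w 3) + q 2 * w 2) * r2 -
      μ (q 1 ^ 2, q 2 ^ 2) * (q 1 * Real.cos (q 4) *
        (Real.cos (q 4) * w 1 - q 1 * Real.sin (q 4) * w 4) + q 1 * Real.sin (q 4) *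
        (Real.sin (q 4) * w 1 + q 1 * Real.cos (q 4) * w 4) + q 1 * w 1) * s2
  · refine ⟨?_, ?_⟩
    · simpa [hW] using hp
    · simp [hB]

/-- The metric extends across a pole of a horizon rod of surface gravity `c`. Here `p = 2 ξ²` and
`q = 2 η²`, so that `e^{2α} (dρ² + dz²) = 2 e^S (dξ² + dη²)`. The part with `dη` is treated as at
an axis rod, and the part with `dξ` as at a horizon rod. -/
theorem extendsAcrossPole {i : Angle} {z₀ σ c ε : ℝ} (hε : 0 < ε) (hσ : σ ^ 2 = 1) (hc : 0 < c)
    {F G S : ℝ × ℝ → ℝ}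
    (hF : ∀ x ∈ Ioo (-ε) ε ×ˢ Ioo (-ε) ε, ContDiffAt ℝ ∞ F x)
    (hG : ∀ x ∈ Ioo (-ε) ε ×ˢ Ioo (-ε) ε, ContDiffAt ℝ ∞ G x)
    (hS : ∀ x ∈ Ioo (-ε) ε ×ˢ Ioo (-ε) ε, ContDiffAt ℝ ∞ S x)
    (h : ∀ ξ η : ℝ, 0 < ξ → 0 < η → 2 * ξ ^ 2 < ε → 2 * η ^ 2 < ε →
      fiber u v i (2 * ξ * η) (z₀ + σ * (ξ ^ 2 - η ^ 2)) =
        Real.log (2 * η ^ 2) + F (2 * ξ ^ 2, 2 * η ^ 2) ∧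
      fiber u v i.other (2 * ξ * η) (z₀ + σ * (ξ ^ 2 - η ^ 2)) = G (2 * ξ ^ 2, 2 * η ^ 2) ∧
      S (2 * ξ ^ 2, 2 * η ^ 2) =
        2 * α (2 * ξ * η) (z₀ + σ * (ξ ^ 2 - η ^ 2)) + Real.log (2 * ξ ^ 2 + 2 * η ^ 2))
    (hq : ∀ p ∈ Ioo 0 ε, S (p, 0) = F (p, 0))
    (hp : ∀ q ∈ Ioo 0 ε, Real.exp (S (0, q)) = Real.exp (-F (0, q) - G (0, q)) / c ^ 2) :
    ExtendsAcrossPole (weylMetric u v α) i z₀ σ c := by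
  obtain ⟨κ, hκ, hκ'⟩ := exists_hadamard_box_snd (δ := ε)
    (Ψ := fun x => Real.exp (S x) - Real.exp (F x))
    (fun x hx => (hS x hx).exp.sub (hF x hx).exp)
  obtain ⟨μ, hμ, hμ'⟩ := exists_hadamard_box_fst (δ := ε)
    (Ψ := fun x => Real.exp (S x) - Real.exp (-F x - G x) / c ^ 2)
    (fun x hx => (hS x hx).exp.sub (((hF x hx).neg.sub (hG x hx)).exp.div_const _))
  have h00 : ((0 : ℝ), (0 : ℝ)) ∈ Ioo (-ε) ε ×ˢ Ioo (-ε) ε := ⟨⟨by linarith, hε⟩, by linarith, hε⟩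
  -- The determinants of the two blocks are positive at the origin, and hence near it.
  obtain ⟨δ, hδ, hδε, hpos⟩ := exists_box_pos hε
    (Ψ := fun x => Real.exp (F x) + κ x * x.2)
    (Φ := fun x => Real.exp (-F x - G x) / c ^ 2 + μ x * x.1)
    ((hF _ h00).continuousAt.rexp.add ((hκ _ h00).continuousAt.mul continuousAt_snd))
    ((((hF _ h00).continuousAt.neg.sub (hG _ h00).continuousAt).rexp.div_const _).add
      ((hμ _ h00).continuousAt.mul continuousAt_fst))
    (by simp only [mul_zero, add_zero]; positivity) (by simp only [mul_zero, add_zero]; positivity)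
  set B : MetricField := fun p => tridiag ![
      μ (2 * (p 0 * p 1), 2 * (p 2 ^ 2 + p 3 ^ 2)) * p 1 ^ 2,
      μ (2 * (p 0 * p 1), 2 * (p 2 ^ 2 + p 3 ^ 2)) * p 0 ^ 2,
      2 * Real.exp (F (2 * (p 0 * p 1), 2 * (p 2 ^ 2 + p 3 ^ 2))) +
        4 * κ (2 * (p 0 * p 1), 2 * (p 2 ^ 2 + p 3 ^ 2)) * p 2 ^ 2,
      2 * Real.exp (F (2 * (p 0 * p 1), 2 * (p 2 ^ 2 + p 3 ^ 2))) +
        4 * κ (2 * (p 0 * p 1), 2 * (p 2 ^ 2 + p 3 ^ 2)) * p 3 ^ 2,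
      Real.exp (G (2 * (p 0 * p 1), 2 * (p 2 ^ 2 + p 3 ^ 2)))]
    ![Real.exp (-F (2 * (p 0 * p 1), 2 * (p 2 ^ 2 + p 3 ^ 2)) -
        G (2 * (p 0 * p 1), 2 * (p 2 ^ 2 + p 3 ^ 2))) / c ^ 2 +
        μ (2 * (p 0 * p 1), 2 * (p 2 ^ 2 + p 3 ^ 2)) * p 0 * p 1, 0,
      4 * κ (2 * (p 0 * p 1), 2 * (p 2 ^ 2 + p 3 ^ 2)) * p 2 * p 3, 0] with hB
  set W : Set E := {p | |p 0 * p 1| < δ ^ 2 ∧ p 2 ^ 2 + p 3 ^ 2 < δ ^ 2} with hW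
  have hδ2 : 0 < δ ^ 2 := by positivity
  have hbox : ∀ p ∈ W,
      (2 * (p 0 * p 1), 2 * (p 2 ^ 2 + p 3 ^ 2)) ∈ Ioo (-ε) ε ×ˢ Ioo (-ε) ε := by
    intro p hp
    have := abs_lt.1 hp.1
    refine ⟨⟨?_, ?_⟩, ⟨?_, ?_⟩⟩ <;> dsimp only <;>
      linarith [hp.2, sq_nonneg (p 2), sq_nonneg (p 3), this.1, this.2]
  have hsm : ∀ p ∈ W, ∀ i j, ContDiffAt ℝ ∞ (fun p => B p i j) p := by
    intro p hp
    have hc : ContDiffAt ℝ ∞ (fun p : E => (2 * (p 0 * p 1), 2 * (p 2 ^ 2 + p 3 ^ 2))) p := by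
      fun_prop
    have c1 := (hF _ (hbox p hp)).comp p hc
    have c2 := (hG _ (hbox p hp)).comp p hc
    have c3 := (hκ _ (hbox p hp)).comp p hc
    have c4 := (hμ _ (hbox p hp)).comp p hc
    have key : ∀ {F₁ F₂ F₃ F₄ : E → ℝ}, ContDiffAt ℝ ∞ F₁ p → ContDiffAt ℝ ∞ F₂ p →
        ContDiffAt ℝ ∞ F₃ p → ContDiffAt ℝ ∞ F₄ p → ∀ i j, ContDiffAt ℝ ∞ (fun p : E => tridiag
          ![F₄ p * p 1 ^ 2, F₄ p * p 0 ^ 2, 2 * Real.exp (F₁ p) + 4 * F₃ p * p 2 ^ 2,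
            2 * Real.exp (F₁ p) + 4 * F₃ p * p 3 ^ 2, Real.exp (F₂ p)]
          ![Real.exp (-F₁ p - F₂ p) / c ^ 2 + F₄ p * p 0 * p 1, 0, 4 * F₃ p * p 2 * p 3, 0] i j)
          p := by
      intro F₁ F₂ F₃ F₄ h1 h2 h3 h4
      apply contDiffAt_tridiag <;> fun_prop
    exact key c1 c2 c3 c4
  refine ⟨δ, hδ, B, ⟨?_, fun q hq => ?_,
    isLorentzianOn_of_contDiffAt hsm (fun p => tridiag_isSymm _ _) fun p hp => ?_,
    fun q hq => ?_⟩, fun p hp s => ?_, ⟨isKillingField_boost (fun p hp i j =>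
      (hsm p hp i j).differentiableAt (by simp)) (fun p => tridiag_isSymm _ _)
      fun p s w => ?_, fun p hp h1 w hw => ?_, fun p hp h1 w hw => ?_⟩,
    timeIsBoost_poleChart _ _ _⟩
  · exact IsOpen.and (isOpen_lt (by fun_prop) continuous_const)
      (isOpen_lt (by fun_prop) continuous_const)
  · obtain ⟨h1, h2, h3, h4⟩ := hq
    have hexp := exp_mul_exp_neg_self (c * q 0)
    have r1 := (radial_identities (Real.sin_sq_add_cos_sq (q i.index)) (q 2) 0 0).2.2
    have e1 : poleChart c i q 0 * poleChart c i q 1 = q 1 ^ 2 := by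
      have : q 1 * Real.exp (c * q 0) * (q 1 * Real.exp (-(c * q 0))) = q 1 ^ 2 := by
        linear_combination q 1 ^ 2 * hexp
      rw [← this]
      cases i <;> rfl
    have e2 : poleChart c i q 2 ^ 2 + poleChart c i q 3 ^ 2 = q 2 ^ 2 := by
      rw [← r1]
      cases i <;> rfl
    refine ⟨?_, ?_⟩
    · rw [e1, abs_of_nonneg (sq_nonneg _)]
      exact pow_lt_pow_left₀ h2 h1.le two_ne_zero
    · rw [e2]
      exact pow_lt_pow_left₀ h4 h3.le two_ne_zero
  · obtain ⟨h1, h2⟩ := hpos (2 * (p 0 * p 1), 2 * (p 2 ^ 2 + p 3 ^ 2))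
      (by dsimp only; rw [abs_mul, abs_two]; linarith [hp.1])
      (by dsimp only; rw [abs_of_nonneg (by positivity)]; linarith [hp.2])
    obtain ⟨h3, h4⟩ := radial_block_pos (x := p 2) (y := p 3)
      (e := 2 * Real.exp (F (2 * (p 0 * p 1), 2 * (p 2 ^ 2 + p 3 ^ 2))))
      (k := 4 * κ (2 * (p 0 * p 1), 2 * (p 2 ^ 2 + p 3 ^ 2))) (by positivity)
      (by linarith)
    obtain ⟨h5, h6⟩ := null_block_pos (X := p 0) (Y := p 1)
      (n := 2 * (Real.exp (-F (2 * (p 0 * p 1), 2 * (p 2 ^ 2 + p 3 ^ 2)) -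
        G (2 * (p 0 * p 1), 2 * (p 2 ^ 2 + p 3 ^ 2))) / c ^ 2))
      (k := 4 * μ (2 * (p 0 * p 1), 2 * (p 2 ^ 2 + p 3 ^ 2))) (by positivity)
      (by linarith)
    refine signature_null_block ?_ ?_ rfl rfl ?_ ?_ ?_ <;> simp only [Matrix.cons_val]
    · linarith
    · refine h6.trans_eq ?_
      ring
    · exact h3
    · exact h4
    · positivity
  · obtain ⟨h1, h2, h3, h4⟩ := hq
    refine pullback_eq (weylMetric_isSymm _ _ _ _) (tridiag_isSymm _ _) fun w => ?_
    obtain ⟨r1, r2, r3⟩ := radial_identities (Real.sin_sq_add_cos_sq (q i.index)) (q 2) (w 2)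
      (w i.index)
    have hexp := exp_mul_exp_neg_self (c * q 0)
    have hξ : 0 < 2 * q 1 ^ 2 := by positivity
    have hη : 0 < 2 * q 2 ^ 2 := by positivity
    have hξε : 2 * q 1 ^ 2 < ε := by
      have := pow_lt_pow_left₀ h2 h1.le two_ne_zero
      linarith
    have hηε : 2 * q 2 ^ 2 < ε := by
      have := pow_lt_pow_left₀ h4 h3.le two_ne_zero
      linarith
    have hx : (2 * q 1 ^ 2, 2 * q 2 ^ 2) ∈ Ioo (-ε) ε ×ˢ Ioo (-ε) ε :=
      ⟨⟨by linarith, hξε⟩, by linarith, hηε⟩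
    obtain ⟨e1, e2, e3⟩ := h (q 1) (q 2) h1 h3 hξε hηε
    have e4 := hκ' _ hx
    have e5 := hμ' _ hx
    simp only [hq _ ⟨hξ, hξε⟩, hp _ ⟨hη, hηε⟩, sub_self, zero_add] at e4 e5
    have e6 : Real.exp (2 * α (2 * q 1 * q 2) (z₀ + σ * (q 1 ^ 2 - q 2 ^ 2))) *
        (2 * q 1 ^ 2 + 2 * q 2 ^ 2) = Real.exp (S (2 * q 1 ^ 2, 2 * q 2 ^ 2)) := by
      rw [e3, Real.exp_add, Real.exp_log (by positivity)]
    obtain ⟨n, hn⟩ : ∃ n, n = Real.exp (-F (2 * q 1 ^ 2, 2 * q 2 ^ 2) -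
        G (2 * q 1 ^ 2, 2 * q 2 ^ 2)) / c ^ 2 := ⟨_, rfl⟩
    have e7 : Real.exp (-(Real.log (2 * q 2 ^ 2) + F (2 * q 1 ^ 2, 2 * q 2 ^ 2)) -
        G (2 * q 1 ^ 2, 2 * q 2 ^ 2)) * (2 * q 1 * q 2) ^ 2 = 2 * q 1 ^ 2 * (n * c ^ 2) := by
      rw [show -(Real.log (2 * q 2 ^ 2) + F (2 * q 1 ^ 2, 2 * q 2 ^ 2)) -
        G (2 * q 1 ^ 2, 2 * q 2 ^ 2) = (-F (2 * q 1 ^ 2, 2 * q 2 ^ 2) -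
        G (2 * q 1 ^ 2, 2 * q 2 ^ 2)) - Real.log (2 * q 2 ^ 2) by ring, Real.exp_sub,
        Real.exp_log hη, hn]
      field_simp
    have hB' : poleChart c i q 0 = q 1 * Real.exp (c * q 0) ∧
        poleChart c i q 1 = q 1 * Real.exp (-(c * q 0)) ∧
        poleChart c i q 2 = q 2 * Real.cos (q i.index) ∧
        poleChart c i q 3 = q 2 * Real.sin (q i.index) := by
      cases i <;> exact ⟨rfl, rfl, rfl, rfl⟩
    have hA' : poleWeyl z₀ σ q 1 = 2 * q 1 * q 2 ∧
        poleWeyl z₀ σ q 2 = z₀ + σ * (q 1 ^ 2 - q 2 ^ 2) := ⟨rfl, rfl⟩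
    have hXY : q 1 * Real.exp (c * q 0) * (q 1 * Real.exp (-(c * q 0))) = q 1 ^ 2 := by
      linear_combination q 1 ^ 2 * hexp
    have hw : (fderiv ℝ (poleWeyl z₀ σ) q w) i.index = w i.index ∧
        (fderiv ℝ (poleWeyl z₀ σ) q w) i.other.index = w i.other.index := by
      rw [fderiv_poleWeyl]
      cases i <;> exact ⟨rfl, rfl⟩
    rw [quad_weylMetric_fiber _ _ _ i, hw.1, hw.2, fderiv_poleChart, fderiv_poleWeyl, hB]
    simp only [quad_tridiag, hA', hB', Matrix.cons_val, r3, hXY, e1, e2]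
    rw [e7, Real.exp_add, Real.exp_log hη]
    rw [← hn] at e5 ⊢
    generalize Real.exp (c * q 0) = X at *
    generalize Real.exp (-(c * q 0)) = Y at *
    generalize κ (2 * q 1 ^ 2, 2 * q 2 ^ 2) = k at *
    generalize μ (2 * q 1 ^ 2, 2 * q 2 ^ 2) = l at *
    linear_combination 2 * (w 1 ^ 2 + w 2 ^ 2) * e6 + 2 * w 2 ^ 2 * e4 + 2 * w 1 ^ 2 * e5 +
      4 * (Real.exp (2 * α (2 * q 1 * q 2) (z₀ + σ * (q 1 ^ 2 - q 2 ^ 2))) *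
        (q 1 * w 1 - q 2 * w 2) ^ 2) * hσ -
      2 * Real.exp (F (2 * q 1 ^ 2, 2 * q 2 ^ 2)) * r1 -
      4 * k * (q 2 * Real.cos (q i.index) *
        (Real.cos (q i.index) * w 2 - q 2 * Real.sin (q i.index) * w i.index) +
        q 2 * Real.sin (q i.index) *
        (Real.sin (q i.index) * w 2 + q 2 * Real.cos (q i.index) * w i.index) + q 2 * w 2) * r2 -
      (2 * n * (w 1 ^ 2 - c ^ 2 * q 1 ^ 2 * w 0 ^ 2) +
      4 * l * q 1 ^ 2 * w 1 ^ 2 * (X * Y + 1)) * hexp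
  · refine ⟨?_, ?_⟩
    · simpa [hW] using hp
    · simp [hB]
  · have hexp := exp_mul_exp_neg_self (c * s)
    have hXY : Real.exp (c * s) * p 0 * (Real.exp (-(c * s)) * p 1) = p 0 * p 1 := by
      linear_combination (p 0 * p 1) * hexp
    rw [hB]
    simp only [quad_tridiag, boostFlow, Matrix.cons_val, hXY]
    generalize Real.exp (c * s) = X at *
    generalize Real.exp (-(c * s)) = Y at *
    generalize μ (2 * (p 0 * p 1), 2 * (p 2 ^ 2 + p 3 ^ 2)) = k
    generalize Real.exp (-F (2 * (p 0 * p 1), 2 * (p 2 ^ 2 + p 3 ^ 2)) -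
        G (2 * (p 0 * p 1), 2 * (p 2 ^ 2 + p 3 ^ 2))) / c ^ 2 = n
    linear_combination (2 * n * w 0 * w 1 + k * (p 1 * w 0 + p 0 * w 1) ^ 2 * (X * Y + 1)) * hexp
  · simp [boost, hB, tridiag, dotProduct, Matrix.mulVec, Fin.sum_univ_five, h1, hw]
  · simp [boost, hB, tridiag, dotProduct, Matrix.mulVec, Fin.sum_univ_five, h1, hw]

end Endpoints

/-! ### Regularity of balanced solutions -/

section Regularity

variable {D : RodDiagram} {U V A : ℝ × ℝ → ℝ} {u v α : ℝ → ℝ → ℝ} {κ μ : ℝ}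

theorem RodForm.extendsAcrossAxis {i : Angle} {a b z₀ : ℝ} {f g A' : ℝ × ℝ → ℝ}
    (hform : RodForm (.axis i) a b 0 U V A f g A') (hz₀ : z₀ ∈ Ioo a b)
    (h : ∀ ρ z, 0 < ρ → u ρ z = U (ρ ^ 2, z) ∧ v ρ z = V (ρ ^ 2, z) ∧ α ρ z = A (ρ ^ 2, z)) :
    ExtendsAcrossAxis (weylMetric u v α) i z₀ := by
  have hmem : ∀ {ρ z}, z ∈ Ioo a b → (ρ ^ 2, z) ∈ rodDomain a b := fun hz =>
    mem_rodDomain_of_nonneg (sq_nonneg _) hz.1 hz.2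
  cases i
  · refine StaticWeyl.extendsAcrossAxis hz₀ hform.smooth_fst hform.smooth_snd hform.smooth
      (fun ρ z hρ hz => ⟨?_, ?_, ?_⟩) fun z hz => ?_
    · rw [fiber, (h ρ z hρ).1, hform.fst_eq _ (hmem hz) (pow_pos hρ 2)]
      simp [RodKind.weight]
    · rw [Angle.other, fiber, (h ρ z hρ).2.1, hform.snd_eq _ (hmem hz) (pow_pos hρ 2)]
      simp [RodKind.weight]
    · rw [(h ρ z hρ).2.2, hform.eq _ (hmem hz) (pow_pos hρ 2)]
    · rw [hform.boundary z hz]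
      simp [RodKind.weight, rodLinear]
      ring
  · refine StaticWeyl.extendsAcrossAxis hz₀ hform.smooth_snd hform.smooth_fst hform.smooth
      (fun ρ z hρ hz => ⟨?_, ?_, ?_⟩) fun z hz => ?_
    · rw [fiber, (h ρ z hρ).2.1, hform.snd_eq _ (hmem hz) (pow_pos hρ 2)]
      simp [RodKind.weight]
    · rw [Angle.other, fiber, (h ρ z hρ).1, hform.fst_eq _ (hmem hz) (pow_pos hρ 2)]
      simp [RodKind.weight]
    · rw [(h ρ z hρ).2.2, hform.eq _ (hmem hz) (pow_pos hρ 2)]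
    · rw [hform.boundary z hz]
      simp [RodKind.weight, rodLinear]
      ring

/-- The boundary identity for `α` on a horizon rod, with the surface gravity `exp (-κ)`. -/
theorem exp_surface_gravity (κ x y : ℝ) :
    Real.exp (2 * (-(x + y) / 2 + κ)) = Real.exp (-x - y) / Real.exp (-κ) ^ 2 := by
  rw [eq_div_iff (by positivity), ← Real.exp_nat_mul, ← Real.exp_add]
  congr 1
  push_cast
  ring

theorem RodForm.extendsAcrossHorizon {a b : ℝ} {f g A' : ℝ × ℝ → ℝ}
    (hform : RodForm .horizon a b κ U V A f g A')
    (h : ∀ ρ z, 0 < ρ → u ρ z = U (ρ ^ 2, z) ∧ v ρ z = V (ρ ^ 2, z) ∧ α ρ z = A (ρ ^ 2, z)) :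
    ExtendsAcrossHorizon (weylMetric u v α) a b (Real.exp (-κ)) := by
  have hmem : ∀ {ρ z}, z ∈ Ioo a b → (ρ ^ 2, z) ∈ rodDomain a b := fun hz =>
    mem_rodDomain_of_nonneg (sq_nonneg _) hz.1 hz.2
  refine StaticWeyl.extendsAcrossHorizon (Real.exp_pos _) hform.smooth_fst hform.smooth_snd
    hform.smooth (fun ρ z hρ hz => ⟨?_, ?_, ?_⟩) fun z hz => ?_
  · rw [(h ρ z hρ).1, hform.fst_eq _ (hmem hz) (pow_pos hρ 2)]
    simp [RodKind.weight]
  · rw [(h ρ z hρ).2.1, hform.snd_eq _ (hmem hz) (pow_pos hρ 2)]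
    simp [RodKind.weight]
  · rw [(h ρ z hρ).2.2, hform.eq _ (hmem hz) (pow_pos hρ 2)]
  · rw [hform.boundary z hz, ← exp_surface_gravity]
    congr 1
    simp [RodKind.weight, rodLinear]
    ring

theorem EndpointForm.extendsAcrossCorner {z₀ σ ε : ℝ} {F G S : ℝ × ℝ → ℝ} (hσ : σ ^ 2 = 1)
    (hform : EndpointForm z₀ σ ε (.axis .psi) (.axis .phi) 0 0 U V A F G S)
    (h : ∀ ρ z, 0 < ρ → u ρ z = U (ρ ^ 2, z) ∧ v ρ z = V (ρ ^ 2, z) ∧ α ρ z = A (ρ ^ 2, z)) :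
    ExtendsAcrossCorner (weylMetric u v α) z₀ σ := by
  refine StaticWeyl.extendsAcrossCorner hform.pos hσ hform.smooth_fst hform.smooth_snd
    hform.smooth (fun ξ η hξ hη hξε hηε => ?_) (fun p hp => ?_) fun q hq => ?_
  · have hx : (ξ ^ 2, η ^ 2) ∈ Ioo 0 ε ×ˢ Ioo 0 ε := ⟨⟨by positivity, hξε⟩, by positivity, hηε⟩
    have hpar : parabolic z₀ σ (ξ ^ 2, η ^ 2) =
        ((ξ * η) ^ 2, z₀ + σ * (ξ ^ 2 - η ^ 2) / 2) := by
      simp only [parabolic, mul_pow]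
    obtain ⟨e1, e2, e3⟩ := h (ξ * η) (z₀ + σ * (ξ ^ 2 - η ^ 2) / 2) (by positivity)
    rw [e1, e2, e3, ← hpar, hform.fst_eq _ hx, hform.snd_eq _ hx, hform.eq _ hx]
    simp [RodKind.weight]
  · rw [hform.boundary_snd p hp]
    simp [RodKind.weight, rodLinear]
    ring
  · rw [hform.boundary_fst q hq]
    simp [RodKind.weight, rodLinear]
    ring

theorem EndpointForm.extendsAcrossPole {i : Angle} {z₀ σ ε : ℝ} {F G S : ℝ × ℝ → ℝ}
    (hσ : σ ^ 2 = 1) (hform : EndpointForm z₀ σ ε .horizon (.axis i) κ 0 U V A F G S)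
    (h : ∀ ρ z, 0 < ρ → u ρ z = U (ρ ^ 2, z) ∧ v ρ z = V (ρ ^ 2, z) ∧ α ρ z = A (ρ ^ 2, z)) :
    ExtendsAcrossPole (weylMetric u v α) i z₀ σ (Real.exp (-κ)) := by
  have hval : ∀ ξ η : ℝ, 0 < ξ → 0 < η → 2 * ξ ^ 2 < ε → 2 * η ^ 2 < ε →
      u (2 * ξ * η) (z₀ + σ * (ξ ^ 2 - η ^ 2)) =
        (RodKind.axis i).weight .phi * Real.log (2 * η ^ 2) + F (2 * ξ ^ 2, 2 * η ^ 2) ∧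
      v (2 * ξ * η) (z₀ + σ * (ξ ^ 2 - η ^ 2)) =
        (RodKind.axis i).weight .psi * Real.log (2 * η ^ 2) + G (2 * ξ ^ 2, 2 * η ^ 2) ∧
      S (2 * ξ ^ 2, 2 * η ^ 2) =
        2 * α (2 * ξ * η) (z₀ + σ * (ξ ^ 2 - η ^ 2)) + Real.log (2 * ξ ^ 2 + 2 * η ^ 2) := by
    intro ξ η hξ hη hξε hηε
    have hx : (2 * ξ ^ 2, 2 * η ^ 2) ∈ Ioo 0 ε ×ˢ Ioo 0 ε :=
      ⟨⟨by positivity, hξε⟩, by positivity, hηε⟩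
    have hpar : parabolic z₀ σ (2 * ξ ^ 2, 2 * η ^ 2) =
        ((2 * ξ * η) ^ 2, z₀ + σ * (ξ ^ 2 - η ^ 2)) := by
      simp only [parabolic, Prod.mk.injEq]
      constructor <;> ring
    obtain ⟨e1, e2, e3⟩ := h (2 * ξ * η) (z₀ + σ * (ξ ^ 2 - η ^ 2)) (by positivity)
    rw [e1, e2, e3, ← hpar, hform.fst_eq _ hx, hform.snd_eq _ hx, hform.eq _ hx]
    simp [RodKind.weight]
  have hgrav : ∀ q ∈ Ioo 0 ε, Real.exp (S (0, q)) =
      Real.exp (-F (0, q) - G (0, q)) / Real.exp (-κ) ^ 2 := fun q hq => by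
    rw [hform.boundary_fst q hq, ← exp_surface_gravity]
    congr 1
    simp [RodKind.weight, rodLinear]
    ring
  cases i
  · refine StaticWeyl.extendsAcrossPole hform.pos hσ (Real.exp_pos _) hform.smooth_fst
      hform.smooth_snd hform.smooth (fun ξ η hξ hη hξε hηε => ?_) (fun p hp => ?_) hgrav
    · obtain ⟨e1, e2, e3⟩ := hval ξ η hξ hη hξε hηε
      refine ⟨?_, ?_, e3⟩
      · rw [fiber, e1]
        simp [RodKind.weight]
      · rw [Angle.other, fiber, e2]
        simp [RodKind.weight]
    · rw [hform.boundary_snd p hp]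
      simp [RodKind.weight, rodLinear]
      ring
  · refine StaticWeyl.extendsAcrossPole hform.pos hσ (Real.exp_pos _) hform.smooth_snd
      hform.smooth_fst hform.smooth (fun ξ η hξ hη hξε hηε => ?_) (fun p hp => ?_) fun q hq => ?_
    · obtain ⟨e1, e2, e3⟩ := hval ξ η hξ hη hξε hηε
      refine ⟨?_, ?_, e3⟩
      · rw [fiber, e2]
        simp [RodKind.weight]
      · rw [Angle.other, fiber, e1]
        simp [RodKind.weight]
    · rw [hform.boundary_snd p hp]
      simp [RodKind.weight, rodLinear]
      ring
    · rw [hgrav q hq, show -F (0, q) - G (0, q) = -G (0, q) - F (0, q) by ring]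

theorem neBot_nhdsWithin_halfPlane (z : ℝ) : (𝓝[{x : ℝ × ℝ | 0 < x.1}] (0, z)).NeBot := by
  have h : Tendsto (fun s : ℝ => (s, z)) (𝓝[>] 0) (𝓝[{x : ℝ × ℝ | 0 < x.1}] (0, z)) := by
    refine tendsto_nhdsWithin_iff.2 ⟨?_, ?_⟩
    · exact ((by fun_prop : Continuous fun s : ℝ => (s, z)).tendsto 0).mono_left nhdsWithin_le_nhds
    · filter_upwards [self_mem_nhdsWithin] with s hs using hs
  exact h.neBot

/-- A balanced solution is regular if the rods tile a period and neighboring rods, in particular the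
last and the first one of a period, are of different kinds. -/
theorem isGeometricallyRegular_of_tiles {a : ℝ} {k : RodKind}
    (ht : Tiles a k D.cell (a + D.period) k) (hl : D.cell ≠ [])
    (hsol : IsBalancedSolution D u v α) : IsGeometricallyRegular D u v α := by
  have hD := ht.isSeparated hl
  obtain ⟨U, V, A, hW, h⟩ := exists_isWeylSolution hD hsol.potential_u hsol.potential_v
    hsol.quadrature
  have hzero : ∀ R ∈ D.rods, ∀ i, R.kind = .axis i → HasDefect U V A R 0 := fun R hR i hi =>
    hW.hasDefect_zero hD (fun ρ z hρ => (h ρ z hρ).1) (fun ρ z hρ => (h ρ z hρ).2.1)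
      (fun ρ z hρ => (h ρ z hρ).2.2) hsol.balanced hR hi
  refine ⟨ht.exists_rod_mem_Icc hl, fun R hR => ht.exists_rod_neighbors hl hR,
    isLorentzianOn_weylMetric (fun x hx => (hW.isAxiHarmonicAt_fst hD hx).1)
      (fun x hx => (hW.isAxiHarmonicAt_snd hD hx).1) (fun x hx => hW.contDiffAt hD hx) h,
    fun R hR i hi z hz => ?_, fun R hR R' hR' hRR' i j hi hj => ⟨?_, ?_⟩, fun R hR hRk => ?_⟩
  · obtain ⟨κ, hκ, f, g, A', hform⟩ := hW.exists_rodForm hD hR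
    have := neBot_nhdsWithin_halfPlane z
    have h0 : κ = 0 := tendsto_nhds_unique (hκ z hz) (hzero R hR i hi z hz)
    rw [h0, hi] at hform
    exact hform.extendsAcrossAxis hz h
  · have := ht.rod_kind_ne hl hR hR' hRR'
    rw [hi, hj] at this
    rintro rfl
    exact this rfl
  · have hkind := ht.rod_kind_ne hl hR hR' hRR'
    rw [hi, hj] at hkind
    -- The rod of kind `φ` lies to the north of the corner if and only if `j = φ`.
    by_cases hphi : j = .phi
    · have hpsi : i = .psi := by
        cases i
        · exact absurd (by rw [hphi]) hkind
        · rfl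
      rw [if_pos hphi]
      subst hphi hpsi
      obtain ⟨ε, F, G, S, hform⟩ := hW.exists_endpointForm hD hR hR' (z₀ := R.b) (σ := 1)
        (Or.inl ⟨rfl, rfl, hRR'.symm⟩) (by rw [hi, hj]; exact hkind) (hzero R hR _ hi)
        (hzero R' hR' _ hj)
      rw [hi, hj] at hform
      exact hform.extendsAcrossCorner (by norm_num) h
    · have hpsi : j = .psi := by
        cases j
        · exact absurd rfl hphi
        · rfl
      have hphi' : i = .phi := by
        cases i
        · rfl
        · exact absurd (by rw [hpsi]) hkind
      rw [if_neg hphi]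
      subst hphi' hpsi
      obtain ⟨ε, F, G, S, hform⟩ := hW.exists_endpointForm hD hR' hR (z₀ := R.b) (σ := -1)
        (Or.inr ⟨rfl, rfl, hRR'.symm⟩) (by rw [hi, hj]; exact hkind.symm) (hzero R' hR' _ hj)
        (hzero R hR _ hi)
      rw [hi, hj] at hform
      exact hform.extendsAcrossCorner (by norm_num) h
  · obtain ⟨κ, hκ, f, g, A', hform⟩ := hW.exists_rodForm hD hR
    rw [hRk] at hform
    obtain ⟨⟨N, hN, hNa⟩, ⟨T, hT, hTb⟩⟩ := ht.exists_rod_neighbors hl hR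
    have haxis : ∀ {k : RodKind}, k ≠ .horizon → ∃ i, k = .axis i := by
      rintro (i | _) hk
      · exact ⟨i, rfl⟩
      · exact absurd rfl hk
    have hkN := ht.rod_kind_ne hl hR hN hNa.symm
    have hkT := ht.rod_kind_ne hl hT hR hTb
    obtain ⟨i, hi⟩ := haxis (hRk ▸ hkN.symm)
    obtain ⟨j, hj⟩ := haxis (hRk ▸ hkT)
    refine ⟨Real.exp (-κ), Real.exp_pos _, hform.extendsAcrossHorizon h,
      ⟨N, hN, hNa, i, hi, ?_⟩, ⟨T, hT, hTb, j, hj, ?_⟩⟩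
    · obtain ⟨ε, F, G, S, hform⟩ := hW.exists_endpointForm hD hR hN (z₀ := R.b) (σ := 1)
        (Or.inl ⟨rfl, rfl, hNa⟩) hkN hκ (hzero N hN _ hi)
      rw [hRk, hi] at hform
      exact hform.extendsAcrossPole (by norm_num) h
    · obtain ⟨ε, F, G, S, hform⟩ := hW.exists_endpointForm hD hR hT (z₀ := R.a) (σ := -1)
        (Or.inr ⟨rfl, hTb, rfl⟩) hkT.symm hκ (hzero T hT _ hj)
      rw [hRk, hj] at hform
      exact hform.extendsAcrossPole (by norm_num) h

end Regularity

end StaticWeyl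

theorem mainTheorem4 (e : StaticWeyl.Family) (L m : ℝ) (hm : 0 < m) (hmL : m < L) :
    (∃ u v α : ℝ → ℝ → ℝ, StaticWeyl.IsBalancedSolution (e.diagram L m) u v α) ∧
    ∀ u v α : ℝ → ℝ → ℝ, StaticWeyl.IsBalancedSolution (e.diagram L m) u v α →
      StaticWeyl.IsGeometricallyRegular (e.diagram L m) u v α := by
  obtain ⟨a, k, ht⟩ := e.exists_tiles hm hmL
  exact ⟨e.exists_isBalancedSolution hm hmL, fun u v α hsol =>
    StaticWeyl.isGeometricallyRegular_of_tiles ht e.cell_ne_nil hsol⟩
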